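/- Let $\mathbb F$ be a field of characteristic zero, let $m\ge 1$, and let $\mathfrak g_m=\mathfrak{sl}(2)\ltimes V(m)$, where $V(n)$ denotes the irreducible $\mathfrak{sl}(2)$-module of highest weight $n$ (of dimension $n+1$) and $V(m)$ is viewed as an abelian ideal. For $a\ge 0$ let $Z(a,1)=V(a)\oplus V(a+m)$ be the $\mathfrak g_m$-module on which $\mathfrak{sl}(2)$ acts on both summands, $V(m)$ annihilates $V(a)$, and $V(m)$ maps $V(a+m)$ to $V(a)$ through a nonzero $\mathfrak{sl}(2)$-homomorphism $V(m)\to\operatorname{Hom}(V(a+m),V(a))$ (unique up to a scalar). The uniserial modules of type $Z$ and length $2$ are those isomorphic to some $Z(a,1)$ or to some dual $Z(b,1)^*$. A socle decomposition of such a module $V$ is a decomposition $V=V(a)\oplus V(b)$ into $\mathfrak{sl}(2)$-submodules of the indicated isomorphism types with $V(a)=\operatorname{soc}(V)$; thus $b=a+m$ for $V\simeq Z(a,1)$ and $a=b+m$ for $V\simeq Z(b,1)^*$. **Theorem.** Let $V_1=V(a)\oplus V(b)$ and $V_2=V(c)\oplus V(d)$ be socle decompositions of two uniserial $\mathfrak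 g_m$-modules of type $Z$ and length $2$, and let $$S_1=\operatorname{soc}(V_1\otimes V_2)\cap\bigl(V(a)\otimes V(d)\,\oplus\,V(b)\otimes V(c)\bigr).$$ Then, as $\mathfrak{sl}(2)$-modules: 1. if $V_1\simeq Z(a,1)$ and $V_2\simeq Z(c,1)$, then $S_1\simeq V(a+d)$; 2. if $V_1\simeq Z(a,1)$ and $V_2\simeq Z(d,1)^*$, then $S_1\simeq V(d-a)$ if $a\le d$, and $S_1=0$ if $a>d$; 3. if $V_1\simeq Z(b,1)^*$ and $V_2\simeq Z(c,1)$, then $S_1\simeq V(b-c)$ if $b\ge c$, and $S_1=0$ if $b<c$; 4. if $V_1\simeq Z(b,1)^*$ and $V_2\simeq Z(d,1)^*$, then $S_1=0$. Moreover, suppose that square roots $\sqrt x\in\mathbb F$ of the non-negative rational numbers are given with $\sqrt{xy}=\sqrt x\sqrt y$. Let $v_0^n,\dots,v_n^n$ be the basis of $V(n)$ with $e v_k^n=\sqrt{k(n-k+1)}\,v_{k-1}^n$, $h v_k^n=(n-2k)v_k^n$, $f v_k^n=\sqrt{(n-k)(k+1)}\,v_{k+1}^n$, let $CG(j_1,m_1;j_2,m_2\,|\,j_3,m_3)$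 be the Clebsch–Gordan coefficients, and put $$v_k^{a,b,c}=\sum_{i,j}CG\bigl(\tfrac a2,\tfrac a2-i;\tfrac b2,\tfrac b2-j\,\big|\,\tfrac c2,\tfrac c2-k\bigr)\,v_i^a\otimes v_j^b .$$ For $|a-b|=m$ the formula $$e_s\,v_j^b=(-1)^j\sum_{i=0}^a CG\bigl(\tfrac a2,\tfrac a2-i;\tfrac b2,-\tfrac b2+j\,\big|\,\tfrac m2,\tfrac m2-s\bigr)\,v_i^a,\qquad e_s=v_s^m,\quad 0\le s\le m,\ 0\le j\le b,$$ defines a unique $\mathfrak{sl}(2)$-homomorphism $V(m)\to\operatorname{Hom}(V(b),V(a))$, hence (with $V(m)$ annihilating $V(a)$) a $\mathfrak g_m$-module $E(a,b)$ with socle decomposition $V(a)\oplus V(b)$; one has $E(a,a+m)\simeq Z(a,1)$ and $E(b+m,b)\simeq Z(b,1)^*$. For $V_1=E(a,b)$ and $V_2=E(c,d)$, a highest weight vector of $S_1$, of weight $\mu$, is $$u_0=\sqrt{d+1}\;v_0^{a,d,\mu}-\sqrt{b+1}\;v_0^{b,c,\mu}$$ in case 1 (with $\mu=a+d=b+c$)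 and in case 2 with $a\le d$ (with $\mu=d-a=c-b$), and $$u_0=\sqrt{d+1}\;v_0^{a,d,\mu}-(-1)^m\sqrt{b+1}\;v_0^{b,c,\mu}$$ in case 3 with $b\ge c$ (with $\mu=a-d=b-c$). -/

import Mathlib

open scoped TensorProduct

noncomputable section

namespace UniserialSl2

universe u v w

/-! ### The Lie algebra `sl(2)` and its irreducible modules -/

/-- The Lie algebra `sl(2)` of traceless `2 × 2` matrices over `F`. -/
abbrev SL2 (F : Type u) [Field F] : Type u := LieAlgebra.SpecialLinear.sl (Fin 2) F

variable (F : Type u) [Field F]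

/-- The standard basis element `e` of `sl(2)`. -/
def sl2e : SL2 F := ⟨!![0, 1; 0, 0], by
  change Matrix.trace (_ : Matrix (Fin 2) (Fin 2) F) = 0
  simp [Matrix.trace_fin_two]⟩

/-- The standard basis element `h` of `sl(2)`. -/
def sl2h : SL2 F := ⟨!![1, 0; 0, -1], by
  change Matrix.trace (_ : Matrix (Fin 2) (Fin 2) F) = 0
  simp [Matrix.trace_fin_two]⟩

/-- The standard basis element `f` of `sl(2)`. -/
def sl2f : SL2 F := ⟨!![0, 0; 1, 0], by
  change Matrix.trace (_ : Matrix (Fin 2) (Fin 2) F) = 0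
  simp [Matrix.trace_fin_two]⟩

/-- The underlying space of the irreducible `sl(2)`-module `V(n)` of highest weight `n`.
Writing `w_0, …, w_n` for the coordinate basis, the action defined below is
`e w_k = (n - k + 1) w_{k-1}`, `h w_k = (n - 2k) w_k`, `f w_k = (k + 1) w_{k+1}`. -/
def Irr (n : ℕ) : Type u := Fin (n + 1) → F

variable {F}

instance (n : ℕ) : AddCommGroup (Irr F n) := inferInstanceAs (AddCommGroup (Fin (n + 1) → F))

instance (n : ℕ) : Module F (Irr F n) := inferInstanceAs (Module F (Fin (n + 1) → F))

/-- The `k`-th coordinate of `v ∈ V(n)`, extended by zero to all natural numbers `k`. -/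
def coord {n : ℕ} (v : Irr F n) (k : ℕ) : F := if h : k < n + 1 then v ⟨k, h⟩ else 0

/-- The action of `sl(2)` on `V(n)`, in coordinates. -/
def slAct {n : ℕ} (x : SL2 F) (v : Irr F n) : Irr F n := fun k =>
  x.1 0 1 * ((n : F) - (k.1 : F)) * coord v (k.1 + 1)
    + x.1 0 0 * ((n : F) - 2 * (k.1 : F)) * coord v k.1
    + x.1 1 0 * (k.1 : F) * coord v (k.1 - 1)

theorem Irr.ext_coord {n : ℕ} {v w : Irr F n} (h : ∀ k ≤ n, coord v k = coord w k) : v = w := by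
  funext k
  have := h k.1 (Nat.lt_succ_iff.mp k.2)
  simpa [coord, k.2] using this

theorem coord_add {n : ℕ} (v w : Irr F n) (k : ℕ) : coord (v + w) k = coord v k + coord w k := by
  unfold coord
  split_ifs
  · rfl
  · simp

theorem coord_smul {n : ℕ} (t : F) (v : Irr F n) (k : ℕ) : coord (t • v) k = t * coord v k := by
  unfold coord
  split_ifs
  · rfl
  · simp

theorem coord_of_lt {n : ℕ} (v : Irr F n) {k : ℕ} (h : n < k) : coord v k = 0 := by
  unfold coord
  rw [dif_neg (by omega)]

theorem coord_slAct {n : ℕ} (x : SL2 F) (v : Irr F n) {k : ℕ} (h : k ≤ n) :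
    coord (slAct x v) k = x.1 0 1 * ((n : F) - (k : F)) * coord v (k + 1)
      + x.1 0 0 * ((n : F) - 2 * (k : F)) * coord v k
      + x.1 1 0 * (k : F) * coord v (k - 1) := by
  rw [coord, dif_pos (Nat.lt_succ_of_le h)]
  rfl

theorem SL2.trace_eq (x : SL2 F) : x.1 1 1 = -x.1 0 0 := by
  have h : Matrix.trace x.1 = 0 := x.2
  rw [Matrix.trace_fin_two] at h
  linear_combination h

instance (n : ℕ) : LieRingModule (SL2 F) (Irr F n) where
  bracket := slAct
  add_lie x y v := by
    change slAct (x + y) v = slAct x v + slAct y v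
    refine Irr.ext_coord fun k hk => ?_
    rw [coord_add, coord_slAct _ _ hk, coord_slAct _ _ hk, coord_slAct _ _ hk]
    have h : ∀ i j, (x + y).1 i j = x.1 i j + y.1 i j := fun _ _ => rfl
    simp only [h]
    ring
  lie_add x v w := by
    refine Irr.ext_coord fun k hk => ?_
    rw [coord_add, coord_slAct _ _ hk, coord_slAct _ _ hk, coord_slAct _ _ hk]
    simp only [coord_add]
    ring
  leibniz_lie x y v := by
    change slAct x (slAct y v) = slAct ⁅x, y⁆ v + slAct y (slAct x v)
    refine Irr.ext_coord fun k hk => ?_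
    have key : ∀ z w : SL2 F, coord (slAct z (slAct w v)) k =
        z.1 0 1 * ((n : F) - (k : F)) * (w.1 0 1 * ((n : F) - ((k : F) + 1)) * coord v (k + 2)
          + w.1 0 0 * ((n : F) - 2 * ((k : F) + 1)) * coord v (k + 1)
          + w.1 1 0 * ((k : F) + 1) * coord v k)
        + z.1 0 0 * ((n : F) - 2 * (k : F)) * (w.1 0 1 * ((n : F) - (k : F)) * coord v (k + 1)
          + w.1 0 0 * ((n : F) - 2 * (k : F)) * coord v k
          + w.1 1 0 * (k : F) * coord v (k - 1))
        + z.1 1 0 * (k : F) * (w.1 0 1 * ((n : F) - ((k : F) - 1)) * coord v k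
          + w.1 0 0 * ((n : F) - 2 * ((k : F) - 1)) * coord v (k - 1)
          + w.1 1 0 * ((k : F) - 1) * coord v (k - 2)) := by
      intro z w
      have h1 : ((n : F) - (k : F)) * coord (slAct w v) (k + 1) = ((n : F) - (k : F)) *
          (w.1 0 1 * ((n : F) - ((k : F) + 1)) * coord v (k + 2)
          + w.1 0 0 * ((n : F) - 2 * ((k : F) + 1)) * coord v (k + 1)
          + w.1 1 0 * ((k : F) + 1) * coord v k) := by
        rcases hk.eq_or_lt with rfl | hlt
        · simp
        · rw [coord_slAct _ _ (Nat.succ_le_of_lt hlt)]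
          simp
      have h2 : (k : F) * coord (slAct w v) (k - 1) = (k : F) *
          (w.1 0 1 * ((n : F) - ((k : F) - 1)) * coord v k
          + w.1 0 0 * ((n : F) - 2 * ((k : F) - 1)) * coord v (k - 1)
          + w.1 1 0 * ((k : F) - 1) * coord v (k - 2)) := by
        rcases k with _ | k
        · simp
        · rw [coord_slAct _ _ (by omega)]
          simp
      rw [coord_slAct _ _ hk, coord_slAct _ _ hk]
      linear_combination z.1 0 1 * h1 + z.1 1 0 * h2
    rw [coord_add, key x y, key y x, coord_slAct _ _ hk]
    have hx := SL2.trace_eq x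
    have hy := SL2.trace_eq y
    simp only [LieSubalgebra.coe_bracket, Ring.lie_def, Matrix.sub_apply, Matrix.mul_apply,
      Fin.sum_univ_two, hx, hy]
    ring

instance (n : ℕ) : LieModule F (SL2 F) (Irr F n) where
  smul_lie t x v := by
    change slAct (t • x) v = t • slAct x v
    refine Irr.ext_coord fun k hk => ?_
    rw [coord_smul, coord_slAct _ _ hk, coord_slAct _ _ hk]
    have h : ∀ i j, (t • x).1 i j = t * x.1 i j := fun _ _ => rfl
    simp only [h]
    ring
  lie_smul t x v := by
    change slAct x (t • v) = t • slAct x v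
    refine Irr.ext_coord fun k hk => ?_
    rw [coord_smul, coord_slAct _ _ hk, coord_slAct _ _ hk]
    simp only [coord_smul]
    ring

/-! ### The Lie algebra `g_m = sl(2) ⋉ V(m)` -/

/-- `V(m)` viewed as an abelian Lie algebra. -/
instance (m : ℕ) : LieRing (Irr F m) where
  bracket _ _ := 0
  add_lie _ _ _ := (add_zero 0).symm
  lie_add _ _ _ := (add_zero 0).symm
  lie_self _ := rfl
  leibniz_lie _ _ _ := (add_zero 0).symm

instance (m : ℕ) : LieAlgebra F (Irr F m) where
  lie_smul t _ _ := (smul_zero t).symm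

variable (F) in
/-- `sl(2)` acts by derivations on the abelian Lie algebra `V(m)`. -/
def slDer (m : ℕ) : SL2 F →ₗ⁅F⁆ LieDerivation F (Irr F m) (Irr F m) where
  toFun x :=
    { toLinearMap := LieModule.toEnd F (SL2 F) (Irr F m) x
      leibniz' := fun a b => by
        change ⁅x, (0 : Irr F m)⁆ = (0 : Irr F m) - 0
        simp }
  map_add' x y := by
    ext v : 1
    exact add_lie x y v
  map_smul' t x := by
    ext v : 1
    exact smul_lie t x v
  map_lie' {x y} := by
    ext v : 1
    rw [LieDerivation.commutator_apply]
    exact lie_lie x y v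

variable (F) in
/-- The Lie algebra `g_m = sl(2) ⋉ V(m)`; its elements `X` have an `sl(2)`-component `X.right` and a
`V(m)`-component `X.left`. -/
abbrev Gm (m : ℕ) : Type u := LieAlgebra.SemiDirectSum (Irr F m) (SL2 F) (slDer F m)

/-- The inclusion of the Levi factor `sl(2)` into `g_m`. -/
def fromSl (m : ℕ) (x : SL2 F) : Gm F m := LieAlgebra.SemiDirectSum.inr (slDer F m) x

/-! ### Modules of length two -/

/-- The space `V(a) ⊕ V(b)` underlying the `g_m`-module defined by an `sl(2)`-homomorphism
`φ : V(m) → Hom(V(b), V(a))`. -/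
def E {m a b : ℕ} (_φ : Irr F m →ₗ⁅F, SL2 F⁆ (Irr F b →ₗ[F] Irr F a)) : Type u :=
  Irr F a × Irr F b

section E

variable {m a b : ℕ} (φ : Irr F m →ₗ⁅F, SL2 F⁆ (Irr F b →ₗ[F] Irr F a))

instance : AddCommGroup (E φ) := inferInstanceAs (AddCommGroup (Irr F a × Irr F b))

instance : Module F (E φ) := inferInstanceAs (Module F (Irr F a × Irr F b))

/-- The `g_m`-module structure on `V(a) ⊕ V(b)`: `sl(2)` acts on both summands, `V(m)` annihilates
`V(a)` and maps `V(b)` to `V(a)` through `φ`. -/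
instance : LieRingModule (Gm F m) (E φ) where
  bracket X p := (⁅X.right, p.1⁆ + φ X.left p.2, ⁅X.right, p.2⁆)
  add_lie X Y p := by
    refine Prod.ext ?_ ?_
    · change ⁅X.right + Y.right, p.1⁆ + φ (X.left + Y.left) p.2 =
        (⁅X.right, p.1⁆ + φ X.left p.2) + (⁅Y.right, p.1⁆ + φ Y.left p.2)
      rw [add_lie, map_add, LinearMap.add_apply]
      abel
    · exact add_lie X.right Y.right p.2
  lie_add X p q := by
    refine Prod.ext ?_ ?_
    · change ⁅X.right, p.1 + q.1⁆ + φ X.left (p.2 + q.2) =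
        (⁅X.right, p.1⁆ + φ X.left p.2) + (⁅X.right, q.1⁆ + φ X.left q.2)
      rw [lie_add, map_add]
      abel
    · exact lie_add X.right p.2 q.2
  leibniz_lie X Y p := by
    refine Prod.ext ?_ ?_
    · change ⁅X.right, ⁅Y.right, p.1⁆ + φ Y.left p.2⁆ + φ X.left ⁅Y.right, p.2⁆ =
        (⁅⁅X.right, Y.right⁆, p.1⁆
          + φ ((0 : Irr F m) + ⁅X.right, Y.left⁆ - ⁅Y.right, X.left⁆) p.2)
        + (⁅Y.right, ⁅X.right, p.1⁆ + φ X.left p.2⁆ + φ Y.left ⁅X.right, p.2⁆)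
      rw [zero_add, map_sub, LieModuleHom.map_lie, LieModuleHom.map_lie, LinearMap.sub_apply,
        LieHom.lie_apply, LieHom.lie_apply, lie_add, lie_add, leibniz_lie X.right Y.right p.1]
      abel
    · exact leibniz_lie X.right Y.right p.2

instance : LieModule F (Gm F m) (E φ) where
  smul_lie t X p := by
    refine Prod.ext ?_ ?_
    · change ⁅t • X.right, p.1⁆ + φ (t • X.left) p.2 = t • (⁅X.right, p.1⁆ + φ X.left p.2)
      rw [smul_lie, map_smul, LinearMap.smul_apply, smul_add]
    · exact smul_lie t X.right p.2
  lie_smul t X p := by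
    refine Prod.ext ?_ ?_
    · change ⁅X.right, t • p.1⁆ + φ X.left (t • p.2) = t • (⁅X.right, p.1⁆ + φ X.left p.2)
      rw [lie_smul, map_smul, smul_add]
    · exact lie_smul t X.right p.2

/-- The inclusion `V(a) → V(a) ⊕ V(b)`. -/
def inA : Irr F a →ₗ[F] E φ := LinearMap.inl F (Irr F a) (Irr F b)

/-- The inclusion `V(b) → V(a) ⊕ V(b)`. -/
def inB : Irr F b →ₗ[F] E φ := LinearMap.inr F (Irr F a) (Irr F b)

end E

variable (F) in
/-- `V ≃ Z(a, 1)`, where `Z(a, 1) = V(a) ⊕ V(a + m)` with `V(m)` acting through a nonzero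
`sl(2)`-homomorphism `V(m) → Hom(V(a + m), V(a))`, which is unique up to a scalar; the isomorphism
class of the module does not depend on the scalar. -/
def IsZ (m a : ℕ) (V : Type v) [AddCommGroup V] [Module F V] [LieRingModule (Gm F m) V] : Prop :=
  ∃ φ : Irr F m →ₗ⁅F, SL2 F⁆ (Irr F (a + m) →ₗ[F] Irr F a),
    φ ≠ 0 ∧ Nonempty (V ≃ₗ⁅F, Gm F m⁆ E φ)

variable (F) in
/-- `V ≃ Z(b, 1)^*`, the dual module. -/
def IsZDual (m b : ℕ) (V : Type v) [AddCommGroup V] [Module F V] [LieRingModule (Gm F m) V] :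
    Prop :=
  ∃ φ : Irr F m →ₗ⁅F, SL2 F⁆ (Irr F (b + m) →ₗ[F] Irr F b),
    φ ≠ 0 ∧ Nonempty (V ≃ₗ⁅F, Gm F m⁆ (E φ →ₗ[F] F))

/-! ### Socles, socle decompositions and `S_1` -/

variable (F) in
/-- The socle of a `g_m`-module: the sum of its irreducible submodules. -/
def soc (m : ℕ) (V : Type v) [AddCommGroup V] [Module F V] [LieRingModule (Gm F m) V] :
    LieSubmodule F (Gm F m) V :=
  sSup {N | LieModule.IsIrreducible F (Gm F m) N}

/-- The subspace `N` of the `g_m`-module `V` is an `sl(2)`-submodule isomorphic to `V(n)`. -/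
def IsoIrr (m : ℕ) {V : Type v} [AddCommGroup V] [Module F V] [LieRingModule (Gm F m) V]
    (N : Submodule F V) (n : ℕ) : Prop :=
  ∃ θ : Irr F n ≃ₗ[F] N, ∀ (x : SL2 F) (v : Irr F n), (θ ⁅x, v⁆ : V) = ⁅fromSl m x, (θ v : V)⁆

/-- `V = A ⊕ B` is a socle decomposition of a module of length two, with `A = soc(V) ≃ V(a)` and
`B ≃ V(b)` as `sl(2)`-modules. -/
structure IsSocleDecomp (m a b : ℕ) {V : Type v} [AddCommGroup V] [Module F V]
    [LieRingModule (Gm F m) V] (A B : Submodule F V) : Prop where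
  soc_eq : A = (soc F m V).toSubmodule
  isCompl : IsCompl A B
  left_iso : IsoIrr m A a
  right_iso : IsoIrr m B b

/-- For `V = A ⊕ B` and `W = C ⊕ D`, the subspace
`S_1 = soc(V ⊗ W) ∩ (A ⊗ D ⊕ B ⊗ C)` of `V ⊗ W`. -/
def S1 (m : ℕ) {V : Type v} {W : Type w} [AddCommGroup V] [Module F V] [LieRingModule (Gm F m) V]
    [LieModule F (Gm F m) V] [AddCommGroup W] [Module F W] [LieRingModule (Gm F m) W]
    [LieModule F (Gm F m) W] (A B : Submodule F V) (C D : Submodule F W) :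
    Submodule F (V ⊗[F] W) :=
  (soc F m (V ⊗[F] W)).toSubmodule ⊓
    (Submodule.map₂ (TensorProduct.mk F V W) A D ⊔ Submodule.map₂ (TensorProduct.mk F V W) B C)

/-- `u` is a highest weight vector of weight `μ` in the subspace `N` of the `g_m`-module `V`. -/
def IsHighestWeight (m : ℕ) {V : Type v} [AddCommGroup V] [Module F V] [LieRingModule (Gm F m) V]
    (N : Submodule F V) (μ : ℕ) (u : V) : Prop :=
  u ∈ N ∧ u ≠ 0 ∧ ⁅fromSl m (sl2e F), u⁆ = 0 ∧ ⁅fromSl m (sl2h F), u⁆ = (μ : F) • u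

/-! ### Square roots and Clebsch–Gordan coefficients -/

variable (F) in
/-- A multiplicative choice in `F` of square roots of the non-negative rational numbers (for `F = ℝ`
the usual one); it gives a meaning in `F` to the radicals `√x`. -/
structure SquareRoots where
  sqrt : ℚ≥0 →*₀ F
  sq : ∀ x : ℚ≥0, sqrt x ^ 2 = (x : F)

variable (σ : SquareRoots F)

/-- The Clebsch–Gordan coefficient
`CG(a/2, a/2 - i; b/2, b/2 - j | c/2, c/2 - k)`
given by Racah's formula. With `j₁ = a/2`, `m₁ = a/2 - i`, and so on, one has `j₁ + m₁ = a - i`,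
`j₁ - m₁ = i`, `j₂ + m₂ = b - j`, `j₂ - m₂ = j`, `j₃ + m₃ = c - k`, `j₃ - m₃ = k`, `2 j₃ + 1 = c + 1`
and, with
`n = j₁ + j₂ - j₃`, `p = j₁ - j₂ + j₃`, `q = -j₁ + j₂ + j₃`,
also `j₃ - j₂ + m₁ = p - i` and `j₃ - j₁ - m₂ = j - n`. The coefficient is zero unless the triangle
condition holds, `|m_i| ≤ j_i`, and `m₁ + m₂ = m₃`; the sum is over those `r` for which all the
arguments of factorials are non-negative, so that all subtractions are exact. -/
def cg (a i b j c k : ℕ) : F :=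
  if c ≤ a + b ∧ b ≤ a + c ∧ a ≤ b + c ∧ Even (a + b + c) ∧ i ≤ a ∧ j ≤ b ∧ k ≤ c ∧
      2 * i + 2 * j + c = a + b + 2 * k then
    let n := (a + b - c) / 2
    let p := (a + c - b) / 2
    let q := (b + c - a) / 2
    σ.sqrt ((n.factorial * p.factorial * q.factorial : ℚ≥0) / ((a + b + c) / 2 + 1).factorial)
      * σ.sqrt (c + 1)
      * σ.sqrt ((a - i).factorial * i.factorial * (b - j).factorial * j.factorial
          * (c - k).factorial * k.factorial)
      * ∑ r ∈ (Finset.range (n + 1)).filter (fun r => r ≤ i ∧ r + j ≤ b ∧ i ≤ p + r ∧ n ≤ j + r),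
          (-1 : F) ^ r / (r.factorial * (n - r).factorial * (i - r).factorial
            * (b - j - r).factorial * (p + r - i).factorial * (j + r - n).factorial)
  else 0

/-- The basis `v_0, …, v_n` of `V(n)` normalized by `v_k = √(k! (n - k)! / n!) w_k`, so that
`e v_k = √(k (n - k + 1)) v_{k-1}`, `h v_k = (n - 2k) v_k`, `f v_k = √((n - k) (k + 1)) v_{k+1}`. -/
def vec (n k : ℕ) : Irr F n := fun l =>
  if l.1 = k then σ.sqrt ((k.factorial * (n - k).factorial : ℚ≥0) / n.factorial) else 0

/-- The vector `v_k^{a,b,c} = ∑ CG(a/2, a/2 - i; b/2, b/2 - j | c/2, c/2 - k) v_i^a ⊗ v_j^b`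
of `V(a) ⊗ V(b)`. -/
def cgVec (a b c k : ℕ) : Irr F a ⊗[F] Irr F b :=
  ∑ i ∈ Finset.range (a + 1), ∑ j ∈ Finset.range (b + 1),
    cg σ a i b j c k • (vec σ a i ⊗ₜ[F] vec σ b j)

/-- The `sl(2)`-homomorphism `φ : V(m) → Hom(V(b), V(a))` is the normalized one:
`e_s v_j^b = (-1)^j ∑_i CG(a/2, a/2 - i; b/2, -b/2 + j | m/2, m/2 - s) v_i^a`, where
`e_s = v_s^m`; the module `E φ` is then `E(a, b)`. -/
def IsCG {m a b : ℕ} (φ : Irr F m →ₗ⁅F, SL2 F⁆ (Irr F b →ₗ[F] Irr F a)) : Prop :=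
  ∀ s ≤ m, ∀ j ≤ b, φ (vec σ m s) (vec σ b j) =
    (-1 : F) ^ j • ∑ i ∈ Finset.range (a + 1), cg σ a i b (b - j) m s • vec σ a i

/-- For `V₁ = V(a) ⊕ V(b)`, `V₂ = V(c) ⊕ V(d)` and a sign `ε`, the vector
`√(d+1) v_0^{a,d,μ} - ε √(b+1) v_0^{b,c,μ}` of `V(a) ⊗ V(d) ⊕ V(b) ⊗ V(c) ⊆ V₁ ⊗ V₂`. -/
def u0 {m a b c d : ℕ} (φ₁ : Irr F m →ₗ⁅F, SL2 F⁆ (Irr F b →ₗ[F] Irr F a))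
    (φ₂ : Irr F m →ₗ⁅F, SL2 F⁆ (Irr F d →ₗ[F] Irr F c)) (μ : ℕ) (ε : F) : E φ₁ ⊗[F] E φ₂ :=
  σ.sqrt (d + 1) • TensorProduct.map (inA φ₁) (inB φ₂) (cgVec σ a d μ 0)
    - (ε * σ.sqrt (b + 1)) • TensorProduct.map (inB φ₁) (inA φ₂) (cgVec σ b c μ 0)

end UniserialSl2

end

open scoped TensorProduct
open UniserialSl2

/-!
The proof is an explicit computation with forms in two variables. Identify `V(n)` with the binary
forms of degree `n`, the basis vector `w_k` being `C(n, k) x^{n-k} y^k`. There are two kinds of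
coordinates: `coord`, in which partial derivatives are shifts of the index, and `pcoord`, the
coefficients of the form, in which multiplication by a monomial is a shift.

Up to a scalar there is only one homomorphism `V(m) → Hom(V(b), V(a))` if `|a - b| = m`
(`exists_eq_smul_contr`, `exists_eq_smul_mult`): for `b = a + m` it is the contraction `contr`,
`X` acting as the differential operator `X(∂_y, -∂_x)`, and for `a = b + m` it is the multiplication
`mult`. In any socle decomposition `V = A ⊕ B` of a module of type `Z` and length two, `V(m)`
annihilates `A` and maps `B` to `A`; after rescaling the isomorphism `V(b) ≃ B`, it does so through
`contr` or `mult` (`IsSocleDecomp.exists_isSplit`).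

Since `V(m)` acts nilpotently, it annihilates the socle of `V₁ ⊗ V₂` (`soc_le_invariants`);
conversely a copy of an irreducible `sl(2)`-module that is annihilated by `V(m)` lies in the socle
(`range_le_soc`). Thus `S_1` consists of the pairs `(p, q)` of double forms `p ∈ V(a) ⊗ V(d)`,
`q ∈ V(b) ⊗ V(c)` such that `X · p + X · q = 0` in `V(a) ⊗ V(c)` for all `X ∈ V(m)`, called
compatible below, as soon as these pairs form a module `V(μ)` or zero (`IsParam.isoIrr`,
`S1_eq_bot`). They are determined in coordinates:
* for two contractions, the coordinate of `p` at `w_i ⊗ w_k` depends only on `i + k`, so that `p` is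
  the polarization of a form of degree `a + d`, and `q` is minus the polarization of the same form
  (`isParam_contr_contr`);
* for a contraction and a multiplication, the polarization operator `x₂ ∂_{x₁} + y₂ ∂_{y₁}`
  annihilates `p`, so that `p` is a multiple of `(x₁ y₂ - x₂ y₁)^a`, and `q` is then a multiple of
  `(x₁ y₂ - x₂ y₁)^{a+m}` by the same form (`isParam_contr_mult`), there being no solution
  if `a > d`; exchanging the factors gives the third case;
* for two multiplications, only the zero pair is compatible (`Compatible.eq_zero_of_mult_mult`).

For all the Clebsch–Gordan coefficients in the statement, Racah's sum reduces to a single term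
(`cg_eq_single`). This identifies the normalized homomorphisms as multiples of `contr` and `mult`
(`isCG_contr`, `isCG_mult`) and `u_0` as a multiple of the image of `w_0 ∈ V(μ)` under the
parametrization of the compatible pairs (`isHighestWeight_u0`). The module defined by a multiple of
`mult` is dual to the one defined by the negative adjoints with respect to the invariant forms on
the `V(n)` (`isZDual_E`).
-/

open scoped TensorProduct

noncomputable section

namespace UniserialSl2

universe u v w

variable {F : Type u} [Field F]

/-! ### Coordinates on `V(n)` -/

/-- The basis vector `w_k` of `V(n)`; it is zero if `k > n`. -/
def wvec (n k : ℕ) : Irr F n := fun l => if l.1 = k then 1 else 0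

theorem coord_wvec {n : ℕ} (k l : ℕ) (hl : l ≤ n) :
    coord (wvec n k : Irr F n) l = if l = k then 1 else 0 := by
  rw [coord, dif_pos (Nat.lt_succ_of_le hl)]
  rfl

theorem coord_zero {n : ℕ} (k : ℕ) : coord (0 : Irr F n) k = 0 := by
  simpa using coord_smul (0 : F) (0 : Irr F n) k

theorem coord_wvec_self {n k : ℕ} (hk : k ≤ n) : coord (wvec n k : Irr F n) k = 1 := by
  rw [coord_wvec _ _ hk, if_pos rfl]

theorem wvec_ne_zero {n k : ℕ} (hk : k ≤ n) : (wvec n k : Irr F n) ≠ 0 := by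
  intro h
  have := coord_wvec_self (F := F) hk
  rw [h, coord_zero] at this
  exact zero_ne_one this

theorem wvec_of_lt {n k : ℕ} (hk : n < k) : (wvec n k : Irr F n) = 0 := by
  refine Irr.ext_coord fun l hl => ?_
  rw [coord_wvec _ _ hl, coord_zero, if_neg (by omega)]

/-- The `k`-th coordinate as a linear form. -/
def coordL (n k : ℕ) : Irr F n →ₗ[F] F where
  toFun v := coord v k
  map_add' v w := coord_add v w k
  map_smul' t v := coord_smul t v k

@[simp] theorem coordL_apply {n : ℕ} (k : ℕ) (v : Irr F n) : coordL n k v = coord v k := rfl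

theorem coord_sum {n : ℕ} {ι : Type*} (s : Finset ι) (g : ι → Irr F n) (k : ℕ) :
    coord (∑ i ∈ s, g i) k = ∑ i ∈ s, coord (g i) k :=
  map_sum (coordL n k) g s

/-- The vector of `V(n)` with coordinates `g 0, …, g n`. -/
def ofCoord (n : ℕ) (g : ℕ → F) : Irr F n := fun k => g k.1

theorem coord_ofCoord {n : ℕ} (g : ℕ → F) {k : ℕ} (hk : k ≤ n) : coord (ofCoord n g) k = g k := by
  rw [coord, dif_pos (Nat.lt_succ_of_le hk)]
  rfl

theorem eq_sum_wvec {n : ℕ} (v : Irr F n) :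
    v = ∑ k ∈ Finset.range (n + 1), coord v k • wvec n k := by
  refine Irr.ext_coord fun l hl => ?_
  rw [coord_sum, Finset.sum_eq_single l]
  · rw [coord_smul, coord_wvec_self hl, mul_one]
  · intro k _ hk
    rw [coord_smul, coord_wvec _ _ hl, if_neg (Ne.symm hk), mul_zero]
  · intro h
    exact absurd (Finset.mem_range.mpr (Nat.lt_succ_of_le hl)) h

theorem Irr.hom_ext {n : ℕ} {M : Type*} [AddCommGroup M] [Module F M] {f g : Irr F n →ₗ[F] M}
    (h : ∀ k ≤ n, f (wvec n k) = g (wvec n k)) : f = g := by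
  ext v
  rw [eq_sum_wvec v, map_sum, map_sum]
  refine Finset.sum_congr rfl fun k hk => ?_
  rw [map_smul, map_smul, h k (Nat.lt_succ_iff.mp (Finset.mem_range.mp hk))]

theorem coord_lie {n : ℕ} (x : SL2 F) (v : Irr F n) {k : ℕ} (h : k ≤ n) :
    coord ⁅x, v⁆ k = x.1 0 1 * ((n : F) - (k : F)) * coord v (k + 1)
      + x.1 0 0 * ((n : F) - 2 * (k : F)) * coord v k
      + x.1 1 0 * (k : F) * coord v (k - 1) :=
  coord_slAct x v h

theorem coord_lie_e {n : ℕ} (v : Irr F n) {k : ℕ} (h : k ≤ n) :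
    coord ⁅sl2e F, v⁆ k = ((n : F) - (k : F)) * coord v (k + 1) := by
  rw [coord_lie _ _ h]; simp [sl2e]

theorem coord_lie_h {n : ℕ} (v : Irr F n) {k : ℕ} (h : k ≤ n) :
    coord ⁅sl2h F, v⁆ k = ((n : F) - 2 * (k : F)) * coord v k := by
  rw [coord_lie _ _ h]; simp [sl2h]

theorem coord_lie_f {n : ℕ} (v : Irr F n) {k : ℕ} (h : k ≤ n) :
    coord ⁅sl2f F, v⁆ k = (k : F) * coord v (k - 1) := by
  rw [coord_lie _ _ h]; simp [sl2f]

theorem lie_e_wvec_zero (n : ℕ) : ⁅sl2e F, (wvec n 0 : Irr F n)⁆ = 0 := by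
  refine Irr.ext_coord fun l hl => ?_
  rw [coord_lie_e _ hl, coord_zero]
  rcases hl.eq_or_lt with rfl | hlt
  · simp
  · rw [coord_wvec _ _ hlt, if_neg (by omega), mul_zero]

theorem lie_e_wvec_succ {n k : ℕ} (hk : k < n) :
    ⁅sl2e F, (wvec n (k + 1) : Irr F n)⁆ = ((n : F) - k) • wvec n k := by
  refine Irr.ext_coord fun l hl => ?_
  rw [coord_lie_e _ hl, coord_smul, coord_wvec _ _ hl]
  rcases hl.eq_or_lt with rfl | hlt
  · rw [if_neg (by omega)]; simp
  · rw [coord_wvec _ _ hlt]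
    by_cases h : l = k
    · subst h; simp
    · rw [if_neg (by omega), if_neg h]; simp

theorem lie_h_wvec (n k : ℕ) :
    ⁅sl2h F, (wvec n k : Irr F n)⁆ = ((n : F) - 2 * k) • wvec n k := by
  refine Irr.ext_coord fun l hl => ?_
  rw [coord_lie_h _ hl, coord_smul, coord_wvec _ _ hl]
  by_cases h : l = k
  · subst h; simp
  · rw [if_neg h]; simp

theorem lie_f_wvec (n k : ℕ) :
    ⁅sl2f F, (wvec n k : Irr F n)⁆ = ((k : F) + 1) • wvec n (k + 1) := by
  refine Irr.ext_coord fun l hl => ?_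
  rw [coord_lie_f _ hl, coord_smul, coord_wvec _ _ hl, coord_wvec _ _ (by omega)]
  rcases l with _ | l
  · simp
  · by_cases h : l = k
    · subst h; simp
    · rw [if_neg (by omega), if_neg (by omega)]; simp

/-! ### Polynomial coordinates -/

/-- The polynomial coordinates of `v ∈ V(n)`: identifying `w_k` with `C(n, k) x^{n-k} y^k`, this is
the coefficient of `x^{n-k} y^k`. The index is an integer, and the value is zero outside `[0, n]`;
in contrast to `coord`, the action of `sl(2)` is then given by the same formula for all `k`. -/
def pcoord {n : ℕ} (v : Irr F n) (k : ℤ) : F :=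
  if 0 ≤ k then (n.choose k.toNat : F) * coord v k.toNat else 0

theorem pcoord_natCast {n : ℕ} (v : Irr F n) (k : ℕ) :
    pcoord v k = (n.choose k : F) * coord v k := by
  simp [pcoord]

theorem pcoord_of_neg {n : ℕ} (v : Irr F n) {k : ℤ} (hk : k < 0) : pcoord v k = 0 := by
  rw [pcoord, if_neg (by omega)]

theorem pcoord_of_lt {n : ℕ} (v : Irr F n) {k : ℤ} (hk : (n : ℤ) < k) : pcoord v k = 0 := by
  rw [pcoord, if_pos (by omega), coord_of_lt v (by omega), mul_zero]

theorem pcoord_add {n : ℕ} (v w : Irr F n) (k : ℤ) :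
    pcoord (v + w) k = pcoord v k + pcoord w k := by
  unfold pcoord
  split_ifs
  · rw [coord_add]; ring
  · simp

theorem pcoord_smul {n : ℕ} (t : F) (v : Irr F n) (k : ℤ) : pcoord (t • v) k = t * pcoord v k := by
  unfold pcoord
  split_ifs
  · rw [coord_smul]; ring
  · simp

/-- The polynomial coordinate as a linear form. -/
def pcoordL (n : ℕ) (k : ℤ) : Irr F n →ₗ[F] F where
  toFun v := pcoord v k
  map_add' v w := pcoord_add v w k
  map_smul' t v := pcoord_smul t v k

@[simp] theorem pcoordL_apply {n : ℕ} (k : ℤ) (v : Irr F n) : pcoordL n k v = pcoord v k := rfl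

theorem pcoord_zero {n : ℕ} (k : ℤ) : pcoord (0 : Irr F n) k = 0 := map_zero (pcoordL n k)

theorem pcoord_wvec {n : ℕ} (k : ℕ) (l : ℤ) :
    pcoord (wvec n k : Irr F n) l = if l = k then (n.choose k : F) else 0 := by
  rcases lt_or_ge l 0 with h | h
  · rw [pcoord_of_neg _ h, if_neg (by omega)]
  · lift l to ℕ using h
    rw [pcoord_natCast]
    rcases lt_or_ge n l with h | h
    · rw [coord_of_lt _ h, mul_zero]
      split_ifs with h'
      · rw [Nat.choose_eq_zero_of_lt (by omega), Nat.cast_zero]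
      · rfl
    · rw [coord_wvec _ _ h]
      by_cases h' : l = k
      · subst h'; simp
      · rw [if_neg h', if_neg (by omega), mul_zero]

theorem succ_mul_choose_succ {n k : ℕ} (hk : k ≤ n) :
    ((k : F) + 1) * (n.choose (k + 1) : F) = ((n : F) - k) * n.choose k := by
  have := congrArg (Nat.cast (R := F)) (Nat.choose_succ_right_eq n k)
  push_cast [Nat.cast_sub hk] at this
  linear_combination this

theorem pcoord_lie {n : ℕ} (x : SL2 F) (v : Irr F n) (k : ℤ) :
    pcoord ⁅x, v⁆ k = x.1 0 1 * ((k : F) + 1) * pcoord v (k + 1)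
      + x.1 0 0 * ((n : F) - 2 * (k : F)) * pcoord v k
      + x.1 1 0 * ((n : F) - (k : F) + 1) * pcoord v (k - 1) := by
  rcases lt_or_ge k 0 with h | h
  · rw [pcoord_of_neg _ h, pcoord_of_neg _ h, pcoord_of_neg _ (show k - 1 < 0 by omega)]
    rcases (show k + 1 < 0 ∨ k = -1 by omega) with h | rfl
    · rw [pcoord_of_neg _ h]; ring
    · push_cast; ring
  · lift k to ℕ using h
    rcases lt_or_ge n k with h | h
    · rw [pcoord_of_lt _ (by omega), pcoord_of_lt _ (by omega), pcoord_of_lt _ (by omega)]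
      rcases (show n + 1 < k ∨ k = n + 1 by omega) with h | rfl
      · rw [pcoord_of_lt _ (by omega)]; ring
      · push_cast; ring
    · rw [show (k : ℤ) + 1 = ((k + 1 : ℕ) : ℤ) by push_cast; rfl, pcoord_natCast, pcoord_natCast,
        pcoord_natCast, coord_lie _ _ h]
      have h1 := succ_mul_choose_succ (F := F) h
      have h2 : (n.choose k : F) * ((k : F) * coord v (k - 1)) =
          ((n : F) - k + 1) * pcoord v ((k : ℤ) - 1) := by
        rcases k with _ | k
        · rw [pcoord_of_neg _ (by simp)]; simp
        · have h3 := succ_mul_choose_succ (F := F) (show k ≤ n by omega)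
          rw [show ((k + 1 : ℕ) : ℤ) - 1 = (k : ℤ) by push_cast; ring, pcoord_natCast,
            Nat.add_sub_cancel]
          push_cast
          linear_combination coord v k * h3
      push_cast
      linear_combination -x.1 0 1 * coord v (k + 1) * h1 + x.1 1 0 * h2

theorem choose_ne_zero [CharZero F] {n k : ℕ} (hk : k ≤ n) : (n.choose k : F) ≠ 0 := by
  exact_mod_cast (Nat.choose_pos hk).ne'

theorem Irr.ext_pcoord [CharZero F] {n : ℕ} {v w : Irr F n}
    (h : ∀ k : ℤ, pcoord v k = pcoord w k) : v = w := by
  refine Irr.ext_coord fun k hk => ?_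
  have := h k
  rw [pcoord_natCast, pcoord_natCast] at this
  exact mul_left_cancel₀ (choose_ne_zero hk) this

/-- The vector of `V(n)` with polynomial coordinates `g 0, …, g n`; the division is the reason why
characteristic zero is needed in `pcoord_ofPCoord`. -/
def ofPCoord (n : ℕ) (g : ℤ → F) : Irr F n := ofCoord n fun k => g k / (n.choose k : F)

theorem pcoord_ofPCoord [CharZero F] {n : ℕ} (g : ℤ → F) (hg : ∀ k, k < 0 ∨ (n : ℤ) < k → g k = 0)
    (k : ℤ) : pcoord (ofPCoord n g) k = g k := by
  rcases lt_or_ge k 0 with h | h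
  · rw [pcoord_of_neg _ h, hg k (Or.inl h)]
  rcases lt_or_ge (n : ℤ) k with h' | h'
  · rw [pcoord_of_lt _ h', hg k (Or.inr h')]
  · lift k to ℕ using h
    have hk : k ≤ n := by omega
    rw [pcoord_natCast, ofPCoord, coord_ofCoord _ hk]
    field_simp [choose_ne_zero (F := F) hk]

/-! ### Irreducibility of `V(n)` -/

/-- A nonzero `sl(2)`-submodule contains `w_0`, because applying `e` repeatedly to a nonzero vector
leads to a nonzero multiple of `w_0`. -/
theorem wvec_zero_mem [CharZero F] {n : ℕ} (N : Submodule F (Irr F n))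
    (hN : ∀ x : SL2 F, ∀ v ∈ N, ⁅x, v⁆ ∈ N) (K : ℕ) :
    ∀ v ∈ N, v ≠ 0 → (∀ k, K < k → coord v k = 0) → wvec n 0 ∈ N := by
  induction K with
  | zero =>
    intro v hv hv0 hK
    have h : v = coord v 0 • wvec n 0 := by
      refine Irr.ext_coord fun l hl => ?_
      rw [coord_smul, coord_wvec _ _ hl]
      rcases l with _ | l
      · simp
      · rw [hK _ (by omega)]; simp
    have h0 : coord v 0 ≠ 0 := fun h0 => hv0 (by rw [h, h0, zero_smul])
    rw [h] at hv
    exact (Submodule.smul_mem_iff N h0).mp hv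
  | succ K ih =>
    intro v hv hv0 hK
    by_cases h : coord v (K + 1) = 0
    · refine ih v hv hv0 fun k hk => ?_
      rcases (show k = K + 1 ∨ K + 1 < k by omega) with rfl | hk
      · exact h
      · exact hK k hk
    · have hKn : K + 1 ≤ n := by
        by_contra hlt
        exact h (coord_of_lt v (by omega))
      refine ih ⁅sl2e F, v⁆ (hN _ v hv) (fun h0 => ?_) fun k hk => ?_
      · have := coord_lie_e v (show K ≤ n by omega)
        rw [h0, coord_zero, ← Nat.cast_sub (by omega : K ≤ n)] at this
        rcases mul_eq_zero.mp this.symm with h1 | h1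
        · rw [Nat.cast_eq_zero] at h1; omega
        · exact h h1
      · rcases lt_or_ge n k with hn | hn
        · exact coord_of_lt _ hn
        · rw [coord_lie_e _ hn, hK _ (by omega), mul_zero]

theorem Irr.eq_bot_or_eq_top [CharZero F] {n : ℕ} (N : Submodule F (Irr F n))
    (hN : ∀ x : SL2 F, ∀ v ∈ N, ⁅x, v⁆ ∈ N) : N = ⊥ ∨ N = ⊤ := by
  refine or_iff_not_imp_left.mpr fun hbot => ?_
  obtain ⟨v, hv, hv0⟩ := (Submodule.ne_bot_iff N).mp hbot
  have h0 := wvec_zero_mem N hN n v hv hv0 fun k hk => coord_of_lt v hk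
  have hk : ∀ k, wvec n k ∈ N := by
    intro k
    induction k with
    | zero => exact h0
    | succ k ih =>
      have := hN (sl2f F) _ ih
      rw [lie_f_wvec] at this
      exact (Submodule.smul_mem_iff N (by exact_mod_cast Nat.succ_ne_zero k)).mp this
  refine (Submodule.eq_top_iff').mpr fun v => ?_
  rw [eq_sum_wvec v]
  exact Submodule.sum_mem _ fun k _ => N.smul_mem _ (hk k)

theorem finrank_irr (n : ℕ) : Module.finrank F (Irr F n) = n + 1 := by
  change Module.finrank F (Fin (n + 1) → F) = n + 1
  simp

instance (n : ℕ) : Module.Finite F (Irr F n) :=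
  inferInstanceAs (Module.Finite F (Fin (n + 1) → F))

/-! ### The contraction and the multiplication homomorphisms -/

/-- Summation by parts: the action of `sl(2)` on `X` is moved to the sequence paired with `X`. -/
theorem sum_pcoord_lie (m : ℕ) (x : SL2 F) (X : Irr F m) (G : ℕ → F) :
    ∑ s ∈ Finset.range (m + 1), pcoord ⁅x, X⁆ s * G s =
      x.1 0 1 * ∑ s ∈ Finset.range (m + 1), (s : F) * pcoord X s * G (s - 1)
      + x.1 0 0 * ∑ s ∈ Finset.range (m + 1), ((m : F) - 2 * s) * pcoord X s * G s
      + x.1 1 0 * ∑ s ∈ Finset.range (m + 1), ((m : F) - s) * pcoord X s * G (s + 1) := by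
  have h1 : ∑ s ∈ Finset.range (m + 1), ((s : F) + 1) * pcoord X ((s : ℤ) + 1) * G s =
      ∑ s ∈ Finset.range (m + 1), (s : F) * pcoord X s * G (s - 1) := by
    rw [Finset.sum_range_succ, Finset.sum_range_succ', pcoord_of_lt X (by omega)]
    simp
  have h2 : ∑ s ∈ Finset.range (m + 1), ((m : F) - s + 1) * pcoord X ((s : ℤ) - 1) * G s =
      ∑ s ∈ Finset.range (m + 1), ((m : F) - s) * pcoord X s * G (s + 1) := by
    rw [Finset.sum_range_succ', Finset.sum_range_succ, pcoord_of_neg X (by simp)]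
    simp [← sub_sub]
  rw [← h1, ← h2, Finset.mul_sum, Finset.mul_sum, Finset.mul_sum, ← Finset.sum_add_distrib,
    ← Finset.sum_add_distrib]
  refine Finset.sum_congr rfl fun s _ => ?_
  rw [pcoord_lie]
  push_cast
  ring

/-- The bilinear map underlying `contr`. -/
def contrLin (F : Type u) [Field F] (m a : ℕ) : Irr F m →ₗ[F] Irr F (a + m) →ₗ[F] Irr F a :=
  LinearMap.mk₂ F
    (fun X v => ofCoord a fun k =>
      ∑ s ∈ Finset.range (m + 1), pcoord X s * ((-1) ^ s * coord v (k + (m - s))))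
    (fun X Y v => Irr.ext_coord fun k hk => by
      simp only [coord_add, coord_ofCoord _ hk, pcoord_add, add_mul, Finset.sum_add_distrib])
    (fun t X v => Irr.ext_coord fun k hk => by
      simp only [coord_smul, coord_ofCoord _ hk, pcoord_smul, Finset.mul_sum, mul_assoc])
    (fun X v w => Irr.ext_coord fun k hk => by
      simp only [coord_add, coord_ofCoord _ hk, mul_add, Finset.sum_add_distrib])
    (fun t X v => Irr.ext_coord fun k hk => by
      simp only [coord_smul, coord_ofCoord _ hk, Finset.mul_sum, mul_left_comm])

theorem coord_contrLin {m a : ℕ} (X : Irr F m) (v : Irr F (a + m)) {k : ℕ} (hk : k ≤ a) :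
    coord (contrLin F m a X v) k =
      ∑ s ∈ Finset.range (m + 1), pcoord X s * ((-1) ^ s * coord v (k + (m - s))) :=
  coord_ofCoord
    (fun k => ∑ s ∈ Finset.range (m + 1), pcoord X s * ((-1) ^ s * coord v (k + (m - s)))) hk

theorem contrLin_lie {m a : ℕ} (x : SL2 F) (X : Irr F m) (v : Irr F (a + m)) :
    contrLin F m a ⁅x, X⁆ v = ⁅x, contrLin F m a X v⁆ - contrLin F m a X ⁅x, v⁆ := by
  rw [eq_sub_iff_add_eq]
  refine Irr.ext_coord fun k hk => ?_
  have h1 : ((a : F) - k) * coord (contrLin F m a X v) (k + 1) = ((a : F) - k) *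
      ∑ s ∈ Finset.range (m + 1), pcoord X s * ((-1) ^ s * coord v (k + 1 + (m - s))) := by
    rcases hk.eq_or_lt with rfl | hlt
    · simp
    · rw [coord_contrLin _ _ hlt]
  have h2 := coord_contrLin X v (show k - 1 ≤ a by omega)
  rw [coord_add, coord_lie _ _ hk, coord_contrLin _ _ hk, coord_contrLin _ _ hk,
    coord_contrLin _ _ hk, mul_assoc, h1, h2,
    sum_pcoord_lie m x X fun s => (-1) ^ s * coord v (k + (m - s))]
  simp only [Finset.mul_sum, ← Finset.sum_add_distrib]
  refine Finset.sum_congr rfl fun s hs => ?_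
  have hs : s ≤ m := Nat.lt_succ_iff.mp (Finset.mem_range.mp hs)
  have hA : (s : F) * ((-1) ^ (s - 1) * coord v (k + (m - (s - 1)))) =
      -(s * ((-1) ^ s * coord v (k + 1 + (m - s)))) := by
    rcases s with _ | s
    · simp
    · rw [Nat.add_sub_cancel, show k + (m - s) = k + 1 + (m - (s + 1)) by omega, pow_succ]
      ring
  have hB : ((m : F) - s) * coord v (k + (m - (s + 1))) =
      ((m : F) - s) * coord v (k + (m - s) - 1) := by
    rcases hs.eq_or_lt with rfl | hlt
    · simp
    · rw [show k + (m - (s + 1)) = k + (m - s) - 1 by omega]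
  have hC : (k : F) * coord v (k - 1 + (m - s)) = k * coord v (k + (m - s) - 1) := by
    rcases k with _ | k
    · simp
    · rw [show k + 1 - 1 + (m - s) = k + 1 + (m - s) - 1 by omega]
  rw [coord_lie _ _ (show k + (m - s) ≤ a + m by omega),
    show k + (m - s) + 1 = k + 1 + (m - s) by omega]
  push_cast [Nat.cast_sub hs]
  linear_combination x.1 0 1 * pcoord X s * hA + x.1 1 0 * pcoord X s * (-1) ^ (s + 1) * hB
    - x.1 1 0 * pcoord X s * (-1) ^ s * hC

/-- The contraction homomorphism `V(m) → Hom(V(a + m), V(a))`: up to a scalar, a form `X(x, y)` of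
degree `m` acts on forms of degree `a + m` as the differential operator `X(∂_y, -∂_x)`. -/
def contr (F : Type u) [Field F] (m a : ℕ) :
    Irr F m →ₗ⁅F, SL2 F⁆ (Irr F (a + m) →ₗ[F] Irr F a) where
  toLinearMap := contrLin F m a
  map_lie' {x X} := LinearMap.ext fun v => contrLin_lie x X v

theorem coord_contr {m a : ℕ} (X : Irr F m) (v : Irr F (a + m)) {k : ℕ} (hk : k ≤ a) :
    coord (contr F m a X v) k =
      ∑ s ∈ Finset.range (m + 1), pcoord X s * ((-1) ^ s * coord v (k + (m - s))) :=
  coord_contrLin X v hk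

theorem sum_pcoord_wvec {m s : ℕ} (hs : s ≤ m) (G : ℕ → F) :
    ∑ r ∈ Finset.range (m + 1), pcoord (wvec m s : Irr F m) r * G r = m.choose s * G s := by
  rw [Finset.sum_eq_single s]
  · rw [pcoord_wvec, if_pos rfl]
  · intro r _ hr
    rw [pcoord_wvec, if_neg (by exact_mod_cast hr), zero_mul]
  · intro h
    exact absurd (Finset.mem_range.mpr (Nat.lt_succ_of_le hs)) h

theorem coord_contr_wvec {m a s : ℕ} (hs : s ≤ m) (v : Irr F (a + m)) {k : ℕ} (hk : k ≤ a) :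
    coord (contr F m a (wvec m s) v) k = m.choose s * ((-1) ^ s * coord v (k + (m - s))) := by
  rw [coord_contr _ _ hk, sum_pcoord_wvec hs fun s => (-1) ^ s * coord v (k + (m - s))]

theorem sum_pcoord_mul_eq_zero {m b : ℕ} (X : Irr F m) (v : Irr F b) (k : ℤ)
    (hk : k < 0 ∨ ((b + m : ℕ) : ℤ) < k) :
    ∑ s ∈ Finset.range (m + 1), pcoord X s * pcoord v (k - s) = 0 := by
  refine Finset.sum_eq_zero fun s hs => ?_
  have hs : s ≤ m := Nat.lt_succ_iff.mp (Finset.mem_range.mp hs)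
  rcases hk with hk | hk
  · rw [pcoord_of_neg v (by omega), mul_zero]
  · rw [pcoord_of_lt v (by push_cast at hk; omega), mul_zero]

section CharZero

variable [CharZero F]

/-- The bilinear map underlying `mult`. -/
def multLin (F : Type u) [Field F] [CharZero F] (m b : ℕ) :
    Irr F m →ₗ[F] Irr F b →ₗ[F] Irr F (b + m) :=
  LinearMap.mk₂ F
    (fun X v => ofPCoord (b + m) fun k =>
      ∑ s ∈ Finset.range (m + 1), pcoord X s * pcoord v (k - s))
    (fun X Y v => Irr.ext_pcoord fun k => by
      simp only [pcoord_add, pcoord_ofPCoord _ (sum_pcoord_mul_eq_zero _ _)]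
      rw [pcoord_ofPCoord _ fun k hk => by
        simpa only [pcoord_add] using sum_pcoord_mul_eq_zero (X + Y) v k hk]
      simp only [add_mul, Finset.sum_add_distrib])
    (fun t X v => Irr.ext_pcoord fun k => by
      rw [pcoord_smul, pcoord_ofPCoord _ (sum_pcoord_mul_eq_zero _ _),
        pcoord_ofPCoord _ (sum_pcoord_mul_eq_zero _ _)]
      simp only [pcoord_smul, Finset.mul_sum, mul_assoc])
    (fun X v w => Irr.ext_pcoord fun k => by
      rw [pcoord_add, pcoord_ofPCoord _ (sum_pcoord_mul_eq_zero _ _),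
        pcoord_ofPCoord _ (sum_pcoord_mul_eq_zero _ _),
        pcoord_ofPCoord _ (sum_pcoord_mul_eq_zero _ _)]
      simp only [pcoord_add, mul_add, Finset.sum_add_distrib])
    (fun t X v => Irr.ext_pcoord fun k => by
      rw [pcoord_smul, pcoord_ofPCoord _ (sum_pcoord_mul_eq_zero _ _),
        pcoord_ofPCoord _ (sum_pcoord_mul_eq_zero _ _)]
      simp only [pcoord_smul, Finset.mul_sum, mul_left_comm])

theorem pcoord_multLin {m b : ℕ} (X : Irr F m) (v : Irr F b) (k : ℤ) :
    pcoord (multLin F m b X v) k = ∑ s ∈ Finset.range (m + 1), pcoord X s * pcoord v (k - s) :=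
  pcoord_ofPCoord _ (sum_pcoord_mul_eq_zero X v) k

theorem multLin_lie {m b : ℕ} (x : SL2 F) (X : Irr F m) (v : Irr F b) :
    multLin F m b ⁅x, X⁆ v = ⁅x, multLin F m b X v⁆ - multLin F m b X ⁅x, v⁆ := by
  rw [eq_sub_iff_add_eq]
  refine Irr.ext_pcoord fun k => ?_
  rw [pcoord_add, pcoord_lie, pcoord_multLin, pcoord_multLin, pcoord_multLin, pcoord_multLin,
    pcoord_multLin, sum_pcoord_lie m x X fun s => pcoord v (k - s)]
  simp only [Finset.mul_sum, ← Finset.sum_add_distrib]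
  refine Finset.sum_congr rfl fun s hs => ?_
  have hA : (s : F) * pcoord v (k - (s - 1 : ℕ)) = s * pcoord v (k - s + 1) := by
    rcases s with _ | s
    · simp
    · rw [show k - ((s + 1 - 1 : ℕ) : ℤ) = k - (s + 1 : ℕ) + 1 by push_cast; ring]
  rw [pcoord_lie, show k + 1 - (s : ℤ) = k - s + 1 by ring,
    show k - 1 - (s : ℤ) = k - s - 1 by ring,
    show k - ((s + 1 : ℕ) : ℤ) = k - s - 1 by push_cast; ring]
  push_cast
  linear_combination x.1 0 1 * pcoord X s * hA

/-- The multiplication homomorphism `V(m) → Hom(V(b), V(b + m))`: a form of degree `m` acts on forms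
of degree `b` by multiplication. -/
def mult (F : Type u) [Field F] [CharZero F] (m b : ℕ) :
    Irr F m →ₗ⁅F, SL2 F⁆ (Irr F b →ₗ[F] Irr F (b + m)) where
  toLinearMap := multLin F m b
  map_lie' {x X} := LinearMap.ext fun v => multLin_lie x X v

theorem pcoord_mult {m b : ℕ} (X : Irr F m) (v : Irr F b) (k : ℤ) :
    pcoord (mult F m b X v) k = ∑ s ∈ Finset.range (m + 1), pcoord X s * pcoord v (k - s) :=
  pcoord_multLin X v k

theorem pcoord_mult_wvec {m b s : ℕ} (hs : s ≤ m) (v : Irr F b) (k : ℤ) :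
    pcoord (mult F m b (wvec m s) v) k = m.choose s * pcoord v (k - s) := by
  rw [pcoord_mult, sum_pcoord_wvec hs fun s => pcoord v (k - s)]

end CharZero

/-! ### Uniqueness of the homomorphisms `V(m) → Hom(V(b), V(a))` -/

theorem lie_h_hom_apply {m a b : ℕ} (φ : Irr F m →ₗ⁅F, SL2 F⁆ (Irr F b →ₗ[F] Irr F a)) :
    ⁅sl2h F, φ (wvec m m) (wvec b 0)⁆ = ((b : F) - m) • φ (wvec m m) (wvec b 0) := by
  have h1 := LieModuleHom.map_lie φ (sl2h F) (wvec m m)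
  have h2 := congrArg (fun T : Irr F b →ₗ[F] Irr F a => T (wvec b 0)) h1
  simp only [LieHom.lie_apply, lie_h_wvec, map_smul, LinearMap.smul_apply] at h2
  rw [eq_sub_iff_add_eq, ← add_smul] at h2
  rw [← h2]
  congr 1
  push_cast
  ring

section CharZero

variable [CharZero F]

/-- A homomorphism `φ : V(m) → Hom(V(b), V(a))` is determined by `φ(w_m) w_0`: the operator `φ(w_m)`
commutes with `f`, because `w_m` is a lowest weight vector, and `e` produces the other `w_s`
from `w_m`. -/
theorem hom_eq_of_apply {m a b : ℕ} {φ ψ : Irr F m →ₗ⁅F, SL2 F⁆ (Irr F b →ₗ[F] Irr F a)}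
    (h : φ (wvec m m) (wvec b 0) = ψ (wvec m m) (wvec b 0)) : φ = ψ := by
  have low : ∀ χ : Irr F m →ₗ⁅F, SL2 F⁆ (Irr F b →ₗ[F] Irr F a), ∀ v : Irr F b,
      χ (wvec m m) ⁅sl2f F, v⁆ = ⁅sl2f F, χ (wvec m m) v⁆ := by
    intro χ v
    have h0 : ⁅sl2f F, (wvec m m : Irr F m)⁆ = 0 := by
      rw [lie_f_wvec, wvec_of_lt (Nat.lt_succ_self m), smul_zero]
    have h1 := LieModuleHom.map_lie χ (sl2f F) (wvec m m)
    rw [h0, map_zero] at h1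
    have h2 := congrArg (fun T : Irr F b →ₗ[F] Irr F a => T v) h1
    simp only [LieHom.lie_apply, LinearMap.zero_apply] at h2
    exact (sub_eq_zero.mp h2.symm).symm
  have hm : φ (wvec m m) = ψ (wvec m m) := by
    refine Irr.hom_ext fun k _ => ?_
    induction k with
    | zero => exact h
    | succ k ih =>
      have hk : ((k : F) + 1) ≠ 0 := by exact_mod_cast Nat.succ_ne_zero k
      have h1 := low φ (wvec b k)
      have h2 := low ψ (wvec b k)
      rw [lie_f_wvec, map_smul] at h1 h2
      rw [ih (by omega), ← h2] at h1
      exact smul_right_injective _ hk h1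
  have hall : ∀ r ≤ m, φ (wvec m (m - r)) = ψ (wvec m (m - r)) := by
    intro r
    induction r with
    | zero => exact fun _ => hm
    | succ r ih =>
      intro hr
      have h0 := lie_e_wvec_succ (F := F) (show m - (r + 1) < m by omega)
      rw [show m - (r + 1) + 1 = m - r by omega] at h0
      have h1 := LieModuleHom.map_lie φ (sl2e F) (wvec m (m - r))
      have h2 := LieModuleHom.map_lie ψ (sl2e F) (wvec m (m - r))
      rw [h0, map_smul] at h1 h2
      rw [ih (by omega), ← h2] at h1
      refine smul_right_injective _ ?_ h1
      rw [Nat.cast_sub hr, sub_sub_cancel]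
      exact_mod_cast Nat.succ_ne_zero r
  ext1 X
  refine LinearMap.congr_fun (Irr.hom_ext (f := φ.toLinearMap) (g := ψ.toLinearMap)
    fun k hk => ?_) X
  have := hall (m - k) (by omega)
  rwa [show m - (m - k) = k by omega] at this

/-- A weight vector of weight `a - 2l` in `V(a)` is a multiple of `w_l`. -/
theorem eq_smul_of_lie_h {a : ℕ} {l : ℕ} {v : Irr F a}
    (h : ⁅sl2h F, v⁆ = ((a : F) - 2 * l) • v) : v = coord v l • wvec a l := by
  refine Irr.ext_coord fun k hk => ?_
  rw [coord_smul, coord_wvec _ _ hk]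
  by_cases hkl : k = l
  · subst hkl; simp
  · have h1 := congrArg (fun v => coord v k) h
    simp only [coord_lie_h _ hk, coord_smul] at h1
    rw [if_neg hkl, mul_zero]
    have h2 : ((l : F) - k) * coord v k = 0 := by
      have : (2 : F) * (((l : F) - k) * coord v k) = 0 := by linear_combination h1
      exact (mul_eq_zero.mp this).resolve_left two_ne_zero
    refine (mul_eq_zero.mp h2).resolve_left ?_
    refine sub_ne_zero.mpr ?_
    exact_mod_cast Ne.symm hkl

/-- If the weight space containing `φ(w_m) w_0` is spanned by `w_l`, every homomorphism is a
multiple of one that does not annihilate `w_0` under `w_m`. -/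
theorem exists_smul_eq {m a b l : ℕ} (hl : (b : F) - m = a - 2 * l)
    (φ ψ : Irr F m →ₗ⁅F, SL2 F⁆ (Irr F b →ₗ[F] Irr F a))
    (hψ : coord (ψ (wvec m m) (wvec b 0)) l ≠ 0) : ∃ t : F, φ = t • ψ := by
  have h1 := eq_smul_of_lie_h (hl ▸ lie_h_hom_apply φ)
  have h2 := eq_smul_of_lie_h (hl ▸ lie_h_hom_apply ψ)
  generalize coord (φ (wvec m m) (wvec b 0)) l = p at h1
  generalize coord (ψ (wvec m m) (wvec b 0)) l = q at h2 hψ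
  refine ⟨p / q, hom_eq_of_apply ?_⟩
  rw [LieModuleHom.smul_apply, LinearMap.smul_apply, h1, h2, smul_smul, div_mul_cancel₀ _ hψ]

theorem coord_contr_wvec_zero_ne_zero (m a : ℕ) :
    coord (contr F m a (wvec m m) (wvec (a + m) 0)) 0 ≠ 0 := by
  rw [coord_contr_wvec le_rfl _ (Nat.zero_le a), Nat.sub_self, coord_wvec_self (Nat.zero_le _)]
  simp

theorem coord_mult_wvec_zero_ne_zero (m b : ℕ) :
    coord (mult F m b (wvec m m) (wvec b 0)) m ≠ 0 := by
  intro h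
  have h1 := pcoord_mult_wvec (F := F) (le_refl m) (wvec b 0) (m : ℤ)
  rw [pcoord_natCast, h, sub_self, pcoord_wvec] at h1
  simp at h1

theorem contr_ne_zero (m a : ℕ) : contr F m a ≠ 0 := fun h =>
  coord_contr_wvec_zero_ne_zero (F := F) m a (by rw [h]; exact coord_zero 0)

theorem mult_ne_zero (m b : ℕ) : mult F m b ≠ 0 := fun h =>
  coord_mult_wvec_zero_ne_zero (F := F) m b (by rw [h]; exact coord_zero m)

theorem exists_eq_smul_contr {m a : ℕ} (φ : Irr F m →ₗ⁅F, SL2 F⁆ (Irr F (a + m) →ₗ[F] Irr F a)) :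
    ∃ t : F, φ = t • contr F m a :=
  exists_smul_eq (by push_cast; ring) φ _ (coord_contr_wvec_zero_ne_zero m a)

theorem exists_eq_smul_mult {m b : ℕ} (φ : Irr F m →ₗ⁅F, SL2 F⁆ (Irr F b →ₗ[F] Irr F (b + m))) :
    ∃ t : F, φ = t • mult F m b :=
  exists_smul_eq (by push_cast; ring) φ _ (coord_mult_wvec_zero_ne_zero m b)

end CharZero

/-! ### Socles and the invariants of the ideal `V(m)` -/

/-- The inclusion of the ideal `V(m)` into `g_m`. -/
def fromV (m : ℕ) (X : Irr F m) : Gm F m := LieAlgebra.SemiDirectSum.inl (slDer F m) X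

theorem eq_fromV_add_fromSl {m : ℕ} (Y : Gm F m) : Y = fromV m Y.left + fromSl m Y.right := by
  ext <;> simp [fromV, fromSl]

theorem lie_fromV {m : ℕ} (Y : Gm F m) (X : Irr F m) : ⁅Y, fromV m X⁆ = fromV m ⁅Y.right, X⁆ := by
  have h : ⁅Y.left, X⁆ = 0 := rfl
  have h' : (slDer F m Y.right) X = ⁅Y.right, X⁆ := rfl
  ext
  · simp [fromV, h, h']
  · simp [fromV]

theorem lie_eq_add {m : ℕ} {V : Type v} [AddCommGroup V] [LieRingModule (Gm F m) V] (Y : Gm F m)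
    (v : V) : ⁅Y, v⁆ = ⁅fromV m Y.left, v⁆ + ⁅fromSl m Y.right, v⁆ := by
  rw [← add_lie, ← eq_fromV_add_fromSl]

section Invariants

variable (F) (m : ℕ) (V : Type v) [AddCommGroup V] [Module F V] [LieRingModule (Gm F m) V]
  [LieModule F (Gm F m) V]

/-- The submodule of the vectors annihilated by `V(m)`. -/
def invariants : LieSubmodule F (Gm F m) V where
  carrier := {v | ∀ X : Irr F m, ⁅fromV m X, v⁆ = 0}
  add_mem' {v w} hv hw X := by rw [lie_add, hv X, hw X, add_zero]
  zero_mem' X := lie_zero _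
  smul_mem' t v hv X := by rw [lie_smul, hv X, smul_zero]
  lie_mem {Y v} hv X := by
    rw [leibniz_lie, hv X, lie_zero, add_zero, ← lie_skew, neg_lie, lie_fromV, hv, neg_zero]

variable {F m V}

theorem mem_invariants {v : V} : v ∈ invariants F m V ↔ ∀ X : Irr F m, ⁅fromV m X, v⁆ = 0 :=
  Iff.rfl

/-- If `V(m)` acts nilpotently, an irreducible submodule contains a nonzero vector annihilated by
`V(m)`, hence consists of such vectors. -/
theorem soc_le_invariants
    (hV : ∀ (X Y Z : Irr F m) (v : V), ⁅fromV m X, ⁅fromV m Y, ⁅fromV m Z, v⁆⁆⁆ = 0) :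
    soc F m V ≤ invariants F m V := by
  refine sSup_le fun N hN => ?_
  have hN : LieModule.IsIrreducible F (Gm F m) N := hN
  obtain ⟨n, hn, hn0, hinv⟩ : ∃ n ∈ N, n ≠ 0 ∧ n ∈ invariants F m V := by
    have : Nontrivial N := LieModule.nontrivial_of_isIrreducible F (Gm F m) N
    obtain ⟨⟨n, hn⟩, hn0⟩ := exists_ne (0 : N)
    have hn0 : n ≠ 0 := fun h => hn0 (Subtype.ext h)
    -- apply elements of `V(m)` to `n` until the next application gives zero
    by_cases h1 : ∀ X : Irr F m, ⁅fromV m X, n⁆ = 0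
    · exact ⟨n, hn, hn0, h1⟩
    · obtain ⟨X, hX⟩ := not_forall.mp h1
      by_cases h2 : ∀ Y : Irr F m, ⁅fromV m Y, ⁅fromV m X, n⁆⁆ = 0
      · exact ⟨_, N.lie_mem hn, hX, h2⟩
      · obtain ⟨Y, hY⟩ := not_forall.mp h2
        exact ⟨_, N.lie_mem (N.lie_mem hn), hY, fun Z => hV Z Y X n⟩
  have htop : (invariants F m V).comap N.incl = ⊤ := by
    refine (IsSimpleOrder.eq_bot_or_eq_top _).resolve_left fun hbot => hn0 ?_
    have : (⟨n, hn⟩ : N) ∈ (invariants F m V).comap N.incl := hinv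
    rw [hbot, LieSubmodule.mem_bot] at this
    exact congrArg Subtype.val this
  intro x hx
  have : (⟨x, hx⟩ : N) ∈ (invariants F m V).comap N.incl := by
    rw [htop]; exact LieSubmodule.mem_top _
  exact this

/-- A copy of `V(n)` annihilated by `V(m)` is contained in the socle. -/
theorem range_le_soc [CharZero F] {n : ℕ} (θ : Irr F n →ₗ[F] V) (hinj : Function.Injective θ)
    (hsl : ∀ (x : SL2 F) (v : Irr F n), θ ⁅x, v⁆ = ⁅fromSl m x, θ v⁆)
    (hinv : ∀ v, θ v ∈ invariants F m V) : LinearMap.range θ ≤ (soc F m V).toSubmodule := by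
  have hlie : ∀ (Y : Gm F m) (v : Irr F n), ⁅Y, θ v⁆ = θ ⁅Y.right, v⁆ := by
    intro Y v
    rw [lie_eq_add, mem_invariants.mp (hinv v), zero_add, hsl]
  let N : LieSubmodule F (Gm F m) V :=
    { LinearMap.range θ with
      lie_mem := by
        rintro Y _ ⟨v, rfl⟩
        exact ⟨_, (hlie Y v).symm⟩ }
  have hmem : ∀ v, θ v ∈ N := fun v => ⟨v, rfl⟩
  have : Nontrivial N := by
    refine ⟨⟨⟨_, hmem (wvec n 0)⟩, 0, fun h => wvec_ne_zero (F := F) (Nat.zero_le n) (hinj ?_)⟩⟩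
    rw [map_zero]
    exact congrArg Subtype.val h
  have hirr : LieModule.IsIrreducible F (Gm F m) N := by
    refine LieModule.IsIrreducible.mk fun P hP => ?_
    -- the preimage of `P` in `V(n)`
    let Q : Submodule F (Irr F n) :=
      { carrier := {v | (⟨θ v, hmem v⟩ : N) ∈ P}
        add_mem' := fun {v w} hv hw => by
          have : (⟨θ (v + w), hmem (v + w)⟩ : N) = ⟨θ v, hmem v⟩ + ⟨θ w, hmem w⟩ :=
            Subtype.ext (map_add θ v w)
          simp only [Set.mem_ofPred_eq, this]
          exact P.add_mem hv hw
        zero_mem' := by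
          have : (⟨θ 0, hmem 0⟩ : N) = 0 := Subtype.ext (map_zero θ)
          simp only [Set.mem_ofPred_eq, this]
          exact P.zero_mem
        smul_mem' := fun t v hv => by
          have : (⟨θ (t • v), hmem (t • v)⟩ : N) = t • ⟨θ v, hmem v⟩ :=
            Subtype.ext (map_smul θ t v)
          simp only [Set.mem_ofPred_eq, this]
          exact P.smul_mem t hv }
    have hQ : Q = ⊥ ∨ Q = ⊤ := Irr.eq_bot_or_eq_top Q fun x v hv => by
      have : (⟨θ ⁅x, v⁆, hmem _⟩ : N) = ⁅fromSl m x, (⟨θ v, hmem v⟩ : N)⁆ := Subtype.ext (hsl x v)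
      change (⟨θ ⁅x, v⁆, hmem _⟩ : N) ∈ P
      rw [this]
      exact P.lie_mem hv
    rcases hQ with hQ | hQ
    · refine absurd ((LieSubmodule.eq_bot_iff P).mpr ?_) hP
      rintro ⟨_, v, rfl⟩ hv
      have : v ∈ Q := hv
      rw [hQ, Submodule.mem_bot] at this
      subst this
      exact Subtype.ext (map_zero θ)
    · refine eq_top_iff.mpr fun n _ => ?_
      obtain ⟨_, v, rfl⟩ := n
      have : v ∈ Q := by rw [hQ]; exact Submodule.mem_top
      exact this
  exact le_sSup (α := LieSubmodule F (Gm F m) V) (show N ∈ _ from hirr)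

end Invariants

/-! ### Modules of the form `V(a) ⊕ V(b)` -/

/-- The maps `ιA : V(a) → V` and `ιB : V(b) → V` identify the `g_m`-module `V` with the module
`V(a) ⊕ V(b)` defined by `φ : V(m) → Hom(V(b), V(a))`. -/
structure IsSplit {m a b : ℕ} {V : Type v} [AddCommGroup V] [Module F V] [LieRingModule (Gm F m) V]
    (φ : Irr F m →ₗ⁅F, SL2 F⁆ (Irr F b →ₗ[F] Irr F a)) (ιA : Irr F a →ₗ[F] V)
    (ιB : Irr F b →ₗ[F] V) : Prop where
  bijective : Function.Bijective (ιA.coprod ιB)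
  lie_left : ∀ (Y : Gm F m) (v : Irr F a), ⁅Y, ιA v⁆ = ιA ⁅Y.right, v⁆
  lie_right : ∀ (Y : Gm F m) (v : Irr F b), ⁅Y, ιB v⁆ = ιA (φ Y.left v) + ιB ⁅Y.right, v⁆

namespace IsSplit

variable {m a b : ℕ} {V : Type v} [AddCommGroup V] [Module F V] [LieRingModule (Gm F m) V]
  {φ : Irr F m →ₗ⁅F, SL2 F⁆ (Irr F b →ₗ[F] Irr F a)} {ιA : Irr F a →ₗ[F] V} {ιB : Irr F b →ₗ[F] V}

theorem exists_eq (h : IsSplit φ ιA ιB) (v : V) : ∃ p q, v = ιA p + ιB q := by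
  obtain ⟨⟨p, q⟩, rfl⟩ := h.bijective.2 v
  exact ⟨p, q, by simp⟩

theorem injective_left (h : IsSplit φ ιA ιB) : Function.Injective ιA := by
  intro p p' hp
  have := @h.bijective.1 (p, 0) (p', 0) (by simpa using hp)
  exact congrArg Prod.fst this

theorem injective_right (h : IsSplit φ ιA ιB) : Function.Injective ιB := by
  intro p p' hp
  have := @h.bijective.1 (0, p) (0, p') (by simpa using hp)
  exact congrArg Prod.snd this

theorem fromV_left (h : IsSplit φ ιA ιB) (X : Irr F m) (v : Irr F a) : ⁅fromV m X, ιA v⁆ = 0 := by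
  rw [h.lie_left]
  simp [fromV]

theorem fromV_right (h : IsSplit φ ιA ιB) (X : Irr F m) (v : Irr F b) :
    ⁅fromV m X, ιB v⁆ = ιA (φ X v) := by
  rw [h.lie_right]
  simp [fromV]

theorem fromSl_left (h : IsSplit φ ιA ιB) (x : SL2 F) (v : Irr F a) :
    ⁅fromSl m x, ιA v⁆ = ιA ⁅x, v⁆ := by
  rw [h.lie_left]
  simp [fromSl]

theorem fromSl_right (h : IsSplit φ ιA ιB) (x : SL2 F) (v : Irr F b) :
    ⁅fromSl m x, ιB v⁆ = ιB ⁅x, v⁆ := by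
  rw [h.lie_right]
  simp [fromSl]

theorem fromV_fromV (h : IsSplit φ ιA ιB) (X Y : Irr F m) (v : V) :
    ⁅fromV m X, ⁅fromV m Y, v⁆⁆ = 0 := by
  obtain ⟨p, q, rfl⟩ := h.exists_eq v
  rw [lie_add, h.fromV_left, h.fromV_right, zero_add, h.fromV_left]

/-- Rescaling the second summand multiplies `φ` by a scalar. -/
theorem smul_right [LieModule F (Gm F m) V] {t : F} (ht : t ≠ 0) (h : IsSplit (t • φ) ιA ιB) :
    IsSplit φ ιA (t⁻¹ • ιB) where
  bijective := by
    constructor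
    · rintro ⟨p, q⟩ ⟨p', q'⟩ hpq
      have := @h.bijective.1 (p, t⁻¹ • q) (p', t⁻¹ • q') (by simpa using hpq)
      obtain ⟨h1, h2⟩ := Prod.mk.inj this
      rw [h1, smul_right_injective _ (inv_ne_zero ht) h2]
    · intro v
      obtain ⟨p, q, rfl⟩ := h.exists_eq v
      exact ⟨(p, t • q), by simp [ht]⟩
  lie_left := h.lie_left
  lie_right Y v := by
    simp [h.lie_right, ht]

end IsSplit

/-! ### The subspace `S_1` in terms of `V(m)`-invariants -/

theorem IsSplit.exists_projections {m a b : ℕ} {V : Type v} [AddCommGroup V] [Module F V]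
    [LieRingModule (Gm F m) V] {φ : Irr F m →ₗ⁅F, SL2 F⁆ (Irr F b →ₗ[F] Irr F a)}
    {ιA : Irr F a →ₗ[F] V} {ιB : Irr F b →ₗ[F] V} (h : IsSplit φ ιA ιB) :
    ∃ (ρA : V →ₗ[F] Irr F a) (ρB : V →ₗ[F] Irr F b), ρA ∘ₗ ιA = LinearMap.id ∧ ρA ∘ₗ ιB = 0 ∧
      ρB ∘ₗ ιA = 0 ∧ ρB ∘ₗ ιB = LinearMap.id := by
  let Ψ := LinearEquiv.ofBijective (ιA.coprod ιB) h.bijective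
  have hA : ∀ p, Ψ.symm (ιA p) = (p, 0) := fun p => by
    rw [LinearEquiv.symm_apply_eq]; simp [Ψ]
  have hB : ∀ q, Ψ.symm (ιB q) = (0, q) := fun q => by
    rw [LinearEquiv.symm_apply_eq]; simp [Ψ]
  refine ⟨LinearMap.fst F _ _ ∘ₗ Ψ.symm.toLinearMap, LinearMap.snd F _ _ ∘ₗ Ψ.symm.toLinearMap,
    ?_, ?_, ?_, ?_⟩ <;> ext v : 1 <;> simp [hA, hB]

theorem lie_map_tmul {L₁ L₂ : Type*} [LieRing L₁] [LieAlgebra F L₁] [LieRing L₂] [LieAlgebra F L₂]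
    {M N P Q : Type*} [AddCommGroup M] [Module F M] [LieRingModule L₁ M] [LieModule F L₁ M]
    [AddCommGroup N] [Module F N] [LieRingModule L₁ N] [LieModule F L₁ N]
    [AddCommGroup P] [Module F P] [LieRingModule L₂ P] [LieModule F L₂ P]
    [AddCommGroup Q] [Module F Q] [LieRingModule L₂ Q] [LieModule F L₂ Q]
    (f : M →ₗ[F] P) (g : N →ₗ[F] Q) (x : L₁) (y : L₂) (hf : ∀ v, ⁅y, f v⁆ = f ⁅x, v⁆)
    (hg : ∀ v, ⁅y, g v⁆ = g ⁅x, v⁆) (t : M ⊗[F] N) :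
    ⁅y, TensorProduct.map f g t⁆ = TensorProduct.map f g ⁅x, t⁆ := by
  induction t with
  | zero => simp
  | tmul p q => simp [TensorProduct.LieModule.lie_tmul_right, hf, hg]
  | add s t hs ht => rw [map_add, lie_add, hs, ht, lie_add, map_add]

section Compatible

variable {m a b c d : ℕ}

/-- For `x ∈ V(a) ⊗ V(d)` and `y ∈ V(b) ⊗ V(c)`, the condition that `x + y` is annihilated by
`V(m)`. -/
def Compatible (φ₁ : Irr F m →ₗ⁅F, SL2 F⁆ (Irr F b →ₗ[F] Irr F a))
    (φ₂ : Irr F m →ₗ⁅F, SL2 F⁆ (Irr F d →ₗ[F] Irr F c)) (x : Irr F a ⊗[F] Irr F d)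
    (y : Irr F b ⊗[F] Irr F c) : Prop :=
  ∀ X : Irr F m, TensorProduct.map LinearMap.id (φ₂ X) x +
    TensorProduct.map (φ₁ X) LinearMap.id y = 0

/-- The homomorphisms `θ₁` and `θ₂` parametrize the compatible pairs by `V(μ)`: the map
`g ↦ (θ₁ g, θ₂ g)` is an isomorphism of `sl(2)`-modules from `V(μ)` onto the space of these
pairs. -/
structure IsParam {μ : ℕ} (φ₁ : Irr F m →ₗ⁅F, SL2 F⁆ (Irr F b →ₗ[F] Irr F a))
    (φ₂ : Irr F m →ₗ⁅F, SL2 F⁆ (Irr F d →ₗ[F] Irr F c))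
    (θ₁ : Irr F μ →ₗ[F] Irr F a ⊗[F] Irr F d) (θ₂ : Irr F μ →ₗ[F] Irr F b ⊗[F] Irr F c) :
    Prop where
  eq_zero : ∀ g, θ₁ g = 0 → θ₂ g = 0 → g = 0
  lie_fst : ∀ (x : SL2 F) g, θ₁ ⁅x, g⁆ = ⁅x, θ₁ g⁆
  lie_snd : ∀ (x : SL2 F) g, θ₂ ⁅x, g⁆ = ⁅x, θ₂ g⁆
  compatible : ∀ g, Compatible φ₁ φ₂ (θ₁ g) (θ₂ g)
  exists_eq : ∀ x y, Compatible φ₁ φ₂ x y → ∃ g, θ₁ g = x ∧ θ₂ g = y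

end Compatible

section Tensor

variable {m a b c d : ℕ} {V₁ : Type v} {V₂ : Type w} [AddCommGroup V₁] [Module F V₁]
  [LieRingModule (Gm F m) V₁] [AddCommGroup V₂] [Module F V₂] [LieRingModule (Gm F m) V₂]
  {φ₁ : Irr F m →ₗ⁅F, SL2 F⁆ (Irr F b →ₗ[F] Irr F a)} {ιA : Irr F a →ₗ[F] V₁}
  {ιB : Irr F b →ₗ[F] V₁}
  {φ₂ : Irr F m →ₗ⁅F, SL2 F⁆ (Irr F d →ₗ[F] Irr F c)} {ιC : Irr F c →ₗ[F] V₂}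
  {ιD : Irr F d →ₗ[F] V₂}

theorem map_left_left_injective (h₁ : IsSplit φ₁ ιA ιB) (h₂ : IsSplit φ₂ ιC ιD) :
    Function.Injective (TensorProduct.map ιA ιC) := by
  obtain ⟨ρA, -, hA, -, -, -⟩ := h₁.exists_projections
  obtain ⟨ρC, -, hC, -, -, -⟩ := h₂.exists_projections
  refine Function.LeftInverse.injective (g := TensorProduct.map ρA ρC) fun t => ?_
  rw [← LinearMap.comp_apply, ← TensorProduct.map_comp, hA, hC, TensorProduct.map_id,
    LinearMap.id_apply]

theorem eq_of_map_add_map_eq (h₁ : IsSplit φ₁ ιA ιB) (h₂ : IsSplit φ₂ ιC ιD)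
    {x x' : Irr F a ⊗[F] Irr F d} {y y' : Irr F b ⊗[F] Irr F c}
    (h : TensorProduct.map ιA ιD x + TensorProduct.map ιB ιC y =
      TensorProduct.map ιA ιD x' + TensorProduct.map ιB ιC y') : x = x' ∧ y = y' := by
  obtain ⟨ρA, ρB, hAA, hAB, hBA, hBB⟩ := h₁.exists_projections
  obtain ⟨ρC, ρD, hCC, hCD, hDC, hDD⟩ := h₂.exists_projections
  constructor
  · have := congrArg (TensorProduct.map ρA ρD) h
    simpa only [map_add, ← LinearMap.comp_apply, ← TensorProduct.map_comp, hAA, hDD, hAB, hDC,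
      TensorProduct.map_id, LinearMap.id_apply, TensorProduct.map_zero_left, LinearMap.zero_apply,
      add_zero] using this
  · have := congrArg (TensorProduct.map ρB ρC) h
    simpa only [map_add, ← LinearMap.comp_apply, ← TensorProduct.map_comp, hBB, hCC, hBA, hCD,
      TensorProduct.map_id, LinearMap.id_apply, TensorProduct.map_zero_left, LinearMap.zero_apply,
      zero_add] using this

/-- The map `V(μ) → V₁ ⊗ V₂` defined by a parametrization of the compatible pairs. -/
def paramMap {μ : ℕ} (ιA : Irr F a →ₗ[F] V₁) (ιB : Irr F b →ₗ[F] V₁) (ιC : Irr F c →ₗ[F] V₂)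
    (ιD : Irr F d →ₗ[F] V₂) (θ₁ : Irr F μ →ₗ[F] Irr F a ⊗[F] Irr F d)
    (θ₂ : Irr F μ →ₗ[F] Irr F b ⊗[F] Irr F c) : Irr F μ →ₗ[F] V₁ ⊗[F] V₂ :=
  TensorProduct.map ιA ιD ∘ₗ θ₁ + TensorProduct.map ιB ιC ∘ₗ θ₂

theorem paramMap_apply {μ : ℕ} (θ₁ : Irr F μ →ₗ[F] Irr F a ⊗[F] Irr F d)
    (θ₂ : Irr F μ →ₗ[F] Irr F b ⊗[F] Irr F c) (g : Irr F μ) :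
    paramMap ιA ιB ιC ιD θ₁ θ₂ g =
      TensorProduct.map ιA ιD (θ₁ g) + TensorProduct.map ιB ιC (θ₂ g) := rfl

variable {μ : ℕ} {θ₁ : Irr F μ →ₗ[F] Irr F a ⊗[F] Irr F d}
  {θ₂ : Irr F μ →ₗ[F] Irr F b ⊗[F] Irr F c}

theorem IsParam.paramMap_injective (h : IsParam φ₁ φ₂ θ₁ θ₂) (h₁ : IsSplit φ₁ ιA ιB)
    (h₂ : IsSplit φ₂ ιC ιD) : Function.Injective (paramMap ιA ιB ιC ιD θ₁ θ₂) := by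
  refine (injective_iff_map_eq_zero _).mpr fun g hg => ?_
  obtain ⟨hx, hy⟩ := eq_of_map_add_map_eq h₁ h₂ (x := θ₁ g) (x' := 0) (y := θ₂ g) (y' := 0)
    (by simpa only [paramMap_apply, map_zero, add_zero] using hg)
  exact h.eq_zero g hx hy

variable [LieModule F (Gm F m) V₁] [LieModule F (Gm F m) V₂]

theorem fromV_map_left_right (h₁ : IsSplit φ₁ ιA ιB) (h₂ : IsSplit φ₂ ιC ιD) (X : Irr F m)
    (t : Irr F a ⊗[F] Irr F d) : ⁅fromV m X, TensorProduct.map ιA ιD t⁆ =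
      TensorProduct.map ιA ιC (TensorProduct.map LinearMap.id (φ₂ X) t) := by
  induction t with
  | zero => simp
  | tmul p q =>
    simp [TensorProduct.LieModule.lie_tmul_right, h₁.fromV_left, h₂.fromV_right]
  | add s t hs ht => rw [map_add, lie_add, hs, ht, map_add, map_add]

theorem fromV_map_right_left (h₁ : IsSplit φ₁ ιA ιB) (h₂ : IsSplit φ₂ ιC ιD) (X : Irr F m)
    (t : Irr F b ⊗[F] Irr F c) : ⁅fromV m X, TensorProduct.map ιB ιC t⁆ =
      TensorProduct.map ιA ιC (TensorProduct.map (φ₁ X) LinearMap.id t) := by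
  induction t with
  | zero => simp
  | tmul p q =>
    simp [TensorProduct.LieModule.lie_tmul_right, h₂.fromV_left, h₁.fromV_right]
  | add s t hs ht => rw [map_add, lie_add, hs, ht, map_add, map_add]

/-- Products of two elements of `V(m)` annihilate each factor, so products of three annihilate the
tensor product. -/
theorem fromV_tensor_eq_zero (h₁ : IsSplit φ₁ ιA ιB) (h₂ : IsSplit φ₂ ιC ιD) (X Y Z : Irr F m)
    (t : V₁ ⊗[F] V₂) : ⁅fromV m X, ⁅fromV m Y, ⁅fromV m Z, t⁆⁆⁆ = 0 := by
  induction t with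
  | zero => simp
  | tmul p q =>
    simp [TensorProduct.LieModule.lie_tmul_right, h₁.fromV_fromV, h₂.fromV_fromV]
  | add s t hs ht => simp only [lie_add, hs, ht, add_zero]

theorem mem_invariants_iff_compatible (h₁ : IsSplit φ₁ ιA ιB) (h₂ : IsSplit φ₂ ιC ιD)
    (x : Irr F a ⊗[F] Irr F d) (y : Irr F b ⊗[F] Irr F c) :
    TensorProduct.map ιA ιD x + TensorProduct.map ιB ιC y ∈ invariants F m (V₁ ⊗[F] V₂) ↔
      Compatible φ₁ φ₂ x y := by
  rw [mem_invariants]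
  refine forall_congr' fun X => ?_
  rw [lie_add, fromV_map_left_right h₁ h₂, fromV_map_right_left h₁ h₂, ← map_add,
    map_eq_zero_iff _ (map_left_left_injective h₁ h₂)]

theorem mem_S1_iff (t : V₁ ⊗[F] V₂) :
    t ∈ S1 m (LinearMap.range ιA) (LinearMap.range ιB) (LinearMap.range ιC) (LinearMap.range ιD) ↔
      t ∈ soc F m (V₁ ⊗[F] V₂) ∧
        ∃ x y, TensorProduct.map ιA ιD x + TensorProduct.map ιB ιC y = t := by
  rw [S1, Submodule.mem_inf, ← TensorProduct.range_map, ← TensorProduct.range_map,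
    Submodule.mem_sup]
  simp

theorem S1_eq_bot (h₁ : IsSplit φ₁ ιA ιB) (h₂ : IsSplit φ₂ ιC ιD)
    (h : ∀ x y, Compatible φ₁ φ₂ x y → x = 0 ∧ y = 0) :
    S1 m (LinearMap.range ιA) (LinearMap.range ιB) (LinearMap.range ιC) (LinearMap.range ιD) =
      ⊥ := by
  refine (Submodule.eq_bot_iff _).mpr fun t ht => ?_
  obtain ⟨hsoc, x, y, rfl⟩ := (mem_S1_iff t).mp ht
  obtain ⟨rfl, rfl⟩ := h x y ((mem_invariants_iff_compatible h₁ h₂ x y).mp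
    (soc_le_invariants (fromV_tensor_eq_zero h₁ h₂) hsoc))
  simp

namespace IsParam

theorem paramMap_lie (h : IsParam φ₁ φ₂ θ₁ θ₂) (h₁ : IsSplit φ₁ ιA ιB)
    (h₂ : IsSplit φ₂ ιC ιD) (x : SL2 F) (g : Irr F μ) :
    paramMap ιA ιB ιC ιD θ₁ θ₂ ⁅x, g⁆ = ⁅fromSl m x, paramMap ιA ιB ιC ιD θ₁ θ₂ g⁆ := by
  rw [paramMap_apply, paramMap_apply, lie_add, h.lie_fst, h.lie_snd,
    lie_map_tmul ιA ιD x (fromSl m x) (h₁.fromSl_left x) (h₂.fromSl_right x),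
    lie_map_tmul ιB ιC x (fromSl m x) (h₁.fromSl_right x) (h₂.fromSl_left x)]

theorem S1_eq_range [CharZero F] (h : IsParam φ₁ φ₂ θ₁ θ₂) (h₁ : IsSplit φ₁ ιA ιB)
    (h₂ : IsSplit φ₂ ιC ιD) :
    S1 m (LinearMap.range ιA) (LinearMap.range ιB) (LinearMap.range ιC) (LinearMap.range ιD) =
      LinearMap.range (paramMap ιA ιB ιC ιD θ₁ θ₂) := by
  ext t
  rw [mem_S1_iff]
  constructor
  · rintro ⟨hsoc, x, y, rfl⟩
    obtain ⟨g, rfl, rfl⟩ := h.exists_eq x y ((mem_invariants_iff_compatible h₁ h₂ x y).mp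
      (soc_le_invariants (fromV_tensor_eq_zero h₁ h₂) hsoc))
    exact ⟨g, rfl⟩
  · rintro ⟨g, rfl⟩
    refine ⟨?_, _, _, rfl⟩
    refine range_le_soc _ (h.paramMap_injective h₁ h₂) (h.paramMap_lie h₁ h₂) (fun g => ?_)
      ⟨g, rfl⟩
    rw [paramMap_apply, mem_invariants_iff_compatible h₁ h₂]
    exact h.compatible g

theorem isoIrr [CharZero F] (h : IsParam φ₁ φ₂ θ₁ θ₂) (h₁ : IsSplit φ₁ ιA ιB)
    (h₂ : IsSplit φ₂ ιC ιD) :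
    IsoIrr m (S1 m (LinearMap.range ιA) (LinearMap.range ιB) (LinearMap.range ιC)
      (LinearMap.range ιD)) μ := by
  rw [h.S1_eq_range h₁ h₂]
  exact ⟨LinearEquiv.ofInjective _ (h.paramMap_injective h₁ h₂), h.paramMap_lie h₁ h₂⟩

theorem isHighestWeight [CharZero F] (h : IsParam φ₁ φ₂ θ₁ θ₂) (h₁ : IsSplit φ₁ ιA ιB)
    (h₂ : IsSplit φ₂ ιC ιD) {κ : F} (hκ : κ ≠ 0) :
    IsHighestWeight m (S1 m (LinearMap.range ιA) (LinearMap.range ιB) (LinearMap.range ιC)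
      (LinearMap.range ιD)) μ (κ • paramMap ιA ιB ιC ιD θ₁ θ₂ (wvec μ 0)) := by
  rw [h.S1_eq_range h₁ h₂]
  refine ⟨Submodule.smul_mem _ _ ⟨_, rfl⟩, smul_ne_zero hκ fun h0 =>
    wvec_ne_zero (F := F) (Nat.zero_le μ) (h.paramMap_injective h₁ h₂ (by rw [h0, map_zero])),
    ?_, ?_⟩
  · rw [lie_smul, ← h.paramMap_lie h₁ h₂, lie_e_wvec_zero, map_zero, smul_zero]
  · rw [lie_smul, ← h.paramMap_lie h₁ h₂, lie_h_wvec, map_smul, smul_comm]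
    simp

end IsParam

end Tensor

/-! ### Coordinates on tensor products -/

/-- The linear form `f ⊗ g` on `M ⊗ N`. -/
def tensorForm {M N : Type*} [AddCommGroup M] [Module F M] [AddCommGroup N] [Module F N]
    (f : M →ₗ[F] F) (g : N →ₗ[F] F) : M ⊗[F] N →ₗ[F] F :=
  LinearMap.mul' F F ∘ₗ TensorProduct.map f g

@[simp] theorem tensorForm_tmul {M N : Type*} [AddCommGroup M] [Module F M] [AddCommGroup N]
    [Module F N] (f : M →ₗ[F] F) (g : N →ₗ[F] F) (p : M) (q : N) :
    tensorForm f g (p ⊗ₜ q) = f p * g q := rfl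

/-- The coordinate of a tensor at `w_i ⊗ w_k`. -/
abbrev tcoord {a d : ℕ} (i k : ℕ) : Irr F a ⊗[F] Irr F d →ₗ[F] F :=
  tensorForm (coordL a i) (coordL d k)

/-- The coordinate of a tensor, with a polynomial coordinate in the second factor. -/
abbrev mcoord {a d : ℕ} (i : ℕ) (k : ℤ) : Irr F a ⊗[F] Irr F d →ₗ[F] F :=
  tensorForm (coordL a i) (pcoordL d k)

/-- The polynomial coordinates of a tensor. -/
abbrev ppcoord {a d : ℕ} (i k : ℤ) : Irr F a ⊗[F] Irr F d →ₗ[F] F :=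
  tensorForm (pcoordL a i) (pcoordL d k)

section

variable {a d : ℕ}

theorem eq_sum_tcoord (t : Irr F a ⊗[F] Irr F d) :
    t = ∑ i ∈ Finset.range (a + 1), ∑ k ∈ Finset.range (d + 1),
      tcoord i k t • (wvec a i ⊗ₜ[F] wvec d k) := by
  induction t with
  | zero => simp
  | tmul p q =>
    conv_lhs => rw [eq_sum_wvec p, eq_sum_wvec q]
    rw [TensorProduct.sum_tmul]
    refine Finset.sum_congr rfl fun i _ => ?_
    rw [TensorProduct.tmul_sum]
    refine Finset.sum_congr rfl fun k _ => ?_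
    rw [TensorProduct.smul_tmul_smul, tensorForm_tmul, coordL_apply, coordL_apply]
  | add s t hs ht =>
    conv_lhs => rw [hs, ht]
    simp only [← Finset.sum_add_distrib, ← add_smul, ← map_add]

theorem ext_tcoord {s t : Irr F a ⊗[F] Irr F d}
    (h : ∀ i ≤ a, ∀ k ≤ d, tcoord i k s = tcoord i k t) : s = t := by
  rw [eq_sum_tcoord s, eq_sum_tcoord t]
  refine Finset.sum_congr rfl fun i hi => Finset.sum_congr rfl fun k hk => ?_
  rw [h i (Nat.lt_succ_iff.mp (Finset.mem_range.mp hi)) k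
    (Nat.lt_succ_iff.mp (Finset.mem_range.mp hk))]

theorem mcoord_natCast (i k : ℕ) (t : Irr F a ⊗[F] Irr F d) :
    mcoord i k t = (d.choose k : F) * tcoord i k t := by
  induction t with
  | zero => simp
  | tmul p q => simp [pcoord_natCast]; ring
  | add s t hs ht => rw [map_add, map_add, hs, ht, mul_add]

theorem ppcoord_natCast (i : ℕ) (k : ℤ) (t : Irr F a ⊗[F] Irr F d) :
    ppcoord i k t = (a.choose i : F) * mcoord i k t := by
  induction t with
  | zero => simp
  | tmul p q => simp [pcoord_natCast]; ring
  | add s t hs ht => rw [map_add, map_add, hs, ht, mul_add]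

theorem mcoord_eq_zero (i : ℕ) {k : ℤ} (hk : k < 0 ∨ (d : ℤ) < k) (t : Irr F a ⊗[F] Irr F d) :
    mcoord i k t = 0 := by
  induction t with
  | zero => simp
  | tmul p q =>
    rcases hk with hk | hk
    · simp [pcoord_of_neg q hk]
    · simp [pcoord_of_lt q hk]
  | add s t hs ht => rw [map_add, hs, ht, add_zero]

theorem ppcoord_eq_zero (i : ℤ) {k : ℤ} (hk : (d : ℤ) < k) (t : Irr F a ⊗[F] Irr F d) :
    ppcoord i k t = 0 := by
  induction t with
  | zero => simp
  | tmul p q => simp [pcoord_of_lt q hk]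
  | add s t hs ht => rw [map_add, hs, ht, add_zero]

theorem ext_mcoord [CharZero F] {s t : Irr F a ⊗[F] Irr F d}
    (h : ∀ i ≤ a, ∀ k : ℤ, mcoord i k s = mcoord i k t) : s = t := by
  refine ext_tcoord fun i hi k hk => ?_
  have := h i hi k
  rw [mcoord_natCast, mcoord_natCast] at this
  exact mul_left_cancel₀ (choose_ne_zero hk) this

theorem ext_ppcoord [CharZero F] {s t : Irr F a ⊗[F] Irr F d}
    (h : ∀ i k : ℤ, ppcoord i k s = ppcoord i k t) : s = t := by
  refine ext_mcoord fun i hi k => ?_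
  have := h i k
  rw [ppcoord_natCast, ppcoord_natCast] at this
  exact mul_left_cancel₀ (choose_ne_zero hi) this

theorem tcoord_lie (x : SL2 F) (t : Irr F a ⊗[F] Irr F d) {i k : ℕ} (hi : i ≤ a) (hk : k ≤ d) :
    tcoord i k ⁅x, t⁆ =
      x.1 0 1 * (((a : F) - i) * tcoord (i + 1) k t + ((d : F) - k) * tcoord i (k + 1) t)
      + x.1 0 0 * ((a : F) - 2 * i + d - 2 * k) * tcoord i k t
      + x.1 1 0 * ((i : F) * tcoord (i - 1) k t + (k : F) * tcoord i (k - 1) t) := by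
  induction t with
  | zero => simp
  | tmul p q =>
    simp only [TensorProduct.LieModule.lie_tmul_right, map_add, tensorForm_tmul, coordL_apply,
      coord_lie _ _ hi, coord_lie _ _ hk]
    ring
  | add s t hs ht => simp only [lie_add, map_add, hs, ht]; ring

theorem mcoord_lie (x : SL2 F) (t : Irr F a ⊗[F] Irr F d) {i : ℕ} (hi : i ≤ a) (k : ℤ) :
    mcoord i k ⁅x, t⁆ =
      x.1 0 1 * (((a : F) - i) * mcoord (i + 1) k t + ((k : F) + 1) * mcoord i (k + 1) t)
      + x.1 0 0 * ((a : F) - 2 * i + d - 2 * k) * mcoord i k t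
      + x.1 1 0 * ((i : F) * mcoord (i - 1) k t + ((d : F) - k + 1) * mcoord i (k - 1) t) := by
  induction t with
  | zero => simp
  | tmul p q =>
    simp only [TensorProduct.LieModule.lie_tmul_right, map_add, tensorForm_tmul, coordL_apply,
      pcoordL_apply, coord_lie _ _ hi, pcoord_lie]
    ring
  | add s t hs ht => simp only [lie_add, map_add, hs, ht]; ring

/-- The linear map `V(μ) → V(a) ⊗ V(d)` with prescribed coordinates. -/
def ofTCoord {μ : ℕ} (p : ℕ → ℕ → Irr F μ →ₗ[F] F) : Irr F μ →ₗ[F] Irr F a ⊗[F] Irr F d :=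
  ∑ i ∈ Finset.range (a + 1), ∑ k ∈ Finset.range (d + 1),
    (p i k).smulRight (wvec a i ⊗ₜ[F] wvec d k)

theorem tcoord_ofTCoord {μ : ℕ} (p : ℕ → ℕ → Irr F μ →ₗ[F] F) (g : Irr F μ) {i k : ℕ} (hi : i ≤ a)
    (hk : k ≤ d) : tcoord i k (ofTCoord p g : Irr F a ⊗[F] Irr F d) = p i k g := by
  simp only [ofTCoord, LinearMap.sum_apply, LinearMap.smulRight_apply, map_sum, map_smul,
    tensorForm_tmul, coordL_apply, coord_wvec _ _ hi, coord_wvec _ _ hk, smul_eq_mul]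
  rw [Finset.sum_eq_single i, Finset.sum_eq_single k]
  · simp
  · intro l _ hl
    rw [if_neg (Ne.symm hl)]; simp
  · intro h
    exact absurd (Finset.mem_range.mpr (Nat.lt_succ_of_le hk)) h
  · intro l _ hl
    refine Finset.sum_eq_zero fun j _ => ?_
    rw [if_neg (Ne.symm hl)]; simp
  · intro h
    exact absurd (Finset.mem_range.mpr (Nat.lt_succ_of_le hi)) h

end

theorem forall_sum_pcoord_eq_zero [CharZero F] {m : ℕ} {B : ℕ → F}
    (h : ∀ X : Irr F m, ∑ s ∈ Finset.range (m + 1), pcoord X s * B s = 0) {s : ℕ} (hs : s ≤ m) :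
    B s = 0 := by
  have := h (wvec m s)
  rw [sum_pcoord_wvec hs B] at this
  exact (mul_eq_zero.mp this).resolve_left (choose_ne_zero hs)

section

variable {m a b c d : ℕ}

theorem tcoord_map_id_contr (X : Irr F m) (t : Irr F a ⊗[F] Irr F (c + m)) (i : ℕ) {k : ℕ}
    (hk : k ≤ c) : tcoord i k (TensorProduct.map LinearMap.id (contr F m c X) t) =
      ∑ s ∈ Finset.range (m + 1), pcoord X s * ((-1) ^ s * tcoord i (k + (m - s)) t) := by
  induction t with
  | zero => simp
  | tmul p q =>
    simp only [TensorProduct.map_tmul, tensorForm_tmul, coordL_apply, LinearMap.id_apply,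
      coord_contr _ _ hk, Finset.mul_sum]
    exact Finset.sum_congr rfl fun s _ => by ring
  | add s t hs ht => simp only [map_add, hs, ht, mul_add, Finset.sum_add_distrib]

theorem tcoord_map_contr_id (X : Irr F m) (t : Irr F (a + m) ⊗[F] Irr F c) {i : ℕ} (hi : i ≤ a)
    (k : ℕ) : tcoord i k (TensorProduct.map (contr F m a X) LinearMap.id t) =
      ∑ s ∈ Finset.range (m + 1), pcoord X s * ((-1) ^ s * tcoord (i + (m - s)) k t) := by
  induction t with
  | zero => simp
  | tmul p q =>
    simp only [TensorProduct.map_tmul, tensorForm_tmul, coordL_apply, LinearMap.id_apply,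
      coord_contr _ _ hi, Finset.sum_mul]
    exact Finset.sum_congr rfl fun s _ => by ring
  | add s t hs ht => simp only [map_add, hs, ht, mul_add, Finset.sum_add_distrib]

theorem mcoord_map_contr_id (X : Irr F m) (t : Irr F (a + m) ⊗[F] Irr F c) {i : ℕ} (hi : i ≤ a)
    (k : ℤ) : mcoord i k (TensorProduct.map (contr F m a X) LinearMap.id t) =
      ∑ s ∈ Finset.range (m + 1), pcoord X s * ((-1) ^ s * mcoord (i + (m - s)) k t) := by
  induction t with
  | zero => simp
  | tmul p q =>
    simp only [TensorProduct.map_tmul, tensorForm_tmul, coordL_apply, LinearMap.id_apply,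
      coord_contr _ _ hi, Finset.sum_mul]
    exact Finset.sum_congr rfl fun s _ => by ring
  | add s t hs ht => simp only [map_add, hs, ht, mul_add, Finset.sum_add_distrib]

variable [CharZero F]

theorem mcoord_map_id_mult (X : Irr F m) (t : Irr F a ⊗[F] Irr F d) (i : ℕ) (k : ℤ) :
    mcoord i k (TensorProduct.map LinearMap.id (mult F m d X) t) =
      ∑ s ∈ Finset.range (m + 1), pcoord X s * mcoord i (k - s) t := by
  induction t with
  | zero => simp
  | tmul p q =>
    simp only [TensorProduct.map_tmul, tensorForm_tmul, coordL_apply, LinearMap.id_apply,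
      pcoordL_apply, pcoord_mult, Finset.mul_sum]
    exact Finset.sum_congr rfl fun s _ => by ring
  | add s t hs ht => simp only [map_add, hs, ht, mul_add, Finset.sum_add_distrib]

theorem ppcoord_map_id_mult (X : Irr F m) (t : Irr F a ⊗[F] Irr F d) (i : ℤ) (k : ℤ) :
    ppcoord i k (TensorProduct.map LinearMap.id (mult F m d X) t) =
      ∑ s ∈ Finset.range (m + 1), pcoord X s * ppcoord i (k - s) t := by
  induction t with
  | zero => simp
  | tmul p q =>
    simp only [TensorProduct.map_tmul, tensorForm_tmul, LinearMap.id_apply,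
      pcoordL_apply, pcoord_mult, Finset.mul_sum]
    exact Finset.sum_congr rfl fun s _ => by ring
  | add s t hs ht => simp only [map_add, hs, ht, mul_add, Finset.sum_add_distrib]

theorem ppcoord_map_mult_id (X : Irr F m) (t : Irr F b ⊗[F] Irr F c) (i : ℤ) (k : ℤ) :
    ppcoord i k (TensorProduct.map (mult F m b X) LinearMap.id t) =
      ∑ s ∈ Finset.range (m + 1), pcoord X s * ppcoord (i - s) k t := by
  induction t with
  | zero => simp
  | tmul p q =>
    simp only [TensorProduct.map_tmul, tensorForm_tmul, LinearMap.id_apply,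
      pcoordL_apply, pcoord_mult, Finset.sum_mul]
    exact Finset.sum_congr rfl fun s _ => by ring
  | add s t hs ht => simp only [map_add, hs, ht, mul_add, Finset.sum_add_distrib]

end

/-! ### Two contractions -/

section

variable {a d μ : ℕ}

/-- The inclusion `V(a + d) → V(a) ⊗ V(d)`, with `μ = a + d`: the polarization of forms. -/
def polar (F : Type u) [Field F] (a d μ : ℕ) : Irr F μ →ₗ[F] Irr F a ⊗[F] Irr F d :=
  ofTCoord fun i k => coordL μ (i + k)

theorem tcoord_polar (g : Irr F μ) {i k : ℕ} (hi : i ≤ a) (hk : k ≤ d) :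
    tcoord i k (polar F a d μ g) = coord g (i + k) :=
  tcoord_ofTCoord _ g hi hk

theorem polar_lie (hμ : a + d = μ) (x : SL2 F) (g : Irr F μ) :
    polar F a d μ ⁅x, g⁆ = ⁅x, polar F a d μ g⁆ := by
  refine ext_tcoord fun i hi k hk => ?_
  have h1 : ((a : F) - i) * tcoord (i + 1) k (polar F a d μ g) =
      ((a : F) - i) * coord g (i + k + 1) := by
    rcases hi.eq_or_lt with rfl | hlt
    · simp
    · rw [tcoord_polar _ hlt hk, show i + 1 + k = i + k + 1 by omega]
  have h2 : ((d : F) - k) * tcoord i (k + 1) (polar F a d μ g) =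
      ((d : F) - k) * coord g (i + k + 1) := by
    rcases hk.eq_or_lt with rfl | hlt
    · simp
    · rw [tcoord_polar _ hi hlt, show i + (k + 1) = i + k + 1 by omega]
  have h3 : (i : F) * tcoord (i - 1) k (polar F a d μ g) = i * coord g (i + k - 1) := by
    rcases i with _ | i
    · simp
    · rw [tcoord_polar _ (by omega) hk, show i + 1 - 1 + k = i + 1 + k - 1 by omega]
  have h4 : (k : F) * tcoord i (k - 1) (polar F a d μ g) = k * coord g (i + k - 1) := by
    rcases k with _ | k
    · simp
    · rw [tcoord_polar _ hi (by omega), show i + (k + 1 - 1) = i + (k + 1) - 1 by omega]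
  rw [tcoord_lie _ _ hi hk, h1, h2, h3, h4, tcoord_polar _ hi hk, tcoord_polar _ hi hk,
    coord_lie _ _ (by omega), show (μ : F) = a + d by rw [← hμ, Nat.cast_add]]
  push_cast
  ring

theorem polar_injective (hμ : a + d = μ) {g : Irr F μ} (hg : polar F a d μ g = 0) : g = 0 := by
  refine Irr.ext_coord fun k hk => ?_
  have := tcoord_polar g (min_le_right k a) (show k - min k a ≤ d by omega)
  rw [hg, map_zero, show min k a + (k - min k a) = k by omega] at this
  rw [← this, coord_zero]

/-- A double form is a polarization if its coordinate at `w_i ⊗ w_k` depends only on `i + k`. -/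
theorem exists_polar {t : Irr F a ⊗[F] Irr F d} (hμ : a + d = μ)
    (h : ∀ i k, i + 1 ≤ a → k + 1 ≤ d → tcoord i (k + 1) t = tcoord (i + 1) k t) :
    ∃ g, polar F a d μ g = t := by
  have key : ∀ n i k, i + n ≤ a → k + n ≤ d → tcoord i (k + n) t = tcoord (i + n) k t := by
    intro n
    induction n with
    | zero => exact fun _ _ _ _ => rfl
    | succ n ih =>
      intro i k hi hk
      rw [show k + (n + 1) = (k + n) + 1 by omega, h i (k + n) (by omega) (by omega),
        ih (i + 1) k (by omega) (by omega), show i + 1 + n = i + (n + 1) by omega]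
  refine ⟨ofCoord μ fun j => tcoord (min j a) (j - min j a) t, ext_tcoord fun i hi k hk => ?_⟩
  rw [tcoord_polar _ hi hk, coord_ofCoord _ (by omega)]
  have := key (min (i + k) a - i) i (i + k - min (i + k) a) (by omega) (by omega)
  rw [show i + k - min (i + k) a + (min (i + k) a - i) = k by omega,
    show i + (min (i + k) a - i) = min (i + k) a by omega] at this
  exact this.symm

end

theorem compatible_contr_contr_iff [CharZero F] {m a c : ℕ} {x : Irr F a ⊗[F] Irr F (c + m)}
    {y : Irr F (a + m) ⊗[F] Irr F c} : Compatible (contr F m a) (contr F m c) x y ↔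
      ∀ i ≤ a, ∀ k ≤ c, ∀ r ≤ m, tcoord i (k + r) x + tcoord (i + r) k y = 0 := by
  have hX : ∀ (X : Irr F m), ∀ i ≤ a, ∀ k ≤ c,
      tcoord i k (TensorProduct.map LinearMap.id (contr F m c X) x +
        TensorProduct.map (contr F m a X) LinearMap.id y) =
      ∑ s ∈ Finset.range (m + 1), pcoord X s *
        ((-1) ^ s * (tcoord i (k + (m - s)) x + tcoord (i + (m - s)) k y)) := by
    intro X i hi k hk
    rw [map_add, tcoord_map_id_contr _ _ _ hk, tcoord_map_contr_id _ _ hi, ← Finset.sum_add_distrib]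
    exact Finset.sum_congr rfl fun s _ => by ring
  constructor
  · intro h i hi k hk r hr
    have := forall_sum_pcoord_eq_zero
      (B := fun s => (-1) ^ s * (tcoord i (k + (m - s)) x + tcoord (i + (m - s)) k y))
      (fun X => by rw [← hX X i hi k hk, h X, map_zero]) (Nat.sub_le m r)
    rw [show m - (m - r) = r by omega] at this
    exact (mul_eq_zero.mp this).resolve_left (pow_ne_zero _ (neg_ne_zero.mpr one_ne_zero))
  · intro h X
    refine ext_tcoord fun i hi k hk => ?_
    rw [hX X i hi k hk, map_zero]
    exact Finset.sum_eq_zero fun s _ => by rw [h i hi k hk _ (Nat.sub_le m s), mul_zero, mul_zero]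

/-- For two contractions, the compatible pairs are the polarizations of the forms of degree
`a + d = b + c`. -/
theorem isParam_contr_contr [CharZero F] {m a c : ℕ} (hm : 1 ≤ m) :
    IsParam (contr F m a) (contr F m c) (polar F a (c + m) (a + (c + m)))
      (-polar F (a + m) c (a + (c + m))) where
  eq_zero g hg _ := polar_injective rfl hg
  lie_fst x g := polar_lie rfl x g
  lie_snd x g := by
    rw [LinearMap.neg_apply, LinearMap.neg_apply, polar_lie (by omega), lie_neg]
  compatible g := by
    refine compatible_contr_contr_iff.mpr fun i hi k hk r hr => ?_
    rw [LinearMap.neg_apply, map_neg, tcoord_polar _ hi (by omega), tcoord_polar _ (by omega) hk,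
      show i + (k + r) = i + r + k by omega, add_neg_cancel]
  exists_eq x y h := by
    rw [compatible_contr_contr_iff] at h
    -- both coordinates of `x` equal `-tcoord j (min k c) y` with `j = i + (k + 1 - min k c)`
    obtain ⟨g, rfl⟩ := exists_polar (t := x) rfl fun i k hi hk => by
      have h1 := h i (by omega) (min k c) (by omega) (k + 1 - min k c) (by omega)
      have h2 := h (i + 1) hi (min k c) (by omega) (k - min k c) (by omega)
      rw [show min k c + (k + 1 - min k c) = k + 1 by omega] at h1
      rw [show min k c + (k - min k c) = k by omega,
        show i + 1 + (k - min k c) = i + (k + 1 - min k c) by omega] at h2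
      linear_combination h1 - h2
    refine ⟨g, rfl, ext_tcoord fun i hi k hk => ?_⟩
    have h1 := h (min i a) (by omega) k hk (i - min i a) (by omega)
    rw [tcoord_polar _ (by omega) (by omega), show min i a + (i - min i a) = i by omega,
      show min i a + (k + (i - min i a)) = i + k by omega] at h1
    rw [LinearMap.neg_apply, map_neg, tcoord_polar _ hi hk]
    linear_combination -h1

/-! ### A contraction and a multiplication -/

section

variable [CharZero F] {a d μ : ℕ}

/-- The inclusion `V(d - a) → V(a) ⊗ V(d)`, with `μ = d - a`: multiplication of forms in the second
pair of variables by `(x₁ y₂ - x₂ y₁)^a`. -/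
def skewPolar (F : Type u) [Field F] (a d μ : ℕ) : Irr F μ →ₗ[F] Irr F a ⊗[F] Irr F d :=
  ofTCoord fun i k => ((-1) ^ i / (d.choose k : F)) • pcoordL μ ((i : ℤ) + k - a)

theorem mcoord_skewPolar (hμ : μ + a = d) (g : Irr F μ) {i : ℕ} (hi : i ≤ a) (k : ℤ) :
    mcoord i k (skewPolar F a d μ g) = (-1) ^ i * pcoord g (i + k - a) := by
  by_cases hk : k < 0 ∨ (d : ℤ) < k
  · rw [mcoord_eq_zero i hk]
    rcases hk with hk | hk
    · rw [pcoord_of_neg g (by omega), mul_zero]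
    · rw [pcoord_of_lt g (by omega), mul_zero]
  · lift k to ℕ using by omega
    have hk : k ≤ d := by omega
    have h := choose_ne_zero (F := F) hk
    rw [mcoord_natCast, skewPolar, tcoord_ofTCoord _ g hi hk, LinearMap.smul_apply, pcoordL_apply,
      smul_eq_mul]
    field_simp

theorem skewPolar_lie (hμ : μ + a = d) (x : SL2 F) (g : Irr F μ) :
    skewPolar F a d μ ⁅x, g⁆ = ⁅x, skewPolar F a d μ g⁆ := by
  refine ext_mcoord fun i hi k => ?_
  have h1 : ((a : F) - i) * mcoord (i + 1) k (skewPolar F a d μ g) =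
      -(((a : F) - i) * ((-1) ^ i * pcoord g (i + k - a + 1))) := by
    rcases hi.eq_or_lt with rfl | hlt
    · simp
    · rw [mcoord_skewPolar hμ _ hlt, show ((i + 1 : ℕ) : ℤ) + k - a = i + k - a + 1 by
        push_cast; ring, pow_succ]
      ring
  have h3 : (i : F) * mcoord (i - 1) k (skewPolar F a d μ g) =
      -(i * ((-1) ^ i * pcoord g (i + k - a - 1))) := by
    rcases i with _ | i
    · simp
    · rw [mcoord_skewPolar hμ _ (by omega), show ((i + 1 - 1 : ℕ) : ℤ) + k - a =
        (i + 1 : ℕ) + k - a - 1 by push_cast; ring, pow_succ, Nat.add_sub_cancel]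
      ring
  rw [mcoord_lie _ _ hi, h1, h3, mcoord_skewPolar hμ _ hi, mcoord_skewPolar hμ _ hi,
    mcoord_skewPolar hμ _ hi, mcoord_skewPolar hμ _ hi, pcoord_lie, ← hμ,
    show (i : ℤ) + (k + 1) - a = i + k - a + 1 by ring,
    show (i : ℤ) + (k - 1) - a = i + k - a - 1 by ring]
  push_cast
  ring

theorem skewPolar_injective (hμ : μ + a = d) {g : Irr F μ} (hg : skewPolar F a d μ g = 0) :
    g = 0 := by
  refine Irr.ext_pcoord fun k => ?_
  have := mcoord_skewPolar hμ g (Nat.zero_le a) (k + a)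
  rw [hg, map_zero, pow_zero, one_mul, Nat.cast_zero, zero_add, add_sub_cancel_right] at this
  rw [← this, pcoord_zero]

/-- The assumption says that the coordinate at `(i, k)`, up to the sign `(-1)^i`, depends only on
`i + k`; as it vanishes for `k < 0` and `k > d`, it is nonzero only for `a ≤ i + k ≤ d`. -/
theorem exists_skewPolar {t : Irr F a ⊗[F] Irr F d} (hμ : μ + a = d)
    (h : ∀ i ≤ a, ∀ k, mcoord i k t = (-1) ^ i * mcoord 0 (i + k) t) :
    ∃ g, skewPolar F a d μ g = t := by
  refine ⟨ofPCoord μ fun l => mcoord 0 (l + a) t, ext_mcoord fun i hi k => ?_⟩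
  rw [mcoord_skewPolar hμ _ hi, pcoord_ofPCoord, h i hi k,
    show (i : ℤ) + k - a + a = i + k by ring]
  rintro l (hl | hl)
  · have h1 := h a le_rfl l
    rw [mcoord_eq_zero a (Or.inl hl)] at h1
    rw [add_comm]
    exact (mul_eq_zero.mp h1.symm).resolve_left (pow_ne_zero _ (neg_ne_zero.mpr one_ne_zero))
  · exact mcoord_eq_zero 0 (Or.inr (by omega)) t

end

section

variable [CharZero F] {m a d : ℕ} {x : Irr F a ⊗[F] Irr F d}
  {y : Irr F (a + m) ⊗[F] Irr F (d + m)}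

theorem compatible_contr_mult_iff : Compatible (contr F m a) (mult F m d) x y ↔
      ∀ i ≤ a, ∀ k : ℤ, ∀ s ≤ m, mcoord i (k - s) x + (-1) ^ s * mcoord (i + (m - s)) k y = 0 := by
  have hX : ∀ (X : Irr F m), ∀ i ≤ a, ∀ k : ℤ,
      mcoord i k (TensorProduct.map LinearMap.id (mult F m d X) x +
        TensorProduct.map (contr F m a X) LinearMap.id y) =
      ∑ s ∈ Finset.range (m + 1), pcoord X s *
        (mcoord i (k - s) x + (-1) ^ s * mcoord (i + (m - s)) k y) := by
    intro X i hi k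
    rw [map_add, mcoord_map_id_mult, mcoord_map_contr_id _ _ hi, ← Finset.sum_add_distrib]
    exact Finset.sum_congr rfl fun s _ => by ring
  constructor
  · intro h i hi k s hs
    exact forall_sum_pcoord_eq_zero
      (B := fun s => mcoord i (k - s) x + (-1) ^ s * mcoord (i + (m - s)) k y)
      (fun X => by rw [← hX X i hi k, h X, map_zero]) hs
  · intro h X
    refine ext_mcoord fun i hi k => ?_
    rw [hX X i hi k, map_zero]
    exact Finset.sum_eq_zero fun s hs => by
      rw [h i hi k s (Nat.lt_succ_iff.mp (Finset.mem_range.mp hs)), mul_zero]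

/-- The first component of a compatible pair is annihilated by the polarization operator
`x₂ ∂_{x₁} + y₂ ∂_{y₁}`: compare the compatibility conditions for `s = 0` at `i` and for `s = 1` at
`i + 1`, which involve the same coordinate of `y`. -/
theorem Compatible.mcoord_eq (hm : 1 ≤ m) (h : Compatible (contr F m a) (mult F m d) x y) :
    ∀ i ≤ a, ∀ k, mcoord i k x = (-1) ^ i * mcoord 0 (i + k) x := by
  rw [compatible_contr_mult_iff] at h
  intro i
  induction i with
  | zero => intro _ k; simp
  | succ i ih =>
    intro hi k
    have h0 := h i (by omega) (k + 1) 0 (by omega)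
    have h1 := h (i + 1) hi (k + 1) 1 hm
    have h2 := ih (by omega) (k + 1)
    rw [show i + (m - 0) = i + 1 + (m - 1) by omega] at h0
    rw [show (i : ℤ) + (k + 1) = ((i + 1 : ℕ) : ℤ) + k by push_cast; ring] at h2
    simp only [Nat.cast_zero, sub_zero, pow_zero, one_mul, Nat.cast_one, add_sub_cancel_right,
      pow_one] at h0 h1
    rw [pow_succ]
    linear_combination h0 + h1 - h2

/-- The first component of a compatible pair determines the second one: every `i ≤ a + m` is the sum
of `min i a ≤ a` and some `m - s` with `s ≤ m`. -/
theorem Compatible.mcoord_snd (h : Compatible (contr F m a) (mult F m d) x y) {i : ℕ}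
    (hi : i ≤ a + m) (k : ℤ) :
    mcoord i k y =
      -((-1) ^ (m - (i - min i a)) * mcoord (min i a) (k - (m - (i - min i a) : ℕ)) x) := by
  rw [compatible_contr_mult_iff] at h
  have h1 := h (min i a) (by omega) k (m - (i - min i a)) (by omega)
  rw [show min i a + (m - (m - (i - min i a))) = i by omega] at h1
  have h2 : ((-1 : F) ^ (m - (i - min i a))) * (-1) ^ (m - (i - min i a)) = 1 := by
    rw [← mul_pow]; simp
  linear_combination (-1 : F) ^ (m - (i - min i a)) * h1 - mcoord i k y * h2

theorem Compatible.eq_zero_of_lt (hm : 1 ≤ m) (had : d < a)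
    (h : Compatible (contr F m a) (mult F m d) x y) : x = 0 ∧ y = 0 := by
  have hx : x = 0 := by
    refine ext_mcoord fun i hi k => ?_
    rw [map_zero, h.mcoord_eq hm i hi k]
    rcases lt_or_ge (d : ℤ) (i + k) with h' | h'
    · rw [mcoord_eq_zero 0 (Or.inr h'), mul_zero]
    · have h1 := h.mcoord_eq hm a le_rfl (i + k - a)
      rw [mcoord_eq_zero a (Or.inl (by omega)), add_sub_cancel] at h1
      rw [(mul_eq_zero.mp h1.symm).resolve_left (pow_ne_zero _ (neg_ne_zero.mpr one_ne_zero)),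
        mul_zero]
  refine ⟨hx, ext_mcoord fun i hi k => ?_⟩
  rw [h.mcoord_snd hi, hx, map_zero, map_zero, mul_zero, neg_zero]

/-- For a contraction and a multiplication, the compatible pairs are the multiples of powers of
`x₁ y₂ - x₂ y₁`. -/
theorem isParam_contr_mult {μ : ℕ} (hm : 1 ≤ m) (hμ : μ + a = d) :
    IsParam (contr F m a) (mult F m d) (skewPolar F a d μ)
      (-(-1 : F) ^ m • skewPolar F (a + m) (d + m) μ) where
  eq_zero g hg _ := skewPolar_injective hμ hg
  lie_fst x g := skewPolar_lie hμ x g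
  lie_snd x g := by
    rw [LinearMap.smul_apply, LinearMap.smul_apply, skewPolar_lie (by omega), lie_smul]
  compatible g := by
    refine compatible_contr_mult_iff.mpr fun i hi k s hs => ?_
    rw [LinearMap.smul_apply, map_smul, mcoord_skewPolar hμ _ hi,
      mcoord_skewPolar (by omega) _ (by omega), smul_eq_mul,
      show ((i + (m - s) : ℕ) : ℤ) + k - (a + m : ℕ) = i + (k - s) - a by
        push_cast [Nat.cast_sub hs]; ring]
    have h2 : (-1 : F) ^ s * ((-1) ^ m * (-1) ^ (i + (m - s))) = (-1) ^ i := by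
      rw [← pow_add, ← pow_add, show s + (m + (i + (m - s))) = i + 2 * m by omega, pow_add,
        pow_mul]
      simp
    linear_combination -pcoord g (i + (k - s) - a) * h2
  exists_eq x y h := by
    obtain ⟨g, rfl⟩ := exists_skewPolar hμ (h.mcoord_eq hm)
    refine ⟨g, rfl, ext_mcoord fun i hi k => ?_⟩
    rw [h.mcoord_snd hi, mcoord_skewPolar hμ _ (by omega), LinearMap.smul_apply, map_smul,
      mcoord_skewPolar (by omega) _ hi, smul_eq_mul,
      show ((min i a : ℕ) : ℤ) + (k - (m - (i - min i a) : ℕ)) - a = i + k - (a + m : ℕ) by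
        omega]
    have h2 : (-1 : F) ^ m * (-1) ^ i = (-1) ^ (m - (i - min i a)) * (-1) ^ (min i a) := by
      rw [← pow_add, ← pow_add, show m + i = (m - (i - min i a)) + min i a + 2 * (i - min i a) by
        omega, pow_add, pow_mul]
      simp
    linear_combination -pcoord g (i + k - (a + m : ℕ)) * h2

end

/-! ### A multiplication and a contraction -/

section

variable {m a b c d : ℕ} {φ₁ : Irr F m →ₗ⁅F, SL2 F⁆ (Irr F b →ₗ[F] Irr F a)}
  {φ₂ : Irr F m →ₗ⁅F, SL2 F⁆ (Irr F d →ₗ[F] Irr F c)}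

theorem comm_lie {M N : Type*} [AddCommGroup M] [Module F M] [LieRingModule (SL2 F) M]
    [LieModule F (SL2 F) M] [AddCommGroup N] [Module F N] [LieRingModule (SL2 F) N]
    [LieModule F (SL2 F) N] (x : SL2 F) (t : M ⊗[F] N) :
    TensorProduct.comm F M N ⁅x, t⁆ = ⁅x, TensorProduct.comm F M N t⁆ := by
  induction t with
  | zero => simp
  | tmul p q => simp [TensorProduct.LieModule.lie_tmul_right, add_comm]
  | add s t hs ht => rw [lie_add, map_add, hs, ht, map_add, lie_add]

theorem Compatible.swap {x : Irr F a ⊗[F] Irr F d} {y : Irr F b ⊗[F] Irr F c}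
    (h : Compatible φ₁ φ₂ x y) :
    Compatible φ₂ φ₁ (TensorProduct.comm F _ _ y) (TensorProduct.comm F _ _ x) := by
  intro X
  rw [TensorProduct.map_comm, TensorProduct.map_comm, ← map_add, add_comm, h X, map_zero]

theorem IsParam.swap {μ : ℕ} {θ₁ : Irr F μ →ₗ[F] Irr F a ⊗[F] Irr F d}
    {θ₂ : Irr F μ →ₗ[F] Irr F b ⊗[F] Irr F c} (h : IsParam φ₁ φ₂ θ₁ θ₂) :
    IsParam φ₂ φ₁ ((TensorProduct.comm F _ _).toLinearMap ∘ₗ θ₂)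
      ((TensorProduct.comm F _ _).toLinearMap ∘ₗ θ₁) where
  eq_zero g h2 h1 := h.eq_zero g (by simpa using h1) (by simpa using h2)
  lie_fst x g := by simp [h.lie_snd, comm_lie]
  lie_snd x g := by simp [h.lie_fst, comm_lie]
  compatible g := (h.compatible g).swap
  exists_eq x y hxy := by
    obtain ⟨g, h1, h2⟩ := h.exists_eq _ _ hxy.swap
    exact ⟨g, by simp [h2], by simp [h1]⟩

end

/-! ### Two multiplications -/

/-- For two multiplications, a compatible pair satisfies `X(x₂, y₂) p = -X(x₁, y₁) q` for all forms
`X` of degree `m ≥ 1`, which forces `p = q = 0`. -/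
theorem Compatible.eq_zero_of_mult_mult [CharZero F] {m b d : ℕ} (hm : 1 ≤ m)
    {x : Irr F (b + m) ⊗[F] Irr F d} {y : Irr F b ⊗[F] Irr F (d + m)}
    (h : Compatible (mult F m b) (mult F m d) x y) : x = 0 ∧ y = 0 := by
  have h1 : ∀ (i k : ℤ), ∀ s ≤ m, ppcoord i (k - s) x + ppcoord (i - s) k y = 0 := by
    intro i k s hs
    refine forall_sum_pcoord_eq_zero (m := m)
      (B := fun s => ppcoord i (k - s) x + ppcoord (i - s) k y) (fun X => ?_) hs
    have h0 := congrArg (ppcoord i k) (h X)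
    rw [map_add, map_zero, ppcoord_map_id_mult, ppcoord_map_mult_id] at h0
    simpa only [mul_add, Finset.sum_add_distrib] using h0
  have h0 : ∀ i k : ℤ, ppcoord i k x + ppcoord i k y = 0 := fun i k => by
    simpa using h1 i k 0 (Nat.zero_le m)
  have hstep : ∀ i k : ℤ, ppcoord i k x = ppcoord (i - 1) (k + 1) x := by
    intro i k
    have h2 := h1 i (k + 1) 1 hm
    have h3 := h0 (i - 1) (k + 1)
    rw [Nat.cast_one, add_sub_cancel_right] at h2
    linear_combination h2 - h3
  have hn : ∀ (n : ℕ) (i k : ℤ), ppcoord i k x = ppcoord (i - n) (k + n) x := by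
    intro n
    induction n with
    | zero => intro i k; simp
    | succ n ih =>
      intro i k
      rw [ih i k, hstep, show i - n - 1 = i - (n + 1 : ℕ) by push_cast; ring,
        show k + n + 1 = k + (n + 1 : ℕ) by push_cast; ring]
  have hx : x = 0 := ext_ppcoord fun i k => by
    rw [hn (d + 1 - k).toNat i k, map_zero, ppcoord_eq_zero _ (by omega)]
  refine ⟨hx, ext_ppcoord fun i k => ?_⟩
  have h2 := h0 i k
  rwa [hx, map_zero, zero_add, ← map_zero (ppcoord i k)] at h2

/-! ### Recovering the structure of a module from a socle decomposition -/

section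

variable {m a b : ℕ} (φ : Irr F m →ₗ⁅F, SL2 F⁆ (Irr F b →ₗ[F] Irr F a))

theorem isSplit_E : IsSplit φ (inA φ) (inB φ) where
  bijective := by
    have h : (inA φ).coprod (inB φ) = LinearMap.id := LinearMap.coprod_inl_inr
    rw [h]
    exact Function.bijective_id
  lie_left Y v := by
    change ((⁅Y.right, v⁆ + φ Y.left 0, ⁅Y.right, (0 : Irr F b)⁆) : Irr F a × Irr F b) =
      (⁅Y.right, v⁆, 0)
    simp
  lie_right Y v := by
    change ((⁅Y.right, (0 : Irr F a)⁆ + φ Y.left v, ⁅Y.right, v⁆) : Irr F a × Irr F b) =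
      (φ Y.left v, 0) + (0, ⁅Y.right, v⁆)
    rw [lie_zero, zero_add]
    exact Prod.ext (add_zero _).symm (zero_add _).symm

variable {φ} {V : Type v} [AddCommGroup V] [Module F V] [LieRingModule (Gm F m) V]

theorem map_lie_equiv {L : Type*} [LieRing L] [LieAlgebra F L] {V W : Type*} [AddCommGroup V]
    [Module F V] [LieRingModule L V] [AddCommGroup W] [Module F W] [LieRingModule L W]
    (e : V ≃ₗ⁅F, L⁆ W) (x : L) (v : V) : e ⁅x, v⁆ = ⁅x, e v⁆ :=
  e.toLieModuleHom.map_lie x v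

theorem IsSplit.of_equiv {W : Type w} [AddCommGroup W] [Module F W] [LieRingModule (Gm F m) W]
    {ιA : Irr F a →ₗ[F] V} {ιB : Irr F b →ₗ[F] V} (h : IsSplit φ ιA ιB) (e : V ≃ₗ⁅F, Gm F m⁆ W) :
    IsSplit φ (e.toLinearEquiv.toLinearMap ∘ₗ ιA) (e.toLinearEquiv.toLinearMap ∘ₗ ιB) where
  bijective := by
    rw [← LinearMap.comp_coprod]
    exact e.toLinearEquiv.bijective.comp h.bijective
  lie_left Y v := by
    change ⁅Y, e (ιA v)⁆ = e (ιA _)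
    rw [← h.lie_left, map_lie_equiv]
  lie_right Y v := by
    change ⁅Y, e (ιB v)⁆ = e (ιA _) + e (ιB _)
    rw [← map_add, ← h.lie_right, map_lie_equiv]

theorem IsSplit.finrank_eq {ιA : Irr F a →ₗ[F] V} {ιB : Irr F b →ₗ[F] V} (h : IsSplit φ ιA ιB) :
    Module.finrank F V = (a + 1) + (b + 1) := by
  rw [← (LinearEquiv.ofBijective _ h.bijective).finrank_eq, Module.finrank_prod, finrank_irr,
    finrank_irr]

theorem IsSplit.exists_fromV_ne_zero {ιA : Irr F a →ₗ[F] V} {ιB : Irr F b →ₗ[F] V}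
    (h : IsSplit φ ιA ιB) (hφ : φ ≠ 0) : ∃ (X : Irr F m) (v : V), ⁅fromV m X, v⁆ ≠ 0 := by
  by_contra! h0
  refine hφ (LieModuleHom.ext fun X => LinearMap.ext fun v => h.injective_left ?_)
  rw [← h.fromV_right, h0]
  simp

theorem isZ_E {φ : Irr F m →ₗ⁅F, SL2 F⁆ (Irr F (a + m) →ₗ[F] Irr F a)} (hφ : φ ≠ 0) :
    IsZ F m a (E φ) :=
  ⟨φ, hφ, ⟨LieModuleEquiv.refl⟩⟩

/-- The properties shared by the modules `Z(a, 1)` and their duals, where `n` is the dimension. -/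
structure IsTypeZ (m n : ℕ) (V : Type v) [AddCommGroup V] [Module F V] [LieRingModule (Gm F m) V] :
    Prop where
  fromV_fromV : ∀ (X Y : Irr F m) (v : V), ⁅fromV m X, ⁅fromV m Y, v⁆⁆ = 0
  exists_ne_zero : ∃ (X : Irr F m) (v : V), ⁅fromV m X, v⁆ ≠ 0
  finrank_eq : Module.finrank F V = n

theorem IsZ.isTypeZ (h : IsZ F m a V) : IsTypeZ (F := F) m ((a + 1) + (a + m + 1)) V := by
  obtain ⟨φ, hφ, ⟨e⟩⟩ := h
  have h := (isSplit_E φ).of_equiv e.symm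
  exact ⟨h.fromV_fromV, h.exists_fromV_ne_zero hφ, h.finrank_eq⟩

theorem IsZDual.isTypeZ (h : IsZDual F m b V) :
    IsTypeZ (F := F) m ((b + 1) + (b + m + 1)) V := by
  obtain ⟨φ, hφ, ⟨e⟩⟩ := h
  have h := isSplit_E φ
  have : Module.Finite F (E φ) := Module.Finite.equiv (LinearEquiv.ofBijective _ h.bijective)
  refine ⟨fun X Y v => e.injective ?_, ?_, ?_⟩
  · rw [map_lie_equiv, map_lie_equiv, map_zero]
    refine LinearMap.ext fun p => ?_
    rw [Module.Dual.lie_apply, Module.Dual.lie_apply, h.fromV_fromV]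
    simp
  · obtain ⟨X, p, hp⟩ := h.exists_fromV_ne_zero hφ
    by_contra! h0
    refine hp ((Module.forall_dual_apply_eq_zero_iff F _).mp fun f => ?_)
    obtain ⟨v, rfl⟩ := e.surjective f
    have h1 := congrArg (fun f : E φ →ₗ[F] F => f p) (map_lie_equiv e (fromV m X) v)
    simp only [h0, map_zero, Module.Dual.lie_apply, LinearMap.zero_apply] at h1
    exact neg_eq_zero.mp h1.symm
  · rw [e.toLinearEquiv.finrank_eq]
    exact Subspace.dual_finrank_eq.trans h.finrank_eq

end

/-- In a socle decomposition `V = A ⊕ B`, the ideal `V(m)` annihilates `A`, and it maps `B` to `A`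
because the quotient `V / A ≃ V(b)` is irreducible and `V(m)` acts nilpotently. -/
theorem IsSocleDecomp.exists_isSplit [CharZero F] {m a b n : ℕ} {V : Type v} [AddCommGroup V]
    [Module F V] [LieRingModule (Gm F m) V] [LieModule F (Gm F m) V] {A B : Submodule F V}
    (h : IsSocleDecomp m a b A B) (hV : IsTypeZ (F := F) m n V) :
    ∃ (φ : Irr F m →ₗ⁅F, SL2 F⁆ (Irr F b →ₗ[F] Irr F a)) (ιA : Irr F a →ₗ[F] V)
      (ιB : Irr F b →ₗ[F] V), φ ≠ 0 ∧ IsSplit φ ιA ιB ∧ LinearMap.range ιA = A ∧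
        LinearMap.range ιB = B := by
  obtain ⟨θA, hA⟩ := h.left_iso
  obtain ⟨θB, hB⟩ := h.right_iso
  let ιA : Irr F a →ₗ[F] V := A.subtype ∘ₗ θA.toLinearMap
  let ιB : Irr F b →ₗ[F] V := B.subtype ∘ₗ θB.toLinearMap
  have hιA : ∀ v, ιA v ∈ A := fun v => (θA v).2
  have hιB : ∀ v, ιB v ∈ B := fun v => (θB v).2
  have hrA : LinearMap.range ιA = A := by
    rw [LinearMap.range_comp, LinearEquiv.range, Submodule.map_top, Submodule.range_subtype]
  have hrB : LinearMap.range ιB = B := by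
    rw [LinearMap.range_comp, LinearEquiv.range, Submodule.map_top, Submodule.range_subtype]
  have hslA : ∀ (x : SL2 F) v, ⁅fromSl m x, ιA v⁆ = ιA ⁅x, v⁆ := fun x v => (hA x v).symm
  have hslB : ∀ (x : SL2 F) v, ⁅fromSl m x, ιB v⁆ = ιB ⁅x, v⁆ := fun x v => (hB x v).symm
  have hkill : ∀ (X : Irr F m) v, v ∈ A → ⁅fromV m X, v⁆ = 0 := by
    intro X v hv
    rw [h.soc_eq] at hv
    exact soc_le_invariants (fun X Y Z v => hV.fromV_fromV X Y _) hv X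
  have hAlie : ∀ (Y : Gm F m) v, v ∈ A → ⁅Y, v⁆ ∈ A := by
    intro Y v hv
    rw [h.soc_eq] at hv ⊢
    exact (soc F m V).lie_mem hv
  have hcop : Function.Bijective (ιA.coprod ιB) := by
    constructor
    · refine (injective_iff_map_eq_zero _).mpr fun ⟨p, q⟩ hpq => ?_
      have hpq : ιA p + ιB q = 0 := by simpa using hpq
      have hq : ιB q = 0 := by
        refine Submodule.disjoint_def.mp h.isCompl.disjoint _ ?_ (hιB q)
        rw [eq_neg_of_add_eq_zero_right hpq]
        exact A.neg_mem (hιA p)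
      rw [hq, add_zero] at hpq
      have h1 : p = 0 := θA.injective (Subtype.ext (by rw [map_zero]; exact hpq))
      have h2 : q = 0 := θB.injective (Subtype.ext (by rw [map_zero]; exact hq))
      rw [h1, h2]; rfl
    · rw [← LinearMap.range_eq_top, LinearMap.range_coprod, hrA, hrB]
      exact h.isCompl.sup_eq_top
  -- the vectors of `V(b)` that `V(m)` maps to `A`
  let N : Submodule F (Irr F b) :=
    { carrier := {v | ∀ X : Irr F m, ⁅fromV m X, ιB v⁆ ∈ A}
      add_mem' := fun {v w} hv hw X => by
        rw [map_add, lie_add]; exact A.add_mem (hv X) (hw X)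
      zero_mem' := fun X => by rw [map_zero, lie_zero]; exact A.zero_mem
      smul_mem' := fun t v hv X => by rw [map_smul, lie_smul]; exact A.smul_mem t (hv X) }
  have hN : N = ⊤ := by
    refine (Irr.eq_bot_or_eq_top N fun x v hv X => ?_).resolve_left fun hbot => ?_
    · have h1 : ⁅fromV m X, ⁅fromSl m x, ιB v⁆⁆ =
          -⁅fromV m ⁅x, X⁆, ιB v⁆ + ⁅fromSl m x, ⁅fromV m X, ιB v⁆⁆ := by
        rw [leibniz_lie, ← lie_skew, lie_fromV, neg_lie]
        rfl
      rw [← hslB, h1]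
      exact A.add_mem (A.neg_mem (hv _)) (hAlie _ _ (hv X))
    · have h0 : wvec b 0 ∉ N := by
        rw [hbot, Submodule.mem_bot]
        exact wvec_ne_zero (Nat.zero_le b)
      obtain ⟨X, hX⟩ := not_forall.mp h0
      obtain ⟨⟨p, q⟩, hpq⟩ := hcop.2 ⁅fromV m X, ιB (wvec b 0)⁆
      have hpq : ιA p + ιB q = ⁅fromV m X, ιB (wvec b 0)⁆ := by simpa using hpq
      have hq : q ∈ N := by
        intro Y
        have h1 := hV.fromV_fromV Y X (ιB (wvec b 0))
        rw [← hpq, lie_add, hkill _ _ (hιA p), zero_add] at h1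
        rw [h1]
        exact A.zero_mem
      rw [hbot, Submodule.mem_bot] at hq
      rw [hq, map_zero, add_zero] at hpq
      exact hX (hpq ▸ hιA p)
  have hBA : ∀ (X : Irr F m) v, ⁅fromV m X, ιB v⁆ ∈ A := fun X v => by
    have : v ∈ N := by rw [hN]; exact Submodule.mem_top
    exact this X
  have hinjA : Function.Injective ιA := A.injective_subtype.comp θA.injective
  obtain ⟨ρ, hρ⟩ := ιA.exists_leftInverse_of_injective (LinearMap.ker_eq_bot.mpr hinjA)
  have hρA : ∀ v ∈ A, ιA (ρ v) = v := by
    intro v hv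
    rw [← hrA] at hv
    obtain ⟨p, rfl⟩ := hv
    rw [← LinearMap.comp_apply ρ, hρ, LinearMap.id_apply]
  let ψ : Irr F m →ₗ[F] Irr F b →ₗ[F] Irr F a := LinearMap.mk₂ F
    (fun X v => ρ ⁅fromV m X, ιB v⁆)
    (fun X Y v => by rw [← map_add, ← add_lie, fromV, fromV, fromV, map_add])
    (fun t X v => by rw [← map_smul, ← smul_lie, fromV, fromV, map_smul])
    (fun X v w => by rw [map_add, lie_add, map_add])
    (fun t X v => by rw [map_smul, lie_smul, map_smul])
  have hψ : ∀ X v, ιA (ψ X v) = ⁅fromV m X, ιB v⁆ := fun X v => hρA _ (hBA X v)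
  let φ : Irr F m →ₗ⁅F, SL2 F⁆ (Irr F b →ₗ[F] Irr F a) :=
    { toLinearMap := ψ
      map_lie' := fun {x X} => LinearMap.ext fun v => hinjA <| by
        change ιA (ψ ⁅x, X⁆ v) = ιA (⁅x, ψ X⁆ v)
        rw [LieHom.lie_apply, map_sub, ← hslA, hψ, hψ, hψ, ← hslB,
          leibniz_lie (fromSl m x) (fromV m X), lie_fromV, add_sub_cancel_right]
        rfl }
  have hφ : ∀ X v, ιA (φ X v) = ⁅fromV m X, ιB v⁆ := hψ
  refine ⟨φ, ιA, ιB, fun h0 => ?_, ⟨hcop, fun Y v => ?_, fun Y v => ?_⟩, hrA, hrB⟩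
  · obtain ⟨X, v, hXv⟩ := hV.exists_ne_zero
    obtain ⟨⟨p, q⟩, rfl⟩ := hcop.2 v
    refine hXv ?_
    rw [LinearMap.coprod_apply, lie_add, hkill _ _ (hιA p), zero_add, ← hφ, h0]
    simp
  · rw [lie_eq_add, hkill _ _ (hιA v), zero_add, hslA]
  · rw [lie_eq_add, hφ, hslB]

section

variable [CharZero F] {m a b : ℕ} {V : Type v} [AddCommGroup V]
    [Module F V] [LieRingModule (Gm F m) V] [LieModule F (Gm F m) V] {A B : Submodule F V}

theorem IsSocleDecomp.finrank_eq (h : IsSocleDecomp m a b A B) {n : ℕ}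
    (hV : IsTypeZ (F := F) m n V) : n = (a + 1) + (b + 1) := by
  obtain ⟨φ, ιA, ιB, -, hs, -⟩ := h.exists_isSplit hV
  rw [← hs.finrank_eq, hV.finrank_eq]

theorem IsSocleDecomp.exists_isSplit_contr (h : IsSocleDecomp m a (a + m) A B) {n : ℕ}
    (hV : IsTypeZ (F := F) m n V) : ∃ (ιA : Irr F a →ₗ[F] V) (ιB : Irr F (a + m) →ₗ[F] V),
      IsSplit (contr F m a) ιA ιB ∧ LinearMap.range ιA = A ∧ LinearMap.range ιB = B := by
  obtain ⟨φ, ιA, ιB, hφ, hs, hrA, hrB⟩ := h.exists_isSplit hV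
  obtain ⟨t, rfl⟩ := exists_eq_smul_contr φ
  have ht : t ≠ 0 := fun ht => hφ (by rw [ht, zero_smul])
  exact ⟨ιA, t⁻¹ • ιB, hs.smul_right ht, hrA,
    by rw [LinearMap.range_smul _ _ (inv_ne_zero ht), hrB]⟩

theorem IsSocleDecomp.exists_isSplit_mult (h : IsSocleDecomp m (b + m) b A B) {n : ℕ}
    (hV : IsTypeZ (F := F) m n V) : ∃ (ιA : Irr F (b + m) →ₗ[F] V) (ιB : Irr F b →ₗ[F] V),
      IsSplit (mult F m b) ιA ιB ∧ LinearMap.range ιA = A ∧ LinearMap.range ιB = B := by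
  obtain ⟨φ, ιA, ιB, hφ, hs, hrA, hrB⟩ := h.exists_isSplit hV
  obtain ⟨t, rfl⟩ := exists_eq_smul_mult φ
  have ht : t ≠ 0 := fun ht => hφ (by rw [ht, zero_smul])
  exact ⟨ιA, t⁻¹ • ιB, hs.smul_right ht, hrA,
    by rw [LinearMap.range_smul _ _ (inv_ne_zero ht), hrB]⟩

end

/-! ### The table of the subspaces `S_1` -/

theorem S1_table [CharZero F] {m : ℕ} (hm : 1 ≤ m) {V₁ : Type v} {V₂ : Type w} [AddCommGroup V₁]
    [Module F V₁] [LieRingModule (Gm F m) V₁] [LieModule F (Gm F m) V₁] [AddCommGroup V₂]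
    [Module F V₂] [LieRingModule (Gm F m) V₂] [LieModule F (Gm F m) V₂] {a b c d : ℕ}
    {A B : Submodule F V₁} {C D : Submodule F V₂} (h₁ : IsSocleDecomp m a b A B)
    (h₂ : IsSocleDecomp m c d C D) :
    (IsZ F m a V₁ → IsZ F m c V₂ → IsoIrr m (S1 m A B C D) (a + d)) ∧
    (IsZ F m a V₁ → IsZDual F m d V₂ →
      (a ≤ d → IsoIrr m (S1 m A B C D) (d - a)) ∧ (d < a → S1 m A B C D = ⊥)) ∧
    (IsZDual F m b V₁ → IsZ F m c V₂ →
      (c ≤ b → IsoIrr m (S1 m A B C D) (b - c)) ∧ (b < c → S1 m A B C D = ⊥)) ∧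
    (IsZDual F m b V₁ → IsZDual F m d V₂ → S1 m A B C D = ⊥) := by
  refine ⟨fun hV₁ hV₂ => ?_, fun hV₁ hV₂ => ?_, fun hV₁ hV₂ => ?_, fun hV₁ hV₂ => ?_⟩
  · obtain rfl : b = a + m := by have := h₁.finrank_eq hV₁.isTypeZ; omega
    obtain rfl : d = c + m := by have := h₂.finrank_eq hV₂.isTypeZ; omega
    obtain ⟨ιA, ιB, hs₁, rfl, rfl⟩ := h₁.exists_isSplit_contr hV₁.isTypeZ
    obtain ⟨ιC, ιD, hs₂, rfl, rfl⟩ := h₂.exists_isSplit_contr hV₂.isTypeZ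
    exact (isParam_contr_contr hm).isoIrr hs₁ hs₂
  · obtain rfl : b = a + m := by have := h₁.finrank_eq hV₁.isTypeZ; omega
    obtain rfl : c = d + m := by have := h₂.finrank_eq hV₂.isTypeZ; omega
    obtain ⟨ιA, ιB, hs₁, rfl, rfl⟩ := h₁.exists_isSplit_contr hV₁.isTypeZ
    obtain ⟨ιC, ιD, hs₂, rfl, rfl⟩ := h₂.exists_isSplit_mult hV₂.isTypeZ
    exact ⟨fun had => (isParam_contr_mult hm (Nat.sub_add_cancel had)).isoIrr hs₁ hs₂,
      fun hda => S1_eq_bot hs₁ hs₂ fun x y hxy => hxy.eq_zero_of_lt hm hda⟩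
  · obtain rfl : a = b + m := by have := h₁.finrank_eq hV₁.isTypeZ; omega
    obtain rfl : d = c + m := by have := h₂.finrank_eq hV₂.isTypeZ; omega
    obtain ⟨ιA, ιB, hs₁, rfl, rfl⟩ := h₁.exists_isSplit_mult hV₁.isTypeZ
    obtain ⟨ιC, ιD, hs₂, rfl, rfl⟩ := h₂.exists_isSplit_contr hV₂.isTypeZ
    refine ⟨fun hcb => (isParam_contr_mult hm (Nat.sub_add_cancel hcb)).swap.isoIrr hs₁ hs₂,
      fun hbc => S1_eq_bot hs₁ hs₂ fun x y hxy => ?_⟩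
    obtain ⟨hy, hx⟩ := hxy.swap.eq_zero_of_lt hm hbc
    exact ⟨by simpa using hx, by simpa using hy⟩
  · obtain rfl : a = b + m := by have := h₁.finrank_eq hV₁.isTypeZ; omega
    obtain rfl : c = d + m := by have := h₂.finrank_eq hV₂.isTypeZ; omega
    obtain ⟨ιA, ιB, hs₁, rfl, rfl⟩ := h₁.exists_isSplit_mult hV₁.isTypeZ
    obtain ⟨ιC, ιD, hs₂, rfl, rfl⟩ := h₂.exists_isSplit_mult hV₂.isTypeZ
    exact S1_eq_bot hs₁ hs₂ fun x y hxy => hxy.eq_zero_of_mult_mult hm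

/-! ### Duality -/

section

/-- The invariant bilinear form on `V(n)`, unique up to a scalar:
`(v, w) ↦ ∑ (-1)^k C(n, k) v_k w_{n-k}` in the coordinates `coord`. -/
def invForm (F : Type u) [Field F] (n : ℕ) : Irr F n →ₗ[F] Irr F n →ₗ[F] F :=
  LinearMap.mk₂ F
    (fun v w => ∑ k ∈ Finset.range (n + 1), pcoord v k * ((-1) ^ k * coord w (n - k)))
    (fun X Y v => by simp only [pcoord_add, add_mul, Finset.sum_add_distrib])
    (fun t X v => by simp only [pcoord_smul, smul_eq_mul, Finset.mul_sum, mul_assoc])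
    (fun X v w => by simp only [coord_add, mul_add, Finset.sum_add_distrib])
    (fun t X v => by simp only [coord_smul, smul_eq_mul, Finset.mul_sum, mul_left_comm])

theorem invForm_apply {n : ℕ} (v w : Irr F n) : invForm F n v w =
    ∑ k ∈ Finset.range (n + 1), pcoord v k * ((-1) ^ k * coord w (n - k)) := rfl

variable [CharZero F]

theorem invForm_lie {n : ℕ} (x : SL2 F) (v w : Irr F n) :
    invForm F n ⁅x, v⁆ w = -invForm F n v ⁅x, w⁆ := by
  rw [eq_neg_iff_add_eq_zero, invForm_apply, invForm_apply,
    sum_pcoord_lie n x v fun s => (-1) ^ s * coord w (n - s)]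
  simp only [Finset.mul_sum, ← Finset.sum_add_distrib]
  refine Finset.sum_eq_zero fun s hs => ?_
  have hs : s ≤ n := Nat.lt_succ_iff.mp (Finset.mem_range.mp hs)
  have hA : (s : F) * ((-1) ^ (s - 1) * coord w (n - (s - 1))) =
      -(s * ((-1) ^ s * coord w (n - s + 1))) := by
    rcases s with _ | s
    · simp
    · rw [Nat.add_sub_cancel, show n - (s + 1) + 1 = n - s by omega, pow_succ]
      ring
  rw [coord_lie _ _ (Nat.sub_le n s), show n - (s + 1) = n - s - 1 by omega]
  push_cast [Nat.cast_sub hs]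
  linear_combination x.1 0 1 * pcoord v s * hA

theorem invForm_injective {n : ℕ} : Function.Injective (invForm F n) := by
  refine (injective_iff_map_eq_zero _).mpr fun v hv => Irr.ext_coord fun k hk => ?_
  have h := congrArg (fun f => f (wvec n (n - k))) hv
  simp only [invForm_apply, LinearMap.zero_apply] at h
  rw [Finset.sum_eq_single k, coord_wvec _ _ (Nat.sub_le n k), if_pos rfl, pcoord_natCast] at h
  · rw [coord_zero]
    have hc := choose_ne_zero (F := F) hk
    have hu : (-1 : F) ^ k ≠ 0 := pow_ne_zero _ (neg_ne_zero.mpr one_ne_zero)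
    simpa [hc, hu] using h
  · intro l hl hlk
    have hl : l ≤ n := Nat.lt_succ_iff.mp (Finset.mem_range.mp hl)
    rw [coord_wvec _ _ (Nat.sub_le n l), if_neg (by omega), mul_zero, mul_zero]
  · intro h'
    exact absurd (Finset.mem_range.mpr (Nat.lt_succ_of_le hk)) h'

/-- The isomorphism of `V(n)` with its dual. -/
def invFormEquiv (F : Type u) [Field F] [CharZero F] (n : ℕ) : Irr F n ≃ₗ[F] (Irr F n →ₗ[F] F) :=
  LinearEquiv.ofInjectiveOfFinrankEq (invForm F n) invForm_injective
    Subspace.dual_finrank_eq.symm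

theorem invFormEquiv_apply {n : ℕ} (v w : Irr F n) : invFormEquiv F n v w = invForm F n v w := rfl

theorem eq_zero_of_forall_invForm {n : ℕ} {w : Irr F n} (h : ∀ v, invForm F n v w = 0) : w = 0 := by
  refine (Module.forall_dual_apply_eq_zero_iff F w).mp fun f => ?_
  obtain ⟨v, rfl⟩ := (invFormEquiv F n).surjective f
  exact h v

section

variable {m a b : ℕ} (φ : Irr F m →ₗ⁅F, SL2 F⁆ (Irr F b →ₗ[F] Irr F a))

/-- The negative of the adjoint of `φ(X)` with respect to the invariant forms; it describes the
action of `V(m)` on the dual module. -/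
def negAdjointLin : Irr F m →ₗ[F] Irr F a →ₗ[F] Irr F b :=
  LinearMap.mk₂ F (fun X p => -(invFormEquiv F b).symm (invForm F a p ∘ₗ φ X))
    (fun X Y p => by rw [map_add, LinearMap.comp_add, map_add, neg_add])
    (fun t X p => by rw [map_smul, LinearMap.comp_smul, map_smul, smul_neg])
    (fun X p q => by rw [map_add, LinearMap.add_comp, map_add, neg_add])
    (fun t X p => by rw [map_smul, LinearMap.smul_comp, map_smul, smul_neg])

theorem invForm_negAdjointLin (X : Irr F m) (p : Irr F a) (v : Irr F b) :
    invForm F b (negAdjointLin φ X p) v = -invForm F a p (φ X v) := by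
  change invForm F b (-(invFormEquiv F b).symm (invForm F a p ∘ₗ φ X)) v = _
  rw [map_neg, LinearMap.neg_apply, ← invFormEquiv_apply, LinearEquiv.apply_symm_apply]
  rfl

/-- The homomorphism `V(m) → Hom(V(a), V(b))` given by the negatives of the adjoints. -/
def negAdjoint : Irr F m →ₗ⁅F, SL2 F⁆ (Irr F a →ₗ[F] Irr F b) where
  toLinearMap := negAdjointLin φ
  map_lie' {x X} := by
    refine LinearMap.ext fun p => invForm_injective (LinearMap.ext fun v => ?_)
    change invForm F b (negAdjointLin φ ⁅x, X⁆ p) v = invForm F b (⁅x, negAdjointLin φ X⁆ p) v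
    rw [LieHom.lie_apply, map_sub, LinearMap.sub_apply, invForm_lie, invForm_negAdjointLin,
      invForm_negAdjointLin, invForm_negAdjointLin, invForm_lie, LieModuleHom.map_lie,
      LieHom.lie_apply, map_sub]
    ring

theorem invForm_negAdjoint (X : Irr F m) (p : Irr F a) (v : Irr F b) :
    invForm F b (negAdjoint φ X p) v = -invForm F a p (φ X v) :=
  invForm_negAdjointLin φ X p v

variable {φ}

theorem negAdjoint_ne_zero (hφ : φ ≠ 0) : negAdjoint φ ≠ 0 := by
  intro h
  refine hφ (LieModuleHom.ext fun X => LinearMap.ext fun v => eq_zero_of_forall_invForm fun p => ?_)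
  have h1 := invForm_negAdjoint φ X p v
  rw [h] at h1
  simpa using h1.symm

variable (φ) in
/-- The pairing of `V(a) ⊕ V(b)` with `V(b) ⊕ V(a)`. -/
def dualMap : E φ →ₗ[F] (E (negAdjoint φ) →ₗ[F] F) :=
  LinearMap.mk₂ F (fun (p : E φ) (q : E (negAdjoint φ)) =>
      invForm F b q.1 p.2 + invForm F a q.2 p.1)
    (fun p p' q => by
      change invForm F b q.1 (p.2 + p'.2) + invForm F a q.2 (p.1 + p'.1) = _
      rw [map_add, map_add]; ring)
    (fun t p q => by
      change invForm F b q.1 (t • p.2) + invForm F a q.2 (t • p.1) = _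
      rw [map_smul, map_smul, smul_add])
    (fun p q q' => by
      change invForm F b (q.1 + q'.1) p.2 + invForm F a (q.2 + q'.2) p.1 = _
      rw [map_add, map_add, LinearMap.add_apply, LinearMap.add_apply]; ring)
    (fun t p q => by
      change invForm F b (t • q.1) p.2 + invForm F a (t • q.2) p.1 = _
      rw [map_smul, map_smul, smul_add]; rfl)

theorem dualMap_apply (p : E φ) (q : E (negAdjoint φ)) :
    dualMap φ p q = invForm F b q.1 p.2 + invForm F a q.2 p.1 := rfl

theorem dualMap_lie (Y : Gm F m) (p : E φ) : dualMap φ ⁅Y, p⁆ = ⁅Y, dualMap φ p⁆ := by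
  refine LinearMap.ext fun q => ?_
  rw [Module.Dual.lie_apply, dualMap_apply, dualMap_apply]
  change invForm F b q.1 ⁅Y.right, p.2⁆ + invForm F a q.2 (⁅Y.right, p.1⁆ + φ Y.left p.2) =
    -(invForm F b (⁅Y.right, q.1⁆ + negAdjoint φ Y.left q.2) p.2 + invForm F a ⁅Y.right, q.2⁆ p.1)
  rw [map_add, map_add, LinearMap.add_apply, invForm_negAdjoint, invForm_lie, invForm_lie]
  ring

theorem dualMap_injective : Function.Injective (dualMap φ) := by
  refine (injective_iff_map_eq_zero _).mpr fun p hp => ?_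
  have h : ∀ q : E (negAdjoint φ), invForm F b q.1 p.2 + invForm F a q.2 p.1 = 0 := fun q => by
    rw [← dualMap_apply, hp, LinearMap.zero_apply]
  refine Prod.ext (eq_zero_of_forall_invForm fun v => ?_) (eq_zero_of_forall_invForm fun v => ?_)
  · have h1 : invForm F b 0 p.2 + invForm F a v p.1 = 0 := h (0, v)
    simpa using h1
  · have h1 : invForm F b v p.2 + invForm F a 0 p.1 = 0 := h (v, 0)
    simpa using h1

end

theorem isZDual_E {m b : ℕ} {φ : Irr F m →ₗ⁅F, SL2 F⁆ (Irr F b →ₗ[F] Irr F (b + m))} (hφ : φ ≠ 0) :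
    IsZDual F m b (E φ) := by
  have h1 := isSplit_E φ
  have h2 := isSplit_E (negAdjoint φ)
  have : Module.Finite F (E φ) := Module.Finite.equiv (LinearEquiv.ofBijective _ h1.bijective)
  have : Module.Finite F (E (negAdjoint φ)) :=
    Module.Finite.equiv (LinearEquiv.ofBijective _ h2.bijective)
  have hdim : Module.finrank F (E φ) = Module.finrank F (E (negAdjoint φ) →ₗ[F] F) := by
    refine Eq.trans ?_ Subspace.dual_finrank_eq.symm
    rw [h1.finrank_eq, h2.finrank_eq, add_comm]
  exact ⟨negAdjoint φ, negAdjoint_ne_zero hφ,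
    ⟨{ LinearEquiv.ofInjectiveOfFinrankEq (dualMap φ) dualMap_injective hdim with
        map_lie' := fun {Y p} => dualMap_lie Y p }⟩⟩

/-! ### The socle decomposition of `E(a, b)` -/

section

variable {m a b : ℕ} {φ : Irr F m →ₗ⁅F, SL2 F⁆ (Irr F b →ₗ[F] Irr F a)}

/-- A vector of `V(b)` annihilated by `V(m)` is zero, since these vectors form an
`sl(2)`-submodule. -/
theorem eq_zero_of_forall_hom_apply (hφ : φ ≠ 0) {q : Irr F b} (hq : ∀ X, φ X q = 0) : q = 0 := by
  let N : Submodule F (Irr F b) :=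
    { carrier := {v | ∀ X : Irr F m, φ X v = 0}
      add_mem' := fun {v w} hv hw X => by rw [map_add, hv X, hw X, add_zero]
      zero_mem' := fun X => map_zero _
      smul_mem' := fun t v hv X => by rw [map_smul, hv X, smul_zero] }
  have hN : N = ⊥ := by
    refine (Irr.eq_bot_or_eq_top N fun x v hv X => ?_).resolve_right fun htop => hφ ?_
    · have h1 := congrArg (fun T : Irr F b →ₗ[F] Irr F a => T v) (LieModuleHom.map_lie φ x X)
      simp only [LieHom.lie_apply, hv _, lie_zero, zero_sub] at h1
      exact neg_eq_zero.mp h1.symm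
    · refine LieModuleHom.ext fun X => LinearMap.ext fun v => ?_
      have : v ∈ N := by rw [htop]; exact Submodule.mem_top
      exact this X
  have : q ∈ N := hq
  rwa [hN, Submodule.mem_bot] at this

theorem isSocleDecomp_E (hφ : φ ≠ 0) :
    IsSocleDecomp m a b (LinearMap.range (inA φ)) (LinearMap.range (inB φ)) where
  soc_eq := by
    have h := isSplit_E φ
    refine le_antisymm (range_le_soc _ h.injective_left (fun x v => (h.fromSl_left x v).symm)
      fun v X => h.fromV_left X v) fun v hv => ?_
    have hv := soc_le_invariants (fun X Y Z v => h.fromV_fromV X Y _) hv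
    obtain ⟨p, q, rfl⟩ := h.exists_eq v
    have hq : q = 0 := eq_zero_of_forall_hom_apply hφ fun X => by
      have h1 := hv X
      rw [lie_add, h.fromV_left, zero_add, h.fromV_right] at h1
      exact h.injective_left (by rw [h1, map_zero])
    rw [hq, map_zero, add_zero]
    exact ⟨p, rfl⟩
  isCompl := LinearMap.isCompl_range_inl_inr
  left_iso := ⟨LinearEquiv.ofInjective _ (isSplit_E φ).injective_left,
    fun x v => ((isSplit_E φ).fromSl_left x v).symm⟩
  right_iso := ⟨LinearEquiv.ofInjective _ (isSplit_E φ).injective_right,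
    fun x v => ((isSplit_E φ).fromSl_right x v).symm⟩

end

end

/-! ### Square roots of factorials -/

section

variable (σ : SquareRoots F)

/-- The square root of `n!`. -/
def sqrtFact (n : ℕ) : F := σ.sqrt (n.factorial : ℚ≥0)

theorem sqrtFact_sq (n : ℕ) : sqrtFact σ n ^ 2 = (n.factorial : F) := by
  rw [sqrtFact, σ.sq, NNRat.cast_natCast]

theorem sqrtFact_zero : sqrtFact σ 0 = 1 := by
  simp [sqrtFact]

theorem sqrtFact_succ (n : ℕ) : sqrtFact σ (n + 1) = σ.sqrt ((n : ℚ≥0) + 1) * sqrtFact σ n := by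
  rw [sqrtFact, sqrtFact, ← map_mul, Nat.factorial_succ]
  push_cast
  rfl

theorem vec_eq_smul {n k : ℕ} : vec σ n k =
    (sqrtFact σ k * sqrtFact σ (n - k) / sqrtFact σ n) • (wvec n k : Irr F n) := by
  rw [sqrtFact, sqrtFact, sqrtFact, ← map_mul, ← map_div₀]
  funext l
  change (if l.1 = k then _ else 0) = _ * (if l.1 = k then (1 : F) else 0)
  rw [mul_ite, mul_one, mul_zero]

theorem coord_vec {n k l : ℕ} (hl : l ≤ n) : coord (vec σ n k : Irr F n) l =
    if l = k then sqrtFact σ k * sqrtFact σ (n - k) / sqrtFact σ n else 0 := by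
  rw [vec_eq_smul, coord_smul, coord_wvec _ _ hl, mul_ite, mul_one, mul_zero]

/-! ### Clebsch–Gordan coefficients given by a single term -/

theorem cg_eq_zero {a i b j c k : ℕ} (h : 2 * i + 2 * j + c ≠ a + b + 2 * k) :
    cg σ a i b j c k = 0 := by
  rw [cg, if_neg fun h' => h h'.2.2.2.2.2.2.2]

/-- Racah's formula when the sum reduces to the term of index `r`, in terms of the numbers
`n = j₁ + j₂ - j₃`, `p = j₁ - j₂ + j₃`, `q = -j₁ + j₂ + j₃`. -/
theorem cg_eq_single {a i b j c k : ℕ} (n p q r : ℕ) (ha : a = n + p) (hb : b = n + q)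
    (hc : c = p + q) (hi : i ≤ a) (hj : j ≤ b) (hk : k ≤ c) (hw : i + j = n + k)
    (hr : r ≤ n ∧ r ≤ i ∧ r + j ≤ b ∧ i ≤ p + r ∧ n ≤ j + r)
    (huniq : ∀ l, l ≤ n → l ≤ i → l + j ≤ b → i ≤ p + l → n ≤ j + l → l = r) :
    cg σ a i b j c k =
      sqrtFact σ n * sqrtFact σ p * sqrtFact σ q / sqrtFact σ (n + p + q + 1)
      * σ.sqrt ((c : ℚ≥0) + 1)
      * (sqrtFact σ (a - i) * sqrtFact σ i * sqrtFact σ (b - j) * sqrtFact σ j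
          * sqrtFact σ (c - k) * sqrtFact σ k)
      * ((-1) ^ r / (sqrtFact σ r ^ 2 * sqrtFact σ (n - r) ^ 2 * sqrtFact σ (i - r) ^ 2
          * sqrtFact σ (b - j - r) ^ 2 * sqrtFact σ (p + r - i) ^ 2
          * sqrtFact σ (j + r - n) ^ 2)) := by
  have h1 : (a + b - c) / 2 = n := by omega
  have h2 : (a + c - b) / 2 = p := by omega
  have h3 : (b + c - a) / 2 = q := by omega
  have h4 : (a + b + c) / 2 + 1 = n + p + q + 1 := by omega
  have hev : Even (a + b + c) := ⟨n + p + q, by omega⟩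
  rw [cg, if_pos ⟨by omega, by omega, by omega, hev, hi, hj, hk, by omega⟩]
  simp only [h1, h2, h3, h4]
  have hfilter : (Finset.range (n + 1)).filter
      (fun r => r ≤ i ∧ r + j ≤ b ∧ i ≤ p + r ∧ n ≤ j + r) = {r} := by
    ext l
    simp only [Finset.mem_filter, Finset.mem_range, Finset.mem_singleton]
    constructor
    · rintro ⟨h5, h6, h7, h8, h9⟩
      exact huniq l (by omega) h6 h7 h8 h9
    · rintro rfl
      exact ⟨by omega, hr.2⟩
  rw [hfilter, Finset.sum_singleton]
  simp only [sqrtFact_sq, map_div₀, map_mul]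
  rfl

/-! ### The normalized homomorphisms -/

theorem coord_sum_cg_vec {a : ℕ} (g : ℕ → F) {i : ℕ} (hi : i ≤ a) :
    coord (∑ k ∈ Finset.range (a + 1), g k • vec σ a k : Irr F a) i =
      g i * (sqrtFact σ i * sqrtFact σ (a - i) / sqrtFact σ a) := by
  rw [coord_sum, Finset.sum_eq_single i]
  · rw [coord_smul, coord_vec σ hi, if_pos rfl]
  · intro k _ hk
    rw [coord_smul, coord_vec σ hi, if_neg (Ne.symm hk), mul_zero]
  · intro h
    exact absurd (Finset.mem_range.mpr (Nat.lt_succ_of_le hi)) h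

variable [CharZero F]

theorem sqrtFact_ne_zero (n : ℕ) : sqrtFact σ n ≠ 0 := by
  intro h
  have := sqrtFact_sq σ n
  rw [h, zero_pow two_ne_zero] at this
  exact Nat.factorial_ne_zero n (by exact_mod_cast this.symm)

theorem sqrt_succ_ne_zero (n : ℕ) : σ.sqrt ((n : ℚ≥0) + 1) ≠ 0 := by
  intro h
  have := σ.sq ((n : ℚ≥0) + 1)
  rw [h, zero_pow two_ne_zero, NNRat.cast_add, NNRat.cast_natCast, NNRat.cast_one] at this
  exact Nat.cast_add_one_ne_zero n this.symm

theorem choose_eq_sqrtFact {n k : ℕ} (hk : k ≤ n) : (n.choose k : F) =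
    sqrtFact σ n ^ 2 / (sqrtFact σ k ^ 2 * sqrtFact σ (n - k) ^ 2) := by
  rw [Nat.cast_choose F hk, sqrtFact_sq, sqrtFact_sq, sqrtFact_sq]

theorem vec_zero (n : ℕ) : vec σ n 0 = (wvec n 0 : Irr F n) := by
  rw [vec_eq_smul, sqrtFact_zero, one_mul, Nat.sub_zero, div_self (sqrtFact_ne_zero σ n), one_smul]

theorem IsCG.unique {m a b : ℕ} {φ ψ : Irr F m →ₗ⁅F, SL2 F⁆ (Irr F b →ₗ[F] Irr F a)}
    (hφ : IsCG σ φ) (hψ : IsCG σ ψ) : φ = ψ := by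
  refine hom_eq_of_apply ?_
  have h := (hφ m le_rfl 0 (Nat.zero_le b)).trans (hψ m le_rfl 0 (Nat.zero_le b)).symm
  rw [vec_zero, vec_eq_smul, Nat.sub_self, sqrtFact_zero, mul_one,
    div_self (sqrtFact_ne_zero σ m), one_smul] at h
  exact h

/-- The normalized homomorphism `V(m) → Hom(V(a + m), V(a))` as a multiple of the contraction. -/
def contrScalar (m a : ℕ) : F :=
  (-1) ^ m * σ.sqrt ((m : ℚ≥0) + 1) / σ.sqrt (((a + m : ℕ) : ℚ≥0) + 1)

/-- The normalized homomorphism `V(m) → Hom(V(b), V(b + m))` as a multiple of the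
multiplication. -/
def multScalar (m b : ℕ) : F :=
  σ.sqrt ((m : ℚ≥0) + 1) / σ.sqrt (((b + m : ℕ) : ℚ≥0) + 1)

theorem contrScalar_ne_zero (m a : ℕ) : contrScalar σ m a ≠ 0 :=
  div_ne_zero (mul_ne_zero (pow_ne_zero _ (neg_ne_zero.mpr one_ne_zero)) (sqrt_succ_ne_zero σ m))
    (sqrt_succ_ne_zero σ _)

theorem multScalar_ne_zero (m b : ℕ) : multScalar σ m b ≠ 0 :=
  div_ne_zero (sqrt_succ_ne_zero σ m) (sqrt_succ_ne_zero σ _)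

theorem isCG_contr (m a : ℕ) : IsCG σ (contrScalar σ m a • contr F m a) := by
  intro s hs j hj
  refine Irr.ext_coord fun i hi => ?_
  rw [coord_smul, coord_sum_cg_vec σ _ hi, vec_eq_smul, vec_eq_smul, LieModuleHom.smul_apply,
    LinearMap.smul_apply, map_smul, map_smul, LinearMap.smul_apply, coord_smul, coord_smul,
    coord_smul, coord_contr_wvec hs _ hi, coord_wvec _ _ (by omega)]
  by_cases h : i + (m - s) = j
  · obtain ⟨u, rfl⟩ := Nat.exists_eq_add_of_le hs
    obtain ⟨w, rfl⟩ := Nat.exists_eq_add_of_le hi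
    have h : j = i + u := by omega
    subst h
    rw [if_pos (by omega), cg_eq_single σ (a := i + w) (i := i) (b := i + w + (s + u))
      (j := i + w + (s + u) - (i + u)) (c := s + u) (k := s) (i + w) 0 (s + u) i rfl rfl (by omega)
      (by omega) (by omega) (by omega) (by omega) (by omega) (by omega), choose_eq_sqrtFact σ hs,
      contrScalar, show i + w + (s + u) - (i + w + (s + u) - (i + u)) = i + u by omega,
      show i + w + (s + u) - (i + u) = w + s by omega, show s + u - s = u by omega,
      show i + w - i = w by omega, show i - i = 0 by omega, show i + u - i = u by omega,
      show 0 + i - i = 0 by omega, show w + s + i - (i + w) = s by omega,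
      show i + w + 0 + (s + u) + 1 = (i + w + (s + u)) + 1 by omega, sqrtFact_succ, sqrtFact_zero]
    have hsig : (-1 : F) ^ (i + u) * (-1) ^ i = (-1) ^ (s + u) * (-1) ^ s := by
      rw [← pow_add, ← pow_add, show i + u + i = u + 2 * i by ring,
        show s + u + s = u + 2 * s by ring, pow_add, pow_add, pow_mul, pow_mul]
      simp
    have h1 := sqrtFact_ne_zero σ
    have h2 := sqrt_succ_ne_zero σ (i + w + (s + u))
    field_simp [h1]
    linear_combination -hsig
  · rw [if_neg h, cg_eq_zero σ (by omega)]
    ring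

theorem isCG_mult (m b : ℕ) : IsCG σ (multScalar σ m b • mult F m b) := by
  intro s hs j hj
  refine Irr.ext_coord fun i hi => ?_
  rw [coord_smul, coord_sum_cg_vec σ _ hi, vec_eq_smul, vec_eq_smul, LieModuleHom.smul_apply,
    LinearMap.smul_apply, map_smul, map_smul, LinearMap.smul_apply, coord_smul, coord_smul,
    coord_smul]
  have hmul := pcoord_mult_wvec (F := F) hs (wvec b j) (i : ℤ)
  rw [pcoord_natCast, pcoord_wvec] at hmul
  have hc := choose_ne_zero (F := F) hi
  rw [mul_comm, ← eq_div_iff hc] at hmul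
  rw [hmul]
  by_cases h : i = j + s
  · subst h
    obtain ⟨u, rfl⟩ := Nat.exists_eq_add_of_le hs
    obtain ⟨w, rfl⟩ := Nat.exists_eq_add_of_le hj
    rw [if_pos (by push_cast; ring), cg_eq_single σ (a := j + w + (s + u)) (i := j + s) (b := j + w)
      (j := j + w - j) (c := s + u) (k := s) (j + w) (s + u) 0 j rfl rfl rfl
      (by omega) (by omega) (by omega) (by omega) (by omega) (by omega), choose_eq_sqrtFact σ hs,
      choose_eq_sqrtFact σ hj, choose_eq_sqrtFact σ hi, multScalar,
      show j + w - (j + w - j) = j by omega, show j + w - j = w by omega,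
      show s + u - s = u by omega, show j + w + (s + u) - (j + s) = w + u by omega,
      show j - j = 0 by omega, show j + s - j = s by omega,
      show s + u + j - (j + s) = u by omega, show w + j - (j + w) = 0 by omega,
      show j + w + (s + u) + 0 + 1 = (j + w + (s + u)) + 1 by omega, sqrtFact_succ, sqrtFact_zero]
    have hsig : (-1 : F) ^ j * (-1) ^ j = 1 := by
      rw [← mul_pow]; simp
    have h1 := sqrtFact_ne_zero σ
    have h2 := sqrt_succ_ne_zero σ (j + w + (s + u))
    field_simp [h1]
    linear_combination -hsig
  · rw [if_neg (by omega), cg_eq_zero σ (by omega)]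
    ring

end

section

variable (σ : SquareRoots F)

/-! ### The highest weight vectors -/

theorem tcoord_cgVec {a b c r i k : ℕ} (hi : i ≤ a) (hk : k ≤ b) :
    tcoord i k (cgVec σ a b c r) = cg σ a i b k c r *
      (sqrtFact σ i * sqrtFact σ (a - i) / sqrtFact σ a) *
      (sqrtFact σ k * sqrtFact σ (b - k) / sqrtFact σ b) := by
  simp only [cgVec, map_sum, map_smul, tensorForm_tmul, coordL_apply, coord_vec σ hi,
    coord_vec σ hk, smul_eq_mul]
  rw [Finset.sum_eq_single i, Finset.sum_eq_single k]
  · rw [if_pos rfl, if_pos rfl, mul_assoc]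
  · intro l _ hl
    rw [if_neg (Ne.symm hl), mul_zero, mul_zero]
  · intro h
    exact absurd (Finset.mem_range.mpr (Nat.lt_succ_of_le hk)) h
  · intro l _ hl
    refine Finset.sum_eq_zero fun j _ => ?_
    rw [if_neg (Ne.symm hl), zero_mul, mul_zero]
  · intro h
    exact absurd (Finset.mem_range.mpr (Nat.lt_succ_of_le hi)) h

theorem tcoord_comm {a d : ℕ} (i k : ℕ) (t : Irr F a ⊗[F] Irr F d) :
    tcoord k i (TensorProduct.comm F _ _ t) = tcoord i k t := by
  induction t with
  | zero => simp
  | tmul p q => simp [mul_comm]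
  | add s t hs ht => rw [map_add, map_add, map_add, hs, ht]

variable [CharZero F]

theorem cgVec_eq_polar {a d μ : ℕ} (hμ : a + d = μ) :
    cgVec σ a d μ 0 = polar F a d μ (wvec μ 0) := by
  refine ext_tcoord fun i hi k hk => ?_
  rw [tcoord_cgVec σ hi hk, tcoord_polar _ hi hk, coord_wvec _ _ (by omega)]
  by_cases h : i + k = 0
  · obtain ⟨rfl, rfl⟩ : i = 0 ∧ k = 0 := by omega
    rw [if_pos rfl, cg_eq_single σ (a := a) (i := 0) (b := d) (j := 0) (c := μ) (k := 0) 0 a d 0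
      (by omega) (by omega) (by omega) (by omega) (by omega) (by omega) (by omega) (by omega)
      (by omega), show 0 + a + d + 1 = μ + 1 by omega, sqrtFact_succ]
    have h1 := sqrtFact_ne_zero σ
    have h2 := sqrt_succ_ne_zero σ μ
    simp only [Nat.sub_zero, Nat.sub_self, Nat.add_zero, sqrtFact_zero]
    field_simp [h1]
  · rw [if_neg h, cg_eq_zero σ (by omega), zero_mul, zero_mul]

theorem tcoord_skewPolar {a d μ : ℕ} (hμ : μ + a = d) {i k : ℕ} (hi : i ≤ a) (hk : k ≤ d) :
    tcoord i k (skewPolar F a d μ (wvec μ 0)) =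
      if i + k = a then (-1) ^ i / (d.choose k : F) else 0 := by
  have h := mcoord_skewPolar hμ (wvec μ 0 : Irr F μ) hi k
  have hc := choose_ne_zero (F := F) hk
  rw [mcoord_natCast, mul_comm, ← eq_div_iff hc, pcoord_wvec] at h
  rw [h]
  by_cases h' : i + k = a
  · rw [if_pos h', if_pos (by omega), Nat.choose_zero_right, Nat.cast_one, mul_one]
  · rw [if_neg h', if_neg (by omega), mul_zero, zero_div]

theorem cgVec_eq_skewPolar {a d μ : ℕ} (hμ : μ + a = d) : cgVec σ a d μ 0 =
    (σ.sqrt ((μ : ℚ≥0) + 1) / σ.sqrt ((d : ℚ≥0) + 1)) • skewPolar F a d μ (wvec μ 0) := by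
  refine ext_tcoord fun i hi k hk => ?_
  rw [tcoord_cgVec σ hi hk, map_smul, tcoord_skewPolar hμ hi hk, smul_eq_mul]
  by_cases h : i + k = a
  · rw [if_pos h, cg_eq_single σ (a := a) (i := i) (b := d) (j := k) (c := μ) (k := 0) a 0 μ i
      (by omega) (by omega) (by omega) (by omega) (by omega) (by omega) (by omega) (by omega)
      (by omega), choose_eq_sqrtFact σ hk, show a + 0 + μ + 1 = d + 1 by omega, sqrtFact_succ,
      show a - i = k by omega, show d - k - i = μ by omega, show k + i - a = 0 by omega,
      show 0 + i - i = 0 by omega, Nat.sub_self, Nat.sub_zero, sqrtFact_zero]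
    have h1 := sqrtFact_ne_zero σ
    have h2 := sqrt_succ_ne_zero σ d
    field_simp [h1]
  · rw [if_neg h, cg_eq_zero σ (by omega)]
    ring

/-- The case of `cgVec_eq_skewPolar` in which the second factor is the smaller one; reversing the
order of the factors costs the sign `(-1)^d`. -/
theorem cgVec_eq_comm_skewPolar {a d μ : ℕ} (hμ : μ + d = a) : cgVec σ a d μ 0 =
    ((-1) ^ d * σ.sqrt ((μ : ℚ≥0) + 1) / σ.sqrt ((a : ℚ≥0) + 1)) •
      TensorProduct.comm F _ _ (skewPolar F d a μ (wvec μ 0)) := by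
  refine ext_tcoord fun i hi k hk => ?_
  rw [tcoord_cgVec σ hi hk, map_smul, tcoord_comm, tcoord_skewPolar hμ hk hi, smul_eq_mul]
  by_cases h : k + i = d
  · rw [if_pos h, cg_eq_single σ (a := a) (i := i) (b := d) (j := k) (c := μ) (k := 0) d μ 0 i
      (by omega) (by omega) (by omega) (by omega) (by omega) (by omega) (by omega) (by omega)
      (by omega), choose_eq_sqrtFact σ hi, show d + μ + 0 + 1 = a + 1 by omega, sqrtFact_succ,
      show d - i = k by omega, show d - k = i by omega, show k + i - d = 0 by omega,
      show μ + i - i = μ by omega, Nat.sub_self, Nat.sub_zero, sqrtFact_zero]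
    have hsig : (-1 : F) ^ i = (-1) ^ d * (-1) ^ k := by
      rw [← pow_add, ← h, show k + i + k = i + 2 * k by ring, pow_add, pow_mul]
      simp
    have h1 := sqrtFact_ne_zero σ
    have h2 := sqrt_succ_ne_zero σ a
    rw [hsig]
    field_simp [h1]
  · rw [if_neg h, cg_eq_zero σ (by omega)]
    ring

/-- If the compatible pairs for `ψ₁` and `ψ₂` are parametrized by `V(μ)`, then, for multiples `φ₁`
and `φ₂` of `ψ₁` and `ψ₂`, the vector `u0` is a highest weight vector of `S_1` as soon as its two
components are the images of a multiple of `w_0`. -/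
theorem isHighestWeight_u0 {m a b c d μ : ℕ} {ψ₁ : Irr F m →ₗ⁅F, SL2 F⁆ (Irr F b →ₗ[F] Irr F a)}
    {ψ₂ : Irr F m →ₗ⁅F, SL2 F⁆ (Irr F d →ₗ[F] Irr F c)} {t₁ t₂ : F} (ht₁ : t₁ ≠ 0) (ht₂ : t₂ ≠ 0)
    {θ₁ : Irr F μ →ₗ[F] Irr F a ⊗[F] Irr F d} {θ₂ : Irr F μ →ₗ[F] Irr F b ⊗[F] Irr F c}
    (h : IsParam ψ₁ ψ₂ θ₁ θ₂) {κ ε : F} (hκ : κ ≠ 0)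
    (h₁ : σ.sqrt ((d : ℚ≥0) + 1) • cgVec σ a d μ 0 = (κ * t₂⁻¹) • θ₁ (wvec μ 0))
    (h₂ : (ε * σ.sqrt ((b : ℚ≥0) + 1)) • cgVec σ b c μ 0 = -(κ * t₁⁻¹) • θ₂ (wvec μ 0)) :
    IsHighestWeight m (S1 m (LinearMap.range (inA (t₁ • ψ₁))) (LinearMap.range (inB (t₁ • ψ₁)))
      (LinearMap.range (inA (t₂ • ψ₂))) (LinearMap.range (inB (t₂ • ψ₂)))) μ
      (u0 σ (t₁ • ψ₁) (t₂ • ψ₂) μ ε) := by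
  have hs₁ := (isSplit_E (t₁ • ψ₁)).smul_right ht₁
  have hs₂ := (isSplit_E (t₂ • ψ₂)).smul_right ht₂
  have hw := h.isHighestWeight hs₁ hs₂ hκ
  rw [LinearMap.range_smul _ _ (inv_ne_zero ht₁), LinearMap.range_smul _ _ (inv_ne_zero ht₂)] at hw
  convert hw using 1
  have e₁ := congrArg (TensorProduct.map (inA (t₁ • ψ₁)) (inB (t₂ • ψ₂))) h₁
  have e₂ := congrArg (TensorProduct.map (inB (t₁ • ψ₁)) (inA (t₂ • ψ₂))) h₂
  rw [map_smul, map_smul] at e₁ e₂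
  rw [u0, e₁, e₂, paramMap_apply, TensorProduct.map_smul_left, TensorProduct.map_smul_right,
    LinearMap.smul_apply, LinearMap.smul_apply, smul_add, smul_smul, smul_smul, neg_smul,
    sub_neg_eq_add]

theorem isHighestWeight_contr_contr {m : ℕ} (hm : 1 ≤ m) (a c : ℕ) :
    IsHighestWeight m
      (S1 m (LinearMap.range (inA (contrScalar σ m a • contr F m a)))
        (LinearMap.range (inB (contrScalar σ m a • contr F m a)))
        (LinearMap.range (inA (contrScalar σ m c • contr F m c)))
        (LinearMap.range (inB (contrScalar σ m c • contr F m c)))) (a + (c + m))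
      (u0 σ (contrScalar σ m a • contr F m a) (contrScalar σ m c • contr F m c)
        (a + (c + m)) 1) := by
  have h0 := sqrt_succ_ne_zero σ
  have hu : (-1 : F) ^ m ≠ 0 := pow_ne_zero _ (neg_ne_zero.mpr one_ne_zero)
  -- `κ` is the common value of `√(d + 1) t₂` and `√(b + 1) t₁`
  refine isHighestWeight_u0 σ (contrScalar_ne_zero σ m a) (contrScalar_ne_zero σ m c)
    (isParam_contr_contr hm) (κ := (-1) ^ m * σ.sqrt ((m : ℚ≥0) + 1)) (mul_ne_zero hu (h0 m)) ?_ ?_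
  · rw [cgVec_eq_polar σ rfl, contrScalar, inv_div]
    congr 1
    field_simp [h0]
  · rw [cgVec_eq_polar σ (by omega), contrScalar, inv_div, LinearMap.neg_apply, smul_neg, neg_smul,
      neg_neg]
    congr 1
    field_simp [h0]

theorem isHighestWeight_contr_mult {m : ℕ} (hm : 1 ≤ m) {a d : ℕ} (had : a ≤ d) :
    IsHighestWeight m
      (S1 m (LinearMap.range (inA (contrScalar σ m a • contr F m a)))
        (LinearMap.range (inB (contrScalar σ m a • contr F m a)))
        (LinearMap.range (inA (multScalar σ m d • mult F m d)))
        (LinearMap.range (inB (multScalar σ m d • mult F m d)))) (d - a)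
      (u0 σ (contrScalar σ m a • contr F m a) (multScalar σ m d • mult F m d) (d - a) 1) := by
  have h0 := sqrt_succ_ne_zero σ
  have hu : (-1 : F) ^ m ≠ 0 := pow_ne_zero _ (neg_ne_zero.mpr one_ne_zero)
  -- `κ` is determined by the first component; the second one confirms it
  refine isHighestWeight_u0 σ (contrScalar_ne_zero σ m a) (multScalar_ne_zero σ m d)
    (isParam_contr_mult hm (Nat.sub_add_cancel had))
    (κ := multScalar σ m d * σ.sqrt (((d - a : ℕ) : ℚ≥0) + 1))
    (mul_ne_zero (multScalar_ne_zero σ m d) (h0 _)) ?_ ?_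
  · rw [cgVec_eq_skewPolar σ (Nat.sub_add_cancel had), smul_smul]
    congr 1
    have := multScalar_ne_zero σ m d
    field_simp [h0]
  · rw [cgVec_eq_skewPolar σ (by omega), smul_smul, LinearMap.smul_apply, smul_smul, contrScalar,
      multScalar, inv_div]
    congr 1
    field_simp [h0]

theorem isHighestWeight_mult_contr {m : ℕ} (hm : 1 ≤ m) {b c : ℕ} (hcb : c ≤ b) :
    IsHighestWeight m
      (S1 m (LinearMap.range (inA (multScalar σ m b • mult F m b)))
        (LinearMap.range (inB (multScalar σ m b • mult F m b)))
        (LinearMap.range (inA (contrScalar σ m c • contr F m c)))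
        (LinearMap.range (inB (contrScalar σ m c • contr F m c)))) (b - c)
      (u0 σ (multScalar σ m b • mult F m b) (contrScalar σ m c • contr F m c) (b - c)
        ((-1) ^ m)) := by
  have h0 := sqrt_succ_ne_zero σ
  have hu : ∀ n, (-1 : F) ^ n ≠ 0 := fun n => pow_ne_zero _ (neg_ne_zero.mpr one_ne_zero)
  -- `κ` is determined by the second component; comparison with the first one, where the scalar
  -- `contrScalar` enters, is what requires `ε = (-1)^m`
  refine isHighestWeight_u0 σ (multScalar_ne_zero σ m b) (contrScalar_ne_zero σ m c)
    (isParam_contr_mult hm (Nat.sub_add_cancel hcb)).swap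
    (κ := -((-1) ^ m * (-1) ^ c * multScalar σ m b * σ.sqrt (((b - c : ℕ) : ℚ≥0) + 1)))
    (neg_ne_zero.mpr (mul_ne_zero (mul_ne_zero (mul_ne_zero (hu m) (hu c))
      (multScalar_ne_zero σ m b)) (h0 _))) ?_ ?_
  · rw [cgVec_eq_comm_skewPolar σ (show b - c + (c + m) = b + m by omega), smul_smul,
      LinearMap.comp_apply, LinearMap.smul_apply, map_smul, smul_smul, contrScalar, multScalar,
      inv_div]
    congr 1
    have hu' := hu m
    rw [pow_add]
    field_simp [h0]
  · rw [cgVec_eq_comm_skewPolar σ (Nat.sub_add_cancel hcb), smul_smul, LinearMap.comp_apply]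
    congr 1
    have := multScalar_ne_zero σ m b
    field_simp [h0]

end

end UniserialSl2

end

open scoped TensorProduct
open UniserialSl2
theorem theorem3p3 (F : Type*) [Field F] [CharZero F] (m : ℕ) (hm : 1 ≤ m) :
    -- the table, for arbitrary modules of type `Z` of length two with socle decompositions
    -- `V₁ = A ⊕ B` and `V₂ = C ⊕ D`
    (∀ (V₁ V₂ : Type*) [AddCommGroup V₁] [Module F V₁] [LieRingModule (Gm F m) V₁]
        [LieModule F (Gm F m) V₁] [AddCommGroup V₂] [Module F V₂] [LieRingModule (Gm F m) V₂]
        [LieModule F (Gm F m) V₂] (a b c d : ℕ) (A B : Submodule F V₁) (C D : Submodule F V₂),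
        IsSocleDecomp m a b A B → IsSocleDecomp m c d C D →
        (IsZ F m a V₁ → IsZ F m c V₂ → IsoIrr m (S1 m A B C D) (a + d)) ∧
        (IsZ F m a V₁ → IsZDual F m d V₂ →
          (a ≤ d → IsoIrr m (S1 m A B C D) (d - a)) ∧ (d < a → S1 m A B C D = ⊥)) ∧
        (IsZDual F m b V₁ → IsZ F m c V₂ →
          (c ≤ b → IsoIrr m (S1 m A B C D) (b - c)) ∧ (b < c → S1 m A B C D = ⊥)) ∧
        (IsZDual F m b V₁ → IsZDual F m d V₂ → S1 m A B C D = ⊥)) ∧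
    -- the highest weight vectors, for the normalized modules
    (∀ σ : SquareRoots F,
      -- the normalized modules `E(a, a + m) = Z(a, 1)` and `E(b + m, b) ≃ Z(b, 1)^*`
      (∀ a : ℕ, ∃! φ : Irr F m →ₗ⁅F, SL2 F⁆ (Irr F (a + m) →ₗ[F] Irr F a), IsCG σ φ) ∧
      (∀ (a : ℕ) (φ : Irr F m →ₗ⁅F, SL2 F⁆ (Irr F (a + m) →ₗ[F] Irr F a)), IsCG σ φ →
        IsZ F m a (E φ) ∧ IsSocleDecomp m a (a + m) (LinearMap.range (inA φ))
          (LinearMap.range (inB φ))) ∧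
      (∀ b : ℕ, ∃! φ : Irr F m →ₗ⁅F, SL2 F⁆ (Irr F b →ₗ[F] Irr F (b + m)), IsCG σ φ) ∧
      (∀ (b : ℕ) (φ : Irr F m →ₗ⁅F, SL2 F⁆ (Irr F b →ₗ[F] Irr F (b + m))), IsCG σ φ →
        IsZDual F m b (E φ) ∧ IsSocleDecomp m (b + m) b (LinearMap.range (inA φ))
          (LinearMap.range (inB φ))) ∧
      -- entry (1,1): `b = a + m`, `d = c + m`
      (∀ (a c : ℕ) (φ₁ : Irr F m →ₗ⁅F, SL2 F⁆ (Irr F (a + m) →ₗ[F] Irr F a))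
          (φ₂ : Irr F m →ₗ⁅F, SL2 F⁆ (Irr F (c + m) →ₗ[F] Irr F c)),
          IsCG σ φ₁ → IsCG σ φ₂ →
          IsHighestWeight m
            (S1 m (LinearMap.range (inA φ₁)) (LinearMap.range (inB φ₁))
              (LinearMap.range (inA φ₂)) (LinearMap.range (inB φ₂)))
            (a + (c + m)) (u0 σ φ₁ φ₂ (a + (c + m)) 1)) ∧
      -- entry (1,2): `b = a + m`, `c = d + m`
      (∀ (a d : ℕ) (φ₁ : Irr F m →ₗ⁅F, SL2 F⁆ (Irr F (a + m) →ₗ[F] Irr F a))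
          (φ₂ : Irr F m →ₗ⁅F, SL2 F⁆ (Irr F d →ₗ[F] Irr F (d + m))),
          IsCG σ φ₁ → IsCG σ φ₂ → a ≤ d →
          IsHighestWeight m
            (S1 m (LinearMap.range (inA φ₁)) (LinearMap.range (inB φ₁))
              (LinearMap.range (inA φ₂)) (LinearMap.range (inB φ₂)))
            (d - a) (u0 σ φ₁ φ₂ (d - a) 1)) ∧
      -- entry (2,1): `a = b + m`, `d = c + m`
      (∀ (b c : ℕ) (φ₁ : Irr F m →ₗ⁅F, SL2 F⁆ (Irr F b →ₗ[F] Irr F (b + m)))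
          (φ₂ : Irr F m →ₗ⁅F, SL2 F⁆ (Irr F (c + m) →ₗ[F] Irr F c)),
          IsCG σ φ₁ → IsCG σ φ₂ → c ≤ b →
          IsHighestWeight m
            (S1 m (LinearMap.range (inA φ₁)) (LinearMap.range (inB φ₁))
              (LinearMap.range (inA φ₂)) (LinearMap.range (inB φ₂)))
            (b - c) (u0 σ φ₁ φ₂ (b - c) ((-1) ^ m)))) := by
  refine ⟨fun V₁ V₂ _ _ _ _ _ _ _ _ a b c d A B C D h₁ h₂ => S1_table hm h₁ h₂,
    fun σ => ⟨fun a => ?_, fun a φ hφ => ?_, fun b => ?_, fun b φ hφ => ?_,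
      fun a c φ₁ φ₂ h₁ h₂ => ?_, fun a d φ₁ φ₂ h₁ h₂ had => ?_, fun b c φ₁ φ₂ h₁ h₂ hcb => ?_⟩⟩
  · exact ⟨_, isCG_contr σ m a, fun φ hφ => hφ.unique σ (isCG_contr σ m a)⟩
  · obtain rfl := hφ.unique σ (isCG_contr σ m a)
    have h := smul_ne_zero (contrScalar_ne_zero σ m a) (contr_ne_zero (F := F) m a)
    exact ⟨isZ_E h, isSocleDecomp_E h⟩
  · exact ⟨_, isCG_mult σ m b, fun φ hφ => hφ.unique σ (isCG_mult σ m b)⟩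
  · obtain rfl := hφ.unique σ (isCG_mult σ m b)
    have h := smul_ne_zero (multScalar_ne_zero σ m b) (mult_ne_zero (F := F) m b)
    exact ⟨isZDual_E h, isSocleDecomp_E h⟩
  · obtain rfl := h₁.unique σ (isCG_contr σ m a)
    obtain rfl := h₂.unique σ (isCG_contr σ m c)
    exact isHighestWeight_contr_contr σ hm a c
  · obtain rfl := h₁.unique σ (isCG_contr σ m a)
    obtain rfl := h₂.unique σ (isCG_mult σ m d)
    exact isHighestWeight_contr_mult σ hm had
  · obtain rfl := h₁.unique σ (isCG_mult σ m b)
    obtain rfl := h₂.unique σ (isCG_contr σ m c)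
    exact isHighestWeight_mult_contr σ hm hcb
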